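/- Let $V_l,V_m,V_r:\mathbb R\to\mathbb R$ be $C^3$ functions and $\alpha\ge 0$. For $L>0$ put $V(u,x)=V_l(u)$ for $x<-L$, $V_m(u)$ for $|x|<L$, $V_r(u)$ for $x>L$, and consider the wave equation $u_{tt}=u_{xx}+\partial_uV(u,x)-\alpha u_t$. A stationary front joining $u_-$ to $u_+$ is a $C^1$ function $u$ on $\mathbb R$ with $u''+\partial_uV(u,x)=0$ for $x\ne\pm L$, $u(x)\to u_\pm$ as $x\to\pm\infty$, and $u'(x)\to0$ exponentially fast as $x\to\pm\infty$ (solitary waves, $u_-=u_+$, are included). Its linearisation is $\mathcal L\Psi=\Psi''+\partial_u^2V(u(x),x)\Psi$ with domain $H^2(\mathbb R)$. The front is called stable if no $\lambda\in\mathbb C$ with $\operatorname{Re}\lambda>0$ is an eigenvalue of the linearised wave equation, that is, satisfies $\lambda^2\Psi=\mathcal L\Psi-\alpha\lambda\Psi$ for some $0\neq\Psi\in H^2(\mathbb R;\mathbb C)$, and unstable otherwise. Let $J\subset\mathbb R$ be open and let $u_{\rm f}(\cdot\,;g)$, $g\in J$, be a branch of stationary fronts joining fixed states $u_-$ and $u_+$,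 with middle interval $(-L(g),L(g))$, $L(g)>0$, such that $\tfrac12(\partial_xu_{\rm f})^2+V_m(u_{\rm f})=g$ on the middle interval, the length curve $L$ is continuously differentiable on $J$, and the boundary values $u_l=u_{\rm f}(-L(g);g)$, $p_l=\partial_xu_{\rm f}(-L(g);g)$, $u_r=u_{\rm f}(L(g);g)$, $p_r=\partial_xu_{\rm f}(L(g);g)$ are continuous in $g$. Assume that no $g\in J$ is a bifurcation value, i.e. $\mathscr B_l(g)=p_l\,[V_m'(u_l)-V_l'(u_l)]\ne0$ and $\mathscr B_r(g)=p_r\,[V_r'(u_r)-V_m'(u_r)]\neq0$, and that for every $g\in J$ all zeros of $\partial_xu_{\rm f}(\cdot\,;g)$ are simple. Write $\mathcal L(g)$ for the linearisation about $u_{\rm f}(\cdot\,;g)$. Let $\widehat g\in J$ be such that $L'$ does not vanish to infinite order at $\widehat g$: for some $n\ge0$, $L'$ is $C^n$ near $\widehat g$, its derivatives of order less than $n$ vanish at $\widehat g$ and that of order $n$ does not; $n$ is the order of vanishing of $L'$ at $\widehat g$ ($n=0$ if $L'(\widehat g)\neq0$). If $L'(\widehat g)=0$, then $0$ is a simple eigenvalue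 of $\mathcal L(\widehat g)$; its eigenfunction, unique up to scalar multiples, is denoted $\Psi(\widehat g)$. There is a change of stability at $\widehat g$ (the fronts $u_{\rm f}(\cdot\,;g)$ are stable for all $g$ close to $\widehat g$ on one side of $\widehat g$, and unstable for all $g$ close to $\widehat g$ on the other side) if and only if 1. $L'(\widehat g)=0$; 2. the order of the zero $\widehat g$ of $L'$ is odd; 3. the eigenfunction $\Psi(\widehat g)$ has no zeros. If 1 and 2 hold (whether or not 3 does), then the number of positive eigenvalues of $\mathcal L(g)$ changes by one as $g$ crosses $\widehat g$: there is $N\in\mathbb N$ such that it equals $N$ for all $g$ close to $\widehat g$ on one side, and $N+1$ for all $g$ close to $\widehat g$ on the other side. -/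

import Mathlib

open Filter Topology MeasureTheory

noncomputable section

namespace InhomWave

/-- The three `C³` potentials of the inhomogeneous wave equation
`u_tt = u_xx + ∂V/∂u(u, x) - α u_t`: `left` on `(-∞, -L)`, `mid` on `(-L, L)` and `right` on
`(L, ∞)`. -/
structure Potential where
  left : ℝ → ℝ
  mid : ℝ → ℝ
  right : ℝ → ℝ
  left_smooth : ContDiff ℝ 3 left
  mid_smooth : ContDiff ℝ 3 mid
  right_smooth : ContDiff ℝ 3 right

/-- The potential `u ↦ V(u, x)` that is in force at the point `x` if the middle interval is
`(-L, L)`. The choice at the two points `x = ±L` plays no role below. -/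
def Potential.V (P : Potential) (L x : ℝ) : ℝ → ℝ :=
  if x < -L then P.left else if x ≤ L then P.mid else P.right

/-- `u` is a stationary front for the middle interval `(-L, L)` that joins the steady states `um`
(at `-∞`) and `up` (at `+∞`): a `C¹` solution of `u'' + ∂V/∂u(u, x) = 0` on the three open
intervals, with `u'` decaying exponentially. (`um = up`, a solitary wave, is allowed.) -/
structure IsFront (P : Potential) (L um up : ℝ) (u : ℝ → ℝ) : Prop where
  smooth : ContDiff ℝ 1 u
  ode : ∀ x, x ≠ -L → x ≠ L → HasDerivAt (deriv u) (-deriv (P.V L x) (u x)) x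
  tendsto_left : Tendsto u atBot (𝓝 um)
  tendsto_right : Tendsto u atTop (𝓝 up)
  decay : ∃ C κ : ℝ, 0 < κ ∧ ∀ x, |deriv u x| ≤ C * Real.exp (-κ * |x|)

/-- A branch of stationary fronts `u g`, with middle interval `(-L g, L g)`, parametrised by the
value `g ∈ J` of the Hamiltonian `u'² / 2 + V_m(u)` in the middle interval. The length curve is
continuously differentiable, and the values of `u` and `u'` at the two ends of the middle interval
depend continuously on `g`. -/
structure IsFrontBranch (P : Potential) (um up : ℝ) (J : Set ℝ) (L : ℝ → ℝ) (u : ℝ → ℝ → ℝ) :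
    Prop where
  isOpen : IsOpen J
  length_pos : ∀ g ∈ J, 0 < L g
  front : ∀ g ∈ J, IsFront P (L g) um up (u g)
  hamiltonian : ∀ g ∈ J, ∀ x ∈ Set.Ioo (-L g) (L g),
    (deriv (u g) x) ^ 2 / 2 + P.mid (u g x) = g
  length_smooth : ContDiffOn ℝ 1 L J
  continuous_ul : ContinuousOn (fun g => u g (-L g)) J
  continuous_pl : ContinuousOn (fun g => deriv (u g) (-L g)) J
  continuous_ur : ContinuousOn (fun g => u g (L g)) J
  continuous_pr : ContinuousOn (fun g => deriv (u g) (L g)) J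

/-- The left bifurcation function `p_l (V_m'(u_l) - V_l'(u_l))`. -/
def bifLeft (P : Potential) (L : ℝ) (u : ℝ → ℝ) : ℝ :=
  deriv u (-L) * (deriv P.mid (u (-L)) - deriv P.left (u (-L)))

/-- The right bifurcation function `p_r (V_r'(u_r) - V_m'(u_r))`. -/
def bifRight (P : Potential) (L : ℝ) (u : ℝ → ℝ) : ℝ :=
  deriv u L * (deriv P.right (u L) - deriv P.mid (u L))

/-- Membership in `H²(ℝ)`, for the `C¹` representative: `Ψ` is differentiable, `Ψ'` is locally
absolutely continuous, and `Ψ`, `Ψ'`, `Ψ''` are square integrable. -/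
structure MemH2 {F : Type*} [NormedAddCommGroup F] [NormedSpace ℝ F] (Ψ : ℝ → F) : Prop where
  differentiable : Differentiable ℝ Ψ
  absolutelyContinuous : ∀ a b, AbsolutelyContinuousOnInterval (deriv Ψ) a b
  memLp : MemLp Ψ 2 volume
  memLp_deriv : MemLp (deriv Ψ) 2 volume
  memLp_deriv_deriv : MemLp (deriv (deriv Ψ)) 2 volume

/-- The linearisation `𝓛 Ψ = Ψ'' + ∂²V/∂u²(u(x), x) Ψ` about `u`. -/
def linearisation {F : Type*} [NormedAddCommGroup F] [NormedSpace ℝ F]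
    (P : Potential) (L : ℝ) (u : ℝ → ℝ) (Ψ : ℝ → F) (x : ℝ) : F :=
  deriv (deriv Ψ) x + iteratedDeriv 2 (P.V L x) (u x) • Ψ x

/-- `Ψ ∈ H²(ℝ)` is an eigenfunction of the linearisation for the eigenvalue `Λ`. -/
def IsEigenfunction (P : Potential) (L : ℝ) (u : ℝ → ℝ) (Λ : ℝ) (Ψ : ℝ → ℝ) : Prop :=
  MemH2 Ψ ∧ Ψ ≠ 0 ∧ ∀ᵐ x, linearisation P L u Ψ x = Λ * Ψ x

/-- The set of positive eigenvalues of the linearisation. -/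
def positiveEigenvalues (P : Potential) (L : ℝ) (u : ℝ → ℝ) : Set ℝ :=
  {Λ | 0 < Λ ∧ ∃ Ψ, IsEigenfunction P L u Λ Ψ}

/-- `z` is an eigenvalue of the wave equation with damping `α`, linearised about `u`: there is a
mode `exp(z t) Ψ(x)` with `0 ≠ Ψ ∈ H²(ℝ; ℂ)` and `z² Ψ = 𝓛 Ψ - α z Ψ`. -/
def IsSpectralEigenvalue (P : Potential) (α L : ℝ) (u : ℝ → ℝ) (z : ℂ) : Prop :=
  ∃ Ψ : ℝ → ℂ, MemH2 Ψ ∧ Ψ ≠ 0 ∧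
    ∀ᵐ x, z ^ 2 * Ψ x = linearisation P L u Ψ x - (α : ℂ) * z * Ψ x

/-- The front `u` is (spectrally) stable: no eigenvalue has positive real part. -/
def IsStable (P : Potential) (α L : ℝ) (u : ℝ → ℝ) : Prop :=
  ∀ z : ℂ, IsSpectralEigenvalue P α L u z → z.re ≤ 0

/-- The property `S` changes at `a`: it holds at all points close to `a` on one side and fails at
all points close to `a` on the other side. -/
def ChangesAt (S : ℝ → Prop) (a : ℝ) : Prop :=
  ((∀ᶠ g in 𝓝[<] a, S g) ∧ ∀ᶠ g in 𝓝[>] a, ¬ S g) ∨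
    ((∀ᶠ g in 𝓝[<] a, ¬ S g) ∧ ∀ᶠ g in 𝓝[>] a, S g)

/-- `f` vanishes at `a` to order exactly `n` (order `0` means `f a ≠ 0`). -/
def VanishesToOrder (f : ℝ → ℝ) (a : ℝ) (n : ℕ) : Prop :=
  ContDiffAt ℝ n f a ∧ (∀ k < n, iteratedDeriv k f a = 0) ∧ iteratedDeriv n f a ≠ 0

end InhomWave

end

/-! Write a solution of ψ'' + (q - Λ)ψ = 0 as ψ = ρ sin θ, ψ' = ρ cos θ. For Λ ≥ 0 the solutions
that decay at -∞ have the angle that remains in [0, π/2] near -∞ (`leftAngle`). It is continued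
through the middle interval; the solutions that decay at +∞ are treated by reflection. The sum F(Λ)
of the two angles at the right junction (`matchAngle`) is a multiple of π exactly when the decaying
solutions match, that is, when Λ is an eigenvalue. F is positive, continuous and strictly
decreasing, and lies below π for large Λ, so the number of positive eigenvalues is the number of
levels kπ, k ≥ 1, below F(0) (`encard_positiveEigenvalues`). If F(0) = kπ, then 0 is a simple
eigenvalue, and its eigenfunction has no zeros iff k = 1 (`exists_eigenfunction_zero`). Symmetry of
the linearisation and α ≥ 0 turn stability into the absence of positive eigenvalues
(`isStable_iff`).

It remains to follow F(0), the `frontAngle`, along the branch. On a tail u' is itself the decaying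
solution for Λ = 0, so the angle of the tail can be read off from (u', -V'(u)) at its end point
(`IsTail.leftAngle_spec`); in the middle a Grönwall argument applies. Hence the front angle is
continuous in g. Next, the branch is differentiated in g. In the middle interval the pairing of this
variation with the solution ψ continued from the left tail is conserved, up to a term proportional
to L'. The energy identities make the variation of each end state a multiple of (u', -V'(u)) of the
adjacent tail, divided by a bifurcation function. The left pairing therefore vanishes and the right
one is a multiple of sin F(0). The outcome (`exists_sin_frontAngle_eq`) is sin F(0) = m · S · L'
with m > 0 and S the `orientation`, which is continuous and never zero.

So L' vanishes iff F(0) is a multiple of π, and near such a point the sign of L' decides on which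
side of the level (N + 1)π the angle lies, hence whether there are N or N + 1 positive eigenvalues.
L' changes sign iff its order is odd, and stability is affected iff N = 0, which means that the
eigenfunction has no zeros. -/

noncomputable section

open Filter Topology MeasureTheory Set Real

namespace InhomWave

/-! ### Differential inequalities -/

/-- A Grönwall estimate whose differential inequality is only known where `f ≤ R`. -/
theorem gronwall_bootstrap {f f' : ℝ → ℝ} {a b K ε R : ℝ} (hK : 0 ≤ K) (hε : 0 ≤ ε)
    (hfa : 0 ≤ f a) (hc : ContinuousOn f (Icc a b))
    (hd : ∀ x ∈ Ioo a b, HasDerivAt f (f' x) x)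
    (hb : ∀ x ∈ Ioo a b, f x ≤ R → f' x ≤ K * f x + ε)
    (hR : (f a + ε * (b - a)) * exp (K * (b - a)) < R) :
    ∀ x ∈ Icc a b, f x ≤ (f a + ε * (b - a)) * exp (K * (b - a)) := by
  have key : ∀ c ∈ Icc a b, (∀ x ∈ Ioo a c, f x ≤ R) →
      f c ≤ (f a + ε * (b - a)) * exp (K * (b - a)) := by
    intro c hcm hle
    have hanti : AntitoneOn (fun x => f x * exp (-K * (x - a)) - ε * (x - a)) (Icc a c) := by
      have hder : ∀ x ∈ Ioo a c, HasDerivAt (fun x => f x * exp (-K * (x - a)) - ε * (x - a))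
          ((f' x - K * f x) * exp (-K * (x - a)) - ε) x := by
        intro x hx
        have h1 := hd x ⟨hx.1, hx.2.trans_le hcm.2⟩
        have h2 : HasDerivAt (fun x => exp (-K * (x - a))) (exp (-K * (x - a)) * (-K * 1)) x :=
          (((hasDerivAt_id x).sub_const a).const_mul (-K)).exp
        have h3 : HasDerivAt (fun x => ε * (x - a)) (ε * 1) x :=
          ((hasDerivAt_id x).sub_const a).const_mul ε
        convert! (h1.mul h2).sub h3 using 1
        ring
      refine antitoneOn_of_deriv_nonpos (convex_Icc a c) ?_ ?_ ?_
      · have := hc.mono (Icc_subset_Icc_right hcm.2)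
        fun_prop
      · rw [interior_Icc]
        exact fun x hx => (hder x hx).differentiableAt.differentiableWithinAt
      · rw [interior_Icc]
        intro x hx
        rw [(hder x hx).deriv]
        have h1 := hb x ⟨hx.1, hx.2.trans_le hcm.2⟩ (hle x hx)
        have h2 : exp (-K * (x - a)) ≤ 1 := by
          rw [exp_le_one_iff]
          nlinarith [hx.1]
        have h3 := exp_pos (-K * (x - a))
        nlinarith
    have h := hanti (left_mem_Icc.2 hcm.1) (right_mem_Icc.2 hcm.1) hcm.1
    simp only [sub_self, mul_zero, exp_zero, mul_one, sub_zero] at h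
    have h1 : f c = (f c * exp (-K * (c - a))) * exp (K * (c - a)) := by
      rw [mul_assoc, ← exp_add]; ring_nf; simp
    rw [h1]
    have h2 : exp (K * (c - a)) ≤ exp (K * (b - a)) := by
      apply exp_le_exp.2; nlinarith [hcm.2]
    have h3 : f c * exp (-K * (c - a)) ≤ f a + ε * (b - a) := by nlinarith [hcm.2]
    have h4 : 0 ≤ f a + ε * (b - a) := by nlinarith [hcm.1, hcm.2]
    have h5 := exp_pos (K * (c - a))
    nlinarith
  -- At the first point where f reaches R the estimate already holds, and it keeps f below R.
  have hlt : ∀ x ∈ Icc a b, f x < R := by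
    by_contra! hcon
    obtain ⟨x, hx, hxR⟩ := hcon
    have hS : IsCompact (Icc a b ∩ f ⁻¹' Ici R) :=
      isCompact_Icc.of_isClosed_subset (hc.preimage_isClosed_of_isClosed isClosed_Icc isClosed_Ici)
        inter_subset_left
    obtain ⟨c, hcS, hmin⟩ := hS.exists_isLeast ⟨x, hx, hxR⟩
    have hc' := key c hcS.1 fun y hy => by
      by_contra! h
      exact absurd (hmin ⟨⟨hy.1.le, hy.2.le.trans hcS.1.2⟩, h.le⟩) (not_le.2 hy.2)
    exact absurd (hc'.trans_lt hR) (not_lt.2 hcS.2)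
  intro x hx
  exact key x hx fun y hy => (hlt y ⟨hy.1.le, hy.2.le.trans hx.2⟩).le

/-- A differentiable function with positive slope at each of its zeros stays positive. -/
theorem pos_of_deriv_pos_at_zeros {f f' : ℝ → ℝ} {a b : ℝ} (hab : a < b)
    (hd : ∀ x ∈ Icc a b, HasDerivAt f (f' x) x)
    (hz : ∀ x ∈ Icc a b, f x = 0 → 0 < f' x) (ha : 0 ≤ f a) : 0 < f b := by
  have hnn : ∀ x ∈ Icc a b, 0 ≤ f x := by
    intro x hx
    have := image_le_of_deriv_right_lt_deriv_boundary (f := fun x => -f x) (f' := fun x => -f' x)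
      (B := fun _ => 0) (B' := fun _ => 0) (a := a) (b := b)
      (fun x hx => (hd x hx).continuousAt.continuousWithinAt.neg)
      (fun x hx => (hd x (Ico_subset_Icc_self hx)).neg.hasDerivWithinAt) (by simpa using ha)
      (fun x => hasDerivAt_const x 0)
      (fun x hx h => by simpa using hz x (Ico_subset_Icc_self hx) (by simpa using h)) hx
    simpa using this
  have hbm : b ∈ Icc a b := right_mem_Icc.2 hab.le
  rcases (hnn b hbm).lt_or_eq with h | h
  · exact h
  exfalso
  have hpos := hz b hbm h.symm
  -- A zero at b with positive slope would make f negative just before b.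
  have hev := (hasDerivAt_iff_tendsto_slope.1 (hd b hbm)).eventually (lt_mem_nhds hpos)
  have hev' : ∀ᶠ y in 𝓝[<] b, 0 < slope f b y := hev.filter_mono
    (nhdsWithin_mono _ fun y hy => ne_of_lt hy)
  obtain ⟨y, hy, hyI⟩ := (hev'.and (Ioo_mem_nhdsLT hab)).exists
  rw [slope_def_field, ← h, sub_zero] at hy
  have h1 := hnn y ⟨hyI.1.le, hyI.2.le⟩
  have : f y / (y - b) ≤ 0 := div_nonpos_of_nonneg_of_nonpos h1 (by linarith [hyI.2])
  linarith

/-! ### Prüfer angles: comparison, existence, continuous dependence -/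

/-- `θ` is a Prüfer angle for `ψ'' + k ψ = 0`: `ψ = ρ sin θ` and `ψ' = ρ cos θ`. -/
def IsAngle (k θ : ℝ → ℝ) : Prop :=
  ∀ x, HasDerivAt θ (cos (θ x) ^ 2 + k x * sin (θ x) ^ 2) x

theorem IsAngle.continuous {k θ : ℝ → ℝ} (h : IsAngle k θ) : Continuous θ :=
  continuous_iff_continuousAt.2 fun x => (h x).continuousAt

theorem sin_sq_sub_sin_sq (a b : ℝ) : sin a ^ 2 - sin b ^ 2 = sin (a + b) * sin (a - b) := by
  rw [sin_add, sin_sub]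
  nlinarith [sin_sq_add_cos_sq a, sin_sq_add_cos_sq b]

theorem abs_sin_sq_sub_sin_sq_le (a b : ℝ) : |sin a ^ 2 - sin b ^ 2| ≤ |a - b| := by
  rw [sin_sq_sub_sin_sq, abs_mul]
  have h1 := abs_sin_le_one (a + b)
  have h2 : |sin (a - b)| ≤ |a - b| := abs_sin_le_abs
  nlinarith [abs_nonneg (sin (a + b)), abs_nonneg (sin (a - b))]

theorem prufer_sub_prufer (k₁ k₂ a b : ℝ) :
    (cos a ^ 2 + k₁ * sin a ^ 2) - (cos b ^ 2 + k₂ * sin b ^ 2) =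
      (k₁ - 1) * (sin a ^ 2 - sin b ^ 2) + (k₁ - k₂) * sin b ^ 2 := by
  rw [cos_sq' a, cos_sq' b]; ring

/-- The difference of two angles solves a linear equation; this is its integrating factor. -/
theorem IsAngle.exists_integrating_factor {k₁ k₂ θ₁ θ₂ : ℝ → ℝ} (hk : Continuous k₁)
    (h₁ : IsAngle k₁ θ₁) (h₂ : IsAngle k₂ θ₂) :
    ∃ E : ℝ → ℝ, (∀ x, 0 < E x) ∧ ∀ x, HasDerivAt (fun x => (θ₁ x - θ₂ x) * E x)
      ((k₁ x - k₂ x) * sin (θ₂ x) ^ 2 * E x) x := by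
  -- The identity sin² a - sin² b = sin (a + b) sin (a - b) shows the factor a - b; `sinc` keeps the
  -- quotient continuous where the angles coincide.
  set c : ℝ → ℝ := fun x => (k₁ x - 1) * sin (θ₁ x + θ₂ x) * sinc (θ₁ x - θ₂ x) with hc
  have hcc : Continuous c := by
    have := h₁.continuous; have := h₂.continuous; have := continuous_sinc
    fun_prop
  refine ⟨fun x => exp (-∫ t in (0 : ℝ)..x, c t), fun x => exp_pos _, fun x => ?_⟩
  have hI : HasDerivAt (fun x => ∫ t in (0 : ℝ)..x, c t) (c x) x :=
    intervalIntegral.integral_hasDerivAt_right (hcc.intervalIntegrable _ _)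
      (hcc.stronglyMeasurableAtFilter _ _) hcc.continuousAt
  convert! ((h₁ x).sub (h₂ x)).mul hI.neg.exp using 1
  simp only [Pi.sub_apply, Pi.neg_apply]
  rw [prufer_sub_prufer, sin_sq_sub_sin_sq]
  have : sin (θ₁ x - θ₂ x) = sinc (θ₁ x - θ₂ x) * (θ₁ x - θ₂ x) := by
    by_cases h : θ₁ x - θ₂ x = 0
    · simp [h]
    · rw [sinc_of_ne_zero h]; field_simp
  have hcx : c x = (k₁ x - 1) * sin (θ₁ x + θ₂ x) * sinc (θ₁ x - θ₂ x) := rfl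
  rw [this, hcx]
  ring

/-- Multiplied by the integrating factor, the difference of the angles is monotone, so its sign at a
persists. -/
theorem IsAngle.le_of_le {k₁ k₂ θ₁ θ₂ : ℝ → ℝ} (hk : Continuous k₁) (h₁ : IsAngle k₁ θ₁)
    (h₂ : IsAngle k₂ θ₂) {a b : ℝ} (hab : a ≤ b) (hle : ∀ x, k₂ x ≤ k₁ x) :
    (θ₂ a ≤ θ₁ a → θ₂ b ≤ θ₁ b) ∧ (θ₂ a < θ₁ a → θ₂ b < θ₁ b) := by
  obtain ⟨E, hE, hd⟩ := h₁.exists_integrating_factor hk h₂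
  have hm : Monotone fun x => (θ₁ x - θ₂ x) * E x := by
    refine monotone_of_deriv_nonneg (fun x => (hd x).differentiableAt) fun x => ?_
    rw [(hd x).deriv]
    have := hle x
    have := hE x
    have : 0 ≤ k₁ x - k₂ x := by linarith
    positivity
  have h := hm hab
  simp only at h
  refine ⟨fun h' => ?_, fun h' => ?_⟩ <;> by_contra! h''
  · have := mul_nonneg (sub_nonneg.2 h') (hE a).le
    nlinarith [hE b]
  · have := mul_pos (sub_pos.2 h') (hE a)
    nlinarith [hE b]

/-- If strictness failed at b, the weighted difference would vanish on (a, b). Its derivative then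
forces sin θ₂ = 0 there, which is impossible because θ₂ has slope 1 wherever its sine vanishes. -/
theorem IsAngle.lt_of_lt {k₁ k₂ θ₁ θ₂ : ℝ → ℝ} (hk : Continuous k₁) (h₁ : IsAngle k₁ θ₁)
    (h₂ : IsAngle k₂ θ₂) {a b : ℝ} (hab : a < b) (hlt : ∀ x, k₂ x < k₁ x)
    (ha : θ₂ a ≤ θ₁ a) : θ₂ b < θ₁ b := by
  obtain ⟨E, hE, hd⟩ := h₁.exists_integrating_factor hk h₂
  have hm : Monotone fun x => (θ₁ x - θ₂ x) * E x := by
    refine monotone_of_deriv_nonneg (fun x => (hd x).differentiableAt) fun x => ?_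
    rw [(hd x).deriv]
    have := hlt x
    have := hE x
    have : 0 ≤ k₁ x - k₂ x := by linarith
    positivity
  have h0 : 0 ≤ (θ₁ a - θ₂ a) * E a := mul_nonneg (sub_nonneg.2 ha) (hE a).le
  by_contra! hcon
  have hb0 : (θ₁ b - θ₂ b) * E b ≤ 0 := mul_nonpos_of_nonpos_of_nonneg (by linarith) (hE b).le
  have hz : ∀ x ∈ Ioo a b, sin (θ₂ x) = 0 := by
    intro x hx
    have heq : (fun x => (θ₁ x - θ₂ x) * E x) =ᶠ[𝓝 x] fun _ => 0 := by
      filter_upwards [Ioo_mem_nhds hx.1 hx.2] with y hy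
      have h1 := hm hy.1.le
      have h2 := hm hy.2.le
      simp only at h1 h2
      linarith
    have h1 := (hd x).unique ((hasDerivAt_const x (0 : ℝ)).congr_of_eventuallyEq heq)
    have h2 : 0 < k₁ x - k₂ x := by linarith [hlt x]
    simpa [h2.ne', (hE x).ne'] using h1
  obtain ⟨x, hx⟩ := exists_between hab
  have heq : (fun x => sin (θ₂ x)) =ᶠ[𝓝 x] fun _ => 0 := by
    filter_upwards [Ioo_mem_nhds hx.1 hx.2] with y hy using hz y hy
  have h1 := ((h₂ x).sin).unique ((hasDerivAt_const x (0 : ℝ)).congr_of_eventuallyEq heq)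
  have h2 := sin_sq_add_cos_sq (θ₂ x)
  rw [hz x hx] at h1 h2
  have h3 : cos (θ₂ x) ^ 2 = 1 := by linarith
  rw [h3] at h1
  simp at h1
  simp [h1] at h3

/-- The right-hand side is bounded and Lipschitz in θ on bounded time intervals, so Picard–Lindelöf
solves the equation on each [a - n, a + n] without shrinking the interval; uniqueness glues these
solutions. -/
theorem exists_isAngle {k : ℝ → ℝ} (hk : Continuous k) (a θ₀ : ℝ) :
    ∃ θ, IsAngle k θ ∧ θ a = θ₀ := by
  have hloc : ∀ n : ℕ, ∃ α : ℝ → ℝ, α a = θ₀ ∧ ∀ t ∈ Icc (a - n) (a + n),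
      HasDerivWithinAt α (cos (α t) ^ 2 + k t * sin (α t) ^ 2) (Icc (a - n) (a + n)) t := by
    intro n
    obtain ⟨C, hC⟩ := isCompact_Icc.exists_bound_of_continuousOn
      (hk.continuousOn (s := Icc (a - n) (a + n)))
    have hn : (0 : ℝ) ≤ n := n.cast_nonneg
    have hC0 : 0 ≤ C := (norm_nonneg _).trans (hC a ⟨by linarith, by linarith⟩)
    have hpl : IsPicardLindelof (fun t θ => cos θ ^ 2 + k t * sin θ ^ 2)
        (tmin := a - n) (tmax := a + n) ⟨a, by constructor <;> linarith⟩ θ₀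
        (⟨1 + C, by linarith⟩ * ⟨n, hn⟩) 0 ⟨1 + C, by linarith⟩ ⟨1 + C, by linarith⟩ := by
      refine ⟨fun t ht => ?_, fun x _ => by fun_prop, fun t ht x _ => ?_, ?_⟩
      · refine LipschitzOnWith.of_dist_le_mul fun x _ y _ => ?_
        rw [dist_eq, dist_eq, prufer_sub_prufer, sub_self, zero_mul, add_zero, abs_mul]
        have h1 := hC t ht
        rw [norm_eq_abs] at h1
        have h2 := abs_sin_sq_sub_sin_sq_le x y
        have h3 : |k t - 1| ≤ 1 + C := (abs_sub _ _).trans (by simp; linarith)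
        exact mul_le_mul h3 h2 (abs_nonneg _) (by linarith)
      · have h1 := hC t ht
        rw [norm_eq_abs] at h1 ⊢
        have h4 : |k t * sin x ^ 2| ≤ C := by
          rw [abs_mul, abs_of_nonneg (sq_nonneg (sin x))]
          nlinarith [sin_sq_le_one x, sq_nonneg (sin x), abs_nonneg (k t)]
        refine (abs_add_le _ _).trans (add_le_add ?_ h4)
        rw [abs_of_nonneg (sq_nonneg _)]
        exact cos_sq_le_one x
      · simp only [add_sub_cancel_left, sub_sub_cancel, max_self, NNReal.coe_zero, sub_zero]
        exact le_rfl
    exact hpl.exists_eq_forall_mem_Icc_hasDerivWithinAt₀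
  choose α hα0 hα using hloc
  have hagree : ∀ m n : ℕ, m ≤ n → EqOn (α m) (α n) (Icc (a - m) (a + m)) := by
    intro m n hmn
    rcases Nat.eq_zero_or_pos m with rfl | hm
    · intro x hx
      have : x = a := by simpa using hx
      rw [this, hα0, hα0]
    have hm' : (0 : ℝ) < m := by exact_mod_cast hm
    have hmn' : (m : ℝ) ≤ n := by exact_mod_cast hmn
    obtain ⟨C, hC⟩ := isCompact_Icc.exists_bound_of_continuousOn
      (hk.continuousOn (s := Icc (a - m) (a + m)))
    have hC0 : 0 ≤ C := (norm_nonneg _).trans (hC a ⟨by linarith, by linarith⟩)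
    refine ODE_solution_unique_of_mem_Icc (v := fun t θ => cos θ ^ 2 + k t * sin θ ^ 2)
      (s := fun _ => univ) (K := ⟨1 + C, by linarith⟩) (t₀ := a) ?_ ⟨by linarith, by linarith⟩
      (fun t ht => (hα m t ht).continuousWithinAt) ?_ (fun _ _ => mem_univ _)
      (fun t ht => ((hα n t ⟨by linarith [ht.1], by linarith [ht.2]⟩).mono
        (Icc_subset_Icc (by linarith) (by linarith))).continuousWithinAt) ?_
      (fun _ _ => mem_univ _) (by rw [hα0, hα0])
    · intro t ht
      refine LipschitzOnWith.of_dist_le_mul fun x _ y _ => ?_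
      rw [dist_eq, dist_eq, prufer_sub_prufer, sub_self, zero_mul, add_zero, abs_mul]
      have h1 := hC t (Ioo_subset_Icc_self ht)
      rw [norm_eq_abs] at h1
      have h2 := abs_sin_sq_sub_sin_sq_le x y
      have h3 : |k t - 1| ≤ 1 + C := (abs_sub _ _).trans (by simp; linarith)
      exact mul_le_mul h3 h2 (abs_nonneg _) (by linarith)
    · intro t ht
      exact (hα m t (Ioo_subset_Icc_self ht)).hasDerivAt (Icc_mem_nhds ht.1 ht.2)
    · intro t ht
      exact (hα n t ⟨by linarith [ht.1], by linarith [ht.2]⟩).hasDerivAt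
        (Icc_mem_nhds (by linarith [ht.1]) (by linarith [ht.2]))
  refine ⟨fun x => α ⌈|x - a|⌉₊ x, fun x => ?_, by simp [hα0]⟩
  have hx1 : |x - a| < (⌈|x - a|⌉₊ + 1 : ℕ) := by
    push_cast
    linarith [Nat.le_ceil |x - a|]
  obtain ⟨h1, h2⟩ := abs_lt.1 hx1
  have hd : HasDerivAt (α (⌈|x - a|⌉₊ + 1)) _ x :=
    (hα (⌈|x - a|⌉₊ + 1) x ⟨by linarith, by linarith⟩).hasDerivAt
      (Icc_mem_nhds (by linarith) (by linarith))
  have hev : (fun y => α ⌈|y - a|⌉₊ y) =ᶠ[𝓝 x] α (⌈|x - a|⌉₊ + 1) := by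
    filter_upwards [(continuous_abs.comp (continuous_sub_right a)).continuousAt.eventually
      (gt_mem_nhds hx1)] with y hy
    simp only [Function.comp_apply] at hy
    refine hagree _ _ (Nat.ceil_le.2 hy.le) ?_
    have := Nat.le_ceil |y - a|
    obtain ⟨h3, h4⟩ := abs_le.1 this
    exact ⟨by linarith, by linarith⟩
  have := hd.congr_of_eventuallyEq hev
  rwa [← hev.eq_of_nhds] at this

/-- The slope is 1 at every multiple of π, so such levels are crossed only upwards. -/
theorem IsAngle.nat_mul_pi_lt {k θ : ℝ → ℝ} (h : IsAngle k θ) (n : ℕ) {a b : ℝ} (hab : a < b)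
    (ha : n * π ≤ θ a) : n * π < θ b := by
  have := pos_of_deriv_pos_at_zeros (f := fun x => θ x - n * π) hab
    (fun x _ => (h x).sub_const _) (fun x _ hx => ?_) (by simpa using ha)
  · linarith
  · have hx : θ x = n * π := by linarith
    have h1 : sin (θ x) = 0 := by rw [hx, sin_nat_mul_pi]
    have h2 := sin_sq_add_cos_sq (θ x)
    rw [h1] at h2 ⊢
    nlinarith

theorem IsAngle.pos_of_nonneg {k θ : ℝ → ℝ} (h : IsAngle k θ) {a b : ℝ} (hab : a < b)
    (ha : 0 ≤ θ a) : 0 < θ b := by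
  simpa using h.nat_mul_pi_lt 0 hab (by simpa using ha)

theorem abs_prufer_sub_prufer_le {k₁ k₂ C η : ℝ} (hC : |k₁| ≤ C) (hη : |k₁ - k₂| ≤ η) (a b : ℝ) :
    |(cos a ^ 2 + k₁ * sin a ^ 2) - (cos b ^ 2 + k₂ * sin b ^ 2)| ≤ (1 + C) * |a - b| + η := by
  rw [prufer_sub_prufer]
  have e1 : |(k₁ - 1) * (sin a ^ 2 - sin b ^ 2)| ≤ (1 + C) * |a - b| := by
    rw [abs_mul]
    refine mul_le_mul ((abs_sub _ _).trans ?_) (abs_sin_sq_sub_sin_sq_le _ _)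
      (abs_nonneg _) (by linarith [abs_nonneg k₁])
    simp; linarith
  have e2 : |(k₁ - k₂) * sin b ^ 2| ≤ η := by
    rw [abs_mul, abs_of_nonneg (sq_nonneg (sin b))]
    nlinarith [abs_nonneg (k₁ - k₂), sin_sq_le_one b, sq_nonneg (sin b)]
  exact (abs_add_le _ _).trans (add_le_add e1 e2)

/-- Squaring avoids the kink of |d|; the inequality 2|d|η ≤ d² + η² produces the constants 2K + 1
and η². -/
theorem sq_le_of_abs_deriv_le {d d' : ℝ → ℝ} {a b K η : ℝ} (hab : a ≤ b) (hK : 0 ≤ K)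
    (hc : ContinuousOn d (Icc a b)) (hd : ∀ x ∈ Ioo a b, HasDerivAt d (d' x) x)
    (hle : ∀ x ∈ Ioo a b, |d' x| ≤ K * |d x| + η) :
    d b ^ 2 ≤ (d a ^ 2 + η ^ 2 * (b - a)) * exp ((2 * K + 1) * (b - a)) := by
  refine gronwall_bootstrap (f := fun x => d x ^ 2) (f' := fun x => 2 * d x * d' x)
    (R := (d a ^ 2 + η ^ 2 * (b - a)) * exp ((2 * K + 1) * (b - a)) + 1)
    (by linarith) (sq_nonneg η) (sq_nonneg _) (hc.pow 2) ?_ ?_ (by linarith) b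
    (right_mem_Icc.2 hab)
  · intro x hx
    convert! (hd x hx).pow 2 using 1
    simp
  · intro x hx _
    have e4 : d x * d' x ≤ |d x| * (K * |d x| + η) :=
      (le_abs_self _).trans (by rw [abs_mul]; gcongr; exact hle x hx)
    have e5 : |d x| * |d x| = d x ^ 2 := by rw [← sq, sq_abs]
    nlinarith [sq_nonneg (|d x| - η)]

/-- Continuous dependence of the angle on the coefficient and the initial value. -/
theorem IsAngle.sq_sub_le {k₁ k₂ θ₁ θ₂ : ℝ → ℝ} (h₁ : IsAngle k₁ θ₁) (h₂ : IsAngle k₂ θ₂)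
    {a b C η : ℝ} (hab : a ≤ b) (hC : ∀ x ∈ Icc a b, |k₁ x| ≤ C)
    (hη : ∀ x ∈ Icc a b, |k₁ x - k₂ x| ≤ η) :
    (θ₁ b - θ₂ b) ^ 2 ≤
      ((θ₁ a - θ₂ a) ^ 2 + η ^ 2 * (b - a)) * exp ((2 * (1 + C) + 1) * (b - a)) := by
  have hC0 : 0 ≤ C := (abs_nonneg _).trans (hC a (left_mem_Icc.2 hab))
  refine sq_le_of_abs_deriv_le (d := fun x => θ₁ x - θ₂ x) hab (by linarith)
    (h₁.continuous.sub h₂.continuous).continuousOn (fun x _ => (h₁ x).sub (h₂ x)) fun x hx => ?_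
  exact abs_prufer_sub_prufer_le (hC x (Ioo_subset_Icc_self hx)) (hη x (Ioo_subset_Icc_self hx)) _ _

theorem IsAngle.tendsto {ι : Type*} {l : Filter ι} {k θ : ℝ → ℝ} {k' θ' : ι → ℝ → ℝ} {η : ι → ℝ}
    (hk : Continuous k) (h : IsAngle k θ) (h' : ∀ᶠ i in l, IsAngle (k' i) (θ' i)) {a b : ℝ}
    (hab : a ≤ b) (hη : Tendsto η l (𝓝 0))
    (hkk : ∀ᶠ i in l, ∀ x ∈ Icc a b, |k x - k' i x| ≤ η i)
    (ha : Tendsto (fun i => θ' i a) l (𝓝 (θ a))) :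
    Tendsto (fun i => θ' i b) l (𝓝 (θ b)) := by
  obtain ⟨C, hC⟩ := isCompact_Icc.exists_bound_of_continuousOn (hk.continuousOn (s := Icc a b))
  have hsq : Tendsto (fun i => (θ b - θ' i b) ^ 2) l (𝓝 0) := by
    refine squeeze_zero' (Eventually.of_forall fun i => sq_nonneg _)
      (g := fun i => ((θ a - θ' i a) ^ 2 + η i ^ 2 * (b - a)) *
        exp ((2 * (1 + C) + 1) * (b - a))) ?_ ?_
    · filter_upwards [h', hkk] with i h1 h2
      exact h.sq_sub_le h1 hab hC h2
    · have h1 : Tendsto (fun i => (θ a - θ' i a) ^ 2) l (𝓝 0) := by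
        simpa using (tendsto_const_nhds (x := θ a)).sub ha |>.pow 2
      have h2 : Tendsto (fun i => η i ^ 2 * (b - a)) l (𝓝 0) := by
        simpa using (hη.pow 2).mul_const (b - a)
      simpa using (h1.add h2).mul_const (exp ((2 * (1 + C) + 1) * (b - a)))
  have habs : Tendsto (fun i => |θ b - θ' i b|) l (𝓝 0) := by
    simpa [Function.comp_def, sqrt_sq_eq_abs] using (continuous_sqrt.tendsto 0).comp hsq
  have := (tendsto_const_nhds (x := θ b)).sub ((tendsto_zero_iff_abs_tendsto_zero _).2 habs)
  simpa using this

/-! ### Angles of solutions that decay at -∞ -/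

/-- The angle of the solutions of `ψ'' + k ψ = 0` that decay at `-∞`. -/
def IsLeftAngle (k θ : ℝ → ℝ) : Prop :=
  IsAngle k θ ∧ ∃ x₀, ∀ x ≤ x₀, θ x ∈ Icc 0 (π / 2)

/-- The vector field points into [0, π/2] at both ends: the slope is 1 at 0 and k < 0 at π/2. -/
theorem IsAngle.mem_Icc_of_neg {k θ : ℝ → ℝ} (h : IsAngle k θ) {a b : ℝ} (hab : a ≤ b)
    (hk : ∀ x ∈ Icc a b, k x < 0) (ha : θ a ∈ Icc 0 (π / 2)) : θ b ∈ Icc 0 (π / 2) := by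
  rcases hab.eq_or_lt with rfl | hab
  · exact ha
  refine ⟨(h.pos_of_nonneg hab ha.1).le, ?_⟩
  have := pos_of_deriv_pos_at_zeros (f := fun x => π / 2 - θ x) hab
    (fun x _ => (h x).const_sub _) (fun x hx h0 => ?_) (by linarith [ha.2])
  · linarith
  · have h1 : θ x = π / 2 := by linarith
    simpa [h1] using hk x hx

/-- Shooting from x₀ - n with the initial angles 0 and π/2 gives nested intervals of values at x₀.
The angle through the supremum of the lower ends remains in [0, π/2] at all earlier points: had it
left, order preservation would put its value at x₀ outside one of these intervals. -/
theorem exists_isLeftAngle {k : ℝ → ℝ} (hk : Continuous k) {x₀ : ℝ} (hneg : ∀ x ≤ x₀, k x < 0) :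
    ∃ θ, IsLeftAngle k θ := by
  choose α hα hα0 using fun n : ℕ => exists_isAngle hk (x₀ - n) 0
  choose β hβ hβ0 using fun n : ℕ => exists_isAngle hk (x₀ - n) (π / 2)
  have hπ := pi_pos
  have hsub : ∀ m n : ℕ, m ≤ n → x₀ - n ≤ x₀ - m := fun m n h => by
    have : (m : ℝ) ≤ n := by exact_mod_cast h
    linarith
  have hle : ∀ n : ℕ, x₀ - n ≤ x₀ := fun n => by simp
  have hinv : ∀ {θ : ℝ → ℝ}, IsAngle k θ → ∀ {a b : ℝ}, a ≤ b → b ≤ x₀ →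
      θ a ∈ Icc 0 (π / 2) → θ b ∈ Icc 0 (π / 2) := fun {θ} h {a b} hab hb ha =>
    h.mem_Icc_of_neg hab (fun x hx => hneg x (hx.2.trans hb)) ha
  have hαβ : ∀ m n, α m x₀ ≤ β n x₀ := by
    intro m n
    rcases le_total n m with h | h
    · refine ((hβ n).le_of_le hk (hα m) (hle n) fun _ => le_rfl).1 ?_
      rw [hβ0]
      refine (hinv (hα m) (hsub _ _ h) (hle n) ?_).2
      rw [hα0]; constructor <;> linarith
    · refine ((hβ n).le_of_le hk (hα m) (hle m) fun _ => le_rfl).1 ?_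
      rw [hα0]
      refine (hinv (hβ n) (hsub _ _ h) (hle m) ?_).1
      rw [hβ0]; constructor <;> linarith
  have hbdd : BddAbove (range fun n => α n x₀) :=
    ⟨β 0 x₀, by rintro _ ⟨n, rfl⟩; exact hαβ n 0⟩
  obtain ⟨θ, hθ, hθ0⟩ := exists_isAngle hk x₀ (⨆ n, α n x₀)
  refine ⟨θ, hθ, x₀, fun x hx => ?_⟩
  obtain ⟨n, hn⟩ := exists_nat_ge (x₀ - x)
  refine hinv hθ (a := x₀ - n) (by linarith) hx ⟨?_, ?_⟩
  · by_contra! hcon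
    rw [← hα0 n] at hcon
    have := ((hα n).le_of_le hk hθ (hle n) fun _ => le_rfl).2 hcon
    rw [hθ0] at this
    exact absurd (le_ciSup hbdd n) (not_le.2 this)
  · by_contra! hcon
    rw [← hβ0 n] at hcon
    have := (hθ.le_of_le hk (hβ n) (hle n) fun _ => le_rfl).2 hcon
    rw [hθ0] at this
    exact absurd (ciSup_le fun m => hαβ m n) (not_le.2 this)

theorem IsLeftAngle.mem_Icc {k θ : ℝ → ℝ} (h : IsLeftAngle k θ) {x₀ : ℝ}
    (hneg : ∀ x ≤ x₀, k x < 0) : ∀ x ≤ x₀, θ x ∈ Icc 0 (π / 2) := by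
  obtain ⟨h, x₁, hx₁⟩ := h
  intro x hx
  exact h.mem_Icc_of_neg (min_le_right x₁ x) (fun y hy => hneg y (hy.2.trans hx))
    (hx₁ _ (min_le_left _ _))

theorem IsLeftAngle.pos {k θ : ℝ → ℝ} (h : IsLeftAngle k θ) (x : ℝ) : 0 < θ x := by
  obtain ⟨h, x₁, hx₁⟩ := h
  exact h.pos_of_nonneg (a := min x₁ (x - 1)) ((min_le_right _ _).trans_lt (by linarith))
    (hx₁ _ (min_le_left _ _)).1

theorem sin_le_sin_of_mem_Icc {d s : ℝ} (h0 : 0 ≤ d) (hs : s ∈ Icc d (π - d)) :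
    sin d ≤ sin s := by
  rcases le_total s (π / 2) with h | h
  · exact sin_le_sin_of_le_of_le_pi_div_two (by linarith [pi_pos]) h hs.1
  · rw [← sin_pi_sub s]
    exact sin_le_sin_of_le_of_le_pi_div_two (by linarith [pi_pos]) (by linarith)
      (by linarith [hs.2])

/-- Two left angles with nearly equal coefficients are close to each other. -/
theorem IsAngle.sin_sq_le_of_mem_Icc {k₁ k₂ θ₁ θ₂ : ℝ → ℝ} (h₁ : IsAngle k₁ θ₁)
    (h₂ : IsAngle k₂ θ₂) {x₀ η : ℝ} (hη : 0 ≤ η) (hk₂ : ∀ x ≤ x₀, k₂ x ≤ 0)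
    (hkk : ∀ x ≤ x₀, k₂ x - k₁ x ≤ η) (hm₁ : ∀ x ≤ x₀, θ₁ x ∈ Icc 0 (π / 2))
    (hm₂ : ∀ x ≤ x₀, θ₂ x ∈ Icc 0 (π / 2)) (hlt : θ₁ x₀ < θ₂ x₀) :
    sin (θ₂ x₀ - θ₁ x₀) ^ 2 ≤ η := by
  by_contra! hcon
  set d₀ := θ₂ x₀ - θ₁ x₀ with hd₀
  have hd₀pos : 0 < d₀ := by linarith
  have hd₀le : d₀ ≤ π / 2 := by linarith [(hm₁ x₀ le_rfl).1, (hm₂ x₀ le_rfl).2]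
  have hsin0 : 0 < sin d₀ := sin_pos_of_pos_of_lt_pi hd₀pos (by linarith [pi_pos])
  set D : ℝ → ℝ := fun x => (cos (θ₂ x) ^ 2 + k₂ x * sin (θ₂ x) ^ 2) -
    (cos (θ₁ x) ^ 2 + k₁ x * sin (θ₁ x) ^ 2) with hD
  have hder : ∀ x, HasDerivAt (fun x => θ₂ x - θ₁ x) (D x) x := fun x => (h₂ x).sub (h₁ x)
  have hDle : ∀ x ≤ x₀, d₀ ≤ θ₂ x - θ₁ x → D x ≤ -(sin d₀ ^ 2 - η) := by
    intro x hx hdx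
    have h1 := hm₁ x hx
    have h2 := hm₂ x hx
    simp only [hD]
    rw [prufer_sub_prufer, sin_sq_sub_sin_sq]
    have e1 : sin d₀ ≤ sin (θ₂ x + θ₁ x) :=
      sin_le_sin_of_mem_Icc hd₀pos.le ⟨by linarith [h1.1], by linarith [h2.2]⟩
    have e2 : sin d₀ ≤ sin (θ₂ x - θ₁ x) :=
      sin_le_sin_of_mem_Icc hd₀pos.le ⟨hdx, by linarith [h1.1, h2.2]⟩
    have e3 : sin d₀ ^ 2 ≤ sin (θ₂ x + θ₁ x) * sin (θ₂ x - θ₁ x) := by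
      rw [sq]; exact mul_le_mul e1 e2 hsin0.le (hsin0.le.trans e1)
    have e4 : (k₂ x - k₁ x) * sin (θ₁ x) ^ 2 ≤ η := by
      have := hkk x hx
      nlinarith [sin_sq_le_one (θ₁ x), sq_nonneg (sin (θ₁ x))]
    nlinarith [hk₂ x hx, sq_nonneg (sin d₀)]
  -- Followed backwards, the gap cannot drop below d₀: wherever it equals d₀ it is strictly
  -- decreasing in x.
  have hge : ∀ x ≤ x₀, d₀ ≤ θ₂ x - θ₁ x := by
    intro x hx
    rcases hx.eq_or_lt with rfl | hx
    · exact le_rfl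
    have := pos_of_deriv_pos_at_zeros (f := fun t => (θ₂ (x₀ - t) - θ₁ (x₀ - t)) - d₀)
      (f' := fun t => -D (x₀ - t)) (a := 0) (b := x₀ - x) (by linarith) (fun t _ => ?_)
      (fun t ht h0 => ?_) (by simp [hd₀])
    · simp only [sub_sub_cancel] at this
      linarith
    · have := (hder (x₀ - t)).scomp t ((hasDerivAt_id t).const_sub x₀)
      simpa using this.sub_const d₀
    · have := hDle (x₀ - t) (by linarith [ht.1]) (by linarith)
      linarith
  set δ := sin d₀ ^ 2 - η with hδ
  have hδpos : 0 < δ := by linarith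
  have hanti : AntitoneOn (fun x => (θ₂ x - θ₁ x) + δ * x) (Iic x₀) := by
    have hd : ∀ x, HasDerivAt (fun x => (θ₂ x - θ₁ x) + δ * x) (D x + δ * 1) x := fun x =>
      (hder x).add ((hasDerivAt_id x).const_mul δ)
    refine antitoneOn_of_deriv_nonpos (convex_Iic x₀)
      (fun x _ => (hd x).continuousAt.continuousWithinAt)
      (fun x _ => (hd x).differentiableAt.differentiableWithinAt) fun x hx => ?_
    rw [interior_Iic] at hx
    rw [(hd x).deriv]
    linarith [hDle x hx.le (hge x hx.le)]
  -- The gap grows backwards at rate at least δ, so over the length 2π/δ it gains 2π, although both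
  -- angles lie in [0, π/2].
  have hx₁ : x₀ - 2 * π / δ ≤ x₀ := by
    have := pi_pos
    have : 0 < 2 * π / δ := by positivity
    linarith
  have h := hanti hx₁ (mem_Iic.2 le_rfl) hx₁
  simp only at h
  have h3 : δ * (x₀ - 2 * π / δ) = δ * x₀ - 2 * π := by field_simp
  rw [h3] at h
  linarith [(hm₁ _ hx₁).1, (hm₂ _ hx₁).2, pi_pos]

/-! ### The left angle as a function of the spectral parameter -/

/-- Coefficients of half-line problems: continuous, bounded, and negative near `-∞`. -/
structure IsTailCoeff (q : ℝ → ℝ) : Prop where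
  continuous : Continuous q
  bdd : ∃ Q, ∀ x, |q x| ≤ Q
  neg : ∃ x₀ μ, 0 < μ ∧ ∀ x ≤ x₀, q x ≤ -μ

open Classical in
/-- The left angle for `ψ'' + (q - Λ) ψ = 0`. -/
def leftAngle (q : ℝ → ℝ) (Λ : ℝ) : ℝ → ℝ :=
  if h : ∃ θ, IsLeftAngle (fun x => q x - Λ) θ then h.choose else 0

theorem IsTailCoeff.continuous_sub {q : ℝ → ℝ} (hq : IsTailCoeff q) (Λ : ℝ) :
    Continuous fun x => q x - Λ := hq.continuous.sub continuous_const

theorem IsTailCoeff.isLeftAngle {q : ℝ → ℝ} (hq : IsTailCoeff q) {Λ : ℝ} (hΛ : 0 ≤ Λ) :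
    IsLeftAngle (fun x => q x - Λ) (leftAngle q Λ) := by
  obtain ⟨x₀, μ, hμ, hx₀⟩ := hq.neg
  have h : ∃ θ, IsLeftAngle (fun x => q x - Λ) θ :=
    exists_isLeftAngle (hq.continuous_sub Λ) (x₀ := x₀) fun x hx => by linarith [hx₀ x hx]
  rw [leftAngle, dif_pos h]
  exact h.choose_spec

theorem IsTailCoeff.isAngle {q : ℝ → ℝ} (hq : IsTailCoeff q) {Λ : ℝ} (hΛ : 0 ≤ Λ) :
    IsAngle (fun x => q x - Λ) (leftAngle q Λ) := (hq.isLeftAngle hΛ).1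

theorem IsTailCoeff.leftAngle_mem_Icc {q : ℝ → ℝ} (hq : IsTailCoeff q) :
    ∃ x₀, ∀ x ≤ x₀, q x ≤ 0 ∧ ∀ Λ, 0 ≤ Λ → leftAngle q Λ x ∈ Icc 0 (π / 2) := by
  obtain ⟨x₀, μ, hμ, hx₀⟩ := hq.neg
  refine ⟨x₀, fun x hx => ⟨by linarith [hx₀ x hx], fun Λ hΛ => ?_⟩⟩
  exact (hq.isLeftAngle hΛ).mem_Icc (fun y hy => by linarith [hx₀ y hy]) x hx

theorem IsTailCoeff.sin_sq_leftAngle_sub_le {q : ℝ → ℝ} (hq : IsTailCoeff q) :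
    ∃ x₀, ∀ x ≤ x₀, ∀ Λ₁ Λ₂ η, 0 ≤ Λ₁ → 0 ≤ Λ₂ → 0 ≤ η → Λ₁ - Λ₂ ≤ η →
      leftAngle q Λ₁ x < leftAngle q Λ₂ x →
      sin (leftAngle q Λ₂ x - leftAngle q Λ₁ x) ^ 2 ≤ η := by
  obtain ⟨x₀, hx₀⟩ := hq.leftAngle_mem_Icc
  refine ⟨x₀, fun x hx Λ₁ Λ₂ η h1 h2 hη hle hlt => ?_⟩
  exact (hq.isAngle h1).sin_sq_le_of_mem_Icc (hq.isAngle h2) hη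
    (fun y hy => by linarith [(hx₀ y (hy.trans hx)).1]) (fun y hy => by linarith)
    (fun y hy => (hx₀ y (hy.trans hx)).2 _ h1) (fun y hy => (hx₀ y (hy.trans hx)).2 _ h2) hlt

/-- Far to the left the weak inequality is the gap estimate with η = 0; comparison on the way to x
makes it strict. -/
theorem IsTailCoeff.leftAngle_lt {q : ℝ → ℝ} (hq : IsTailCoeff q) {Λ₁ Λ₂ : ℝ} (h1 : 0 ≤ Λ₁)
    (h12 : Λ₁ < Λ₂) (x : ℝ) : leftAngle q Λ₂ x < leftAngle q Λ₁ x := by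
  obtain ⟨x₀, hx₀⟩ := hq.leftAngle_mem_Icc
  obtain ⟨x₁, hx₁⟩ := hq.sin_sq_leftAngle_sub_le
  set y := min (min x₀ x₁) (x - 1)
  have hy0 : y ≤ x₀ := (min_le_left _ _).trans (min_le_left _ _)
  have hy1 : y ≤ x₁ := (min_le_left _ _).trans (min_le_right _ _)
  have hyx : y < x := (min_le_right _ _).trans_lt (by linarith)
  have h2 : 0 ≤ Λ₂ := h1.trans h12.le
  refine (hq.isAngle h1).lt_of_lt (hq.continuous_sub _) (hq.isAngle h2) hyx
    (fun z => by linarith) ?_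
  by_contra! hcon
  have h := hx₁ y hy1 Λ₁ Λ₂ 0 h1 h2 le_rfl (by linarith) hcon
  have hs : 0 < sin (leftAngle q Λ₂ y - leftAngle q Λ₁ y) :=
    sin_pos_of_pos_of_lt_pi (by linarith)
      (by linarith [((hx₀ y hy0).2 _ h1).1, ((hx₀ y hy0).2 _ h2).2, pi_pos])
  nlinarith

/-- Far to the left the gap estimate, with the lower bound 2t/π ≤ sin t, bounds the squared
difference of the angles by a multiple of |Λ - Λ₀|; continuous dependence on a bounded interval
carries this to x. -/
theorem IsTailCoeff.continuousOn_leftAngle {q : ℝ → ℝ} (hq : IsTailCoeff q) (x : ℝ) :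
    ContinuousOn (fun Λ => leftAngle q Λ x) (Ici 0) := by
  intro Λ₀ hΛ₀
  obtain ⟨x₀, hx₀⟩ := hq.leftAngle_mem_Icc
  obtain ⟨x₁, hx₁⟩ := hq.sin_sq_leftAngle_sub_le
  set y := min (min x₀ x₁) x
  have hy0 : y ≤ x₀ := (min_le_left _ _).trans (min_le_left _ _)
  have hy1 : y ≤ x₁ := (min_le_left _ _).trans (min_le_right _ _)
  have hyx : y ≤ x := min_le_right _ _
  have hη : Tendsto (fun Λ : ℝ => |Λ - Λ₀|) (𝓝[Ici 0] Λ₀) (𝓝 0) := by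
    have : ContinuousWithinAt (fun Λ : ℝ => |Λ - Λ₀|) (Ici 0) Λ₀ := by fun_prop
    simpa [ContinuousWithinAt] using this
  refine (hq.isAngle hΛ₀).tendsto (k' := fun Λ x => q x - Λ) (hq.continuous_sub _) ?_ hyx hη ?_ ?_
  · filter_upwards [self_mem_nhdsWithin] with Λ hΛ using hq.isAngle hΛ
  · refine Eventually.of_forall fun Λ z _ => le_of_eq ?_
    congr 1
    ring
  have key : ∀ Λ₁ Λ₂, 0 ≤ Λ₁ → 0 ≤ Λ₂ → leftAngle q Λ₁ y < leftAngle q Λ₂ y →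
      (leftAngle q Λ₂ y - leftAngle q Λ₁ y) ^ 2 ≤ (π / 2) ^ 2 * |Λ₁ - Λ₂| := by
    intro Λ₁ Λ₂ h1 h2 hlt
    have h := hx₁ y hy1 Λ₁ Λ₂ _ h1 h2 (abs_nonneg _) (le_abs_self _) hlt
    have h3 := mul_le_sin (sub_nonneg.2 hlt.le)
      (by linarith [((hx₀ y hy0).2 _ h1).1, ((hx₀ y hy0).2 _ h2).2])
    have h4 : (leftAngle q Λ₂ y - leftAngle q Λ₁ y) =
        π / 2 * (2 / π * (leftAngle q Λ₂ y - leftAngle q Λ₁ y)) := by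
      have := pi_ne_zero; field_simp
    rw [h4, mul_pow]
    have h5 : 0 ≤ 2 / π * (leftAngle q Λ₂ y - leftAngle q Λ₁ y) :=
      mul_nonneg (by have := pi_pos; positivity) (sub_nonneg.2 hlt.le)
    gcongr
    exact (pow_le_pow_left₀ h5 h3 2).trans h
  have hsq : Tendsto (fun Λ => (leftAngle q Λ y - leftAngle q Λ₀ y) ^ 2) (𝓝[Ici 0] Λ₀) (𝓝 0) := by
    refine squeeze_zero' (Eventually.of_forall fun i => sq_nonneg _)
      (g := fun Λ => (π / 2) ^ 2 * |Λ - Λ₀|) ?_ (by simpa using hη.const_mul ((π / 2) ^ 2))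
    filter_upwards [self_mem_nhdsWithin] with Λ hΛ
    rcases lt_trichotomy (leftAngle q Λ y) (leftAngle q Λ₀ y) with h | h | h
    · have := key Λ Λ₀ hΛ hΛ₀ h
      rwa [← neg_sub, neg_sq]
    · rw [h, sub_self]; simp; positivity
    · have := key Λ₀ Λ hΛ₀ hΛ h
      rwa [abs_sub_comm]
  have habs : Tendsto (fun Λ => |leftAngle q Λ y - leftAngle q Λ₀ y|) (𝓝[Ici 0] Λ₀) (𝓝 0) := by
    simpa [Function.comp_def, sqrt_sq_eq_abs] using (continuous_sqrt.tendsto 0).comp hsq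
  simpa using ((tendsto_zero_iff_abs_tendsto_zero _).2 habs).add_const (leftAngle q Λ₀ y)

/-- At the level π/4 the slope is (1 + k)/2 < 0. -/
theorem IsAngle.lt_pi_div_four {k θ : ℝ → ℝ} (h : IsAngle k θ) (hk : ∀ x, k x ≤ -2) {a b : ℝ}
    (hab : a ≤ b) (ha : θ a < π / 4) : θ b < π / 4 := by
  rcases hab.eq_or_lt with rfl | hab
  · exact ha
  have := pos_of_deriv_pos_at_zeros (f := fun x => π / 4 - θ x) hab
    (fun x _ => (h x).const_sub _) (fun x hx h0 => ?_) (by linarith)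
  · linarith
  · have h1 : θ x = π / 4 := by linarith
    have h2 : (√2 / 2) ^ 2 = (1 / 2 : ℝ) := by rw [div_pow, sq_sqrt (by norm_num)]; norm_num
    rw [h1, cos_pi_div_four, sin_pi_div_four, h2]
    linarith [hk x]

/-- An angle that is at least π/4 at x must have been so at all earlier points. Where it also lies
in [0, π/2] its slope is at most 1 - 3/2 = -1/2, so it would be unbounded towards -∞. -/
theorem IsTailCoeff.leftAngle_lt_pi_div_four {q : ℝ → ℝ} (hq : IsTailCoeff q) {Q Λ : ℝ}
    (hQ : ∀ x, q x ≤ Q) (hΛ : 0 ≤ Λ) (hQΛ : Q + 2 ≤ Λ) (x : ℝ) : leftAngle q Λ x < π / 4 := by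
  have hang := hq.isAngle hΛ
  have hk : ∀ x, q x - Λ ≤ -2 := fun x => by linarith [hQ x]
  obtain ⟨x₀, hx₀⟩ := hq.leftAngle_mem_Icc
  by_contra! hcon
  have hge : ∀ y ≤ x, π / 4 ≤ leftAngle q Λ y := by
    intro y hy
    by_contra! h
    exact absurd (hang.lt_pi_div_four hk hy h) (not_lt.2 hcon)
  set z := min x x₀
  have hanti : AntitoneOn (fun x => leftAngle q Λ x + (1 / 2) * x) (Iic z) := by
    have hd : ∀ x, HasDerivAt (fun x => leftAngle q Λ x + (1 / 2) * x) _ x := fun x =>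
      (hang x).add ((hasDerivAt_id x).const_mul (1 / 2 : ℝ))
    refine antitoneOn_of_deriv_nonpos (convex_Iic z)
      (fun x _ => (hd x).continuousAt.continuousWithinAt)
      (fun x _ => (hd x).differentiableAt.differentiableWithinAt) fun y hy => ?_
    rw [interior_Iic] at hy
    have hy : y ≤ z := le_of_lt hy
    rw [(hd y).deriv]
    have h1 := hge y (hy.trans (min_le_left _ _))
    have h2 := ((hx₀ y (hy.trans (min_le_right _ _))).2 Λ hΛ).2
    have h3 : sin (π / 4) ≤ sin (leftAngle q Λ y) :=
      sin_le_sin_of_le_of_le_pi_div_two (by linarith [pi_pos]) h2 h1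
    have h4 : (1 / 2 : ℝ) ≤ sin (leftAngle q Λ y) ^ 2 := by
      have e : sin (π / 4) ^ 2 = 1 / 2 := by
        rw [sin_pi_div_four, div_pow, sq_sqrt (by norm_num)]; norm_num
      rw [← e]
      exact pow_le_pow_left₀ (by rw [sin_pi_div_four]; positivity) h3 2
    rw [cos_sq']
    nlinarith [hk y]
  -- With slope at most -1/2, going back by 4π raises the angle by at least 2π, beyond π/2.
  have hz : z - 4 * π ≤ z := by linarith [pi_pos]
  have h := hanti (mem_Iic.2 hz) (mem_Iic.2 le_rfl) hz
  simp only at h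
  linarith [((hx₀ _ (hz.trans (min_le_right _ _))).2 Λ hΛ).2, (hq.isLeftAngle hΛ).pos z, pi_pos]

/-! ### Solutions of the linear equation and their Wronskians -/

/-- `ψ` solves `ψ'' + k ψ = 0` in the interior of `s`, and `ψ` and `p = ψ'` are continuous
up to the boundary. -/
structure IsSolOn (k : ℝ → ℝ) (s : Set ℝ) (ψ p : ℝ → ℝ) : Prop where
  continuousOn : ContinuousOn ψ s
  continuousOn_deriv : ContinuousOn p s
  hasDerivAt : ∀ x ∈ interior s, HasDerivAt ψ (p x) x
  hasDerivAt_deriv : ∀ x ∈ interior s, HasDerivAt p (-k x * ψ x) x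

theorem IsSolOn.mono {k : ℝ → ℝ} {s t : Set ℝ} {ψ p : ℝ → ℝ} (h : IsSolOn k t ψ p) (hst : s ⊆ t) :
    IsSolOn k s ψ p :=
  ⟨h.continuousOn.mono hst, h.continuousOn_deriv.mono hst,
    fun x hx => h.hasDerivAt x (interior_mono hst hx),
    fun x hx => h.hasDerivAt_deriv x (interior_mono hst hx)⟩

theorem IsSolOn.sub_const_mul {k : ℝ → ℝ} {s : Set ℝ} {ψ p φ r : ℝ → ℝ} (h : IsSolOn k s ψ p)
    (h' : IsSolOn k s φ r) (c : ℝ) :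
    IsSolOn k s (fun x => ψ x - c * φ x) (fun x => p x - c * r x) where
  continuousOn := h.continuousOn.sub (continuousOn_const.mul h'.continuousOn)
  continuousOn_deriv := h.continuousOn_deriv.sub (continuousOn_const.mul h'.continuousOn_deriv)
  hasDerivAt x hx := (h.hasDerivAt x hx).sub ((h'.hasDerivAt x hx).const_mul c)
  hasDerivAt_deriv x hx := by
    convert! (h.hasDerivAt_deriv x hx).sub ((h'.hasDerivAt_deriv x hx).const_mul c) using 1
    ring

theorem eq_of_hasDerivAt_zero {f : ℝ → ℝ} {s : Set ℝ} (hs : Convex ℝ s) (hc : ContinuousOn f s)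
    (hd : ∀ x ∈ interior s, HasDerivAt f 0 x) {x y : ℝ} (hx : x ∈ s) (hy : y ∈ s) : f x = f y := by
  have hdiff : DifferentiableOn ℝ f (interior s) :=
    fun x hx => (hd x hx).differentiableAt.differentiableWithinAt
  have h1 : MonotoneOn f s := monotoneOn_of_deriv_nonneg hs hc hdiff
    fun x hx => (hd x hx).deriv.ge
  have h2 : AntitoneOn f s := antitoneOn_of_deriv_nonpos hs hc hdiff
    fun x hx => (hd x hx).deriv.le
  rcases le_total x y with h | h
  · exact le_antisymm (h1 hx hy h) (h2 hx hy h)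
  · exact le_antisymm (h2 hy hx h) (h1 hy hx h)

theorem IsSolOn.wronskian_eq {k : ℝ → ℝ} {s : Set ℝ} (hs : Convex ℝ s) {ψ p φ r : ℝ → ℝ}
    (h : IsSolOn k s ψ p) (h' : IsSolOn k s φ r) {x y : ℝ} (hx : x ∈ s) (hy : y ∈ s) :
    ψ x * r x - p x * φ x = ψ y * r y - p y * φ y := by
  refine eq_of_hasDerivAt_zero (f := fun x => ψ x * r x - p x * φ x) hs
    ((h.continuousOn.mul h'.continuousOn_deriv).sub
      (h.continuousOn_deriv.mul h'.continuousOn)) (fun z hz => ?_) hx hy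
  convert! ((h.hasDerivAt z hz).mul (h'.hasDerivAt_deriv z hz)).sub
    ((h.hasDerivAt_deriv z hz).mul (h'.hasDerivAt z hz)) using 1
  ring

/-- The amplitude that belongs to the angle `θ`, normalised at `a`. -/
def amplitude (k θ : ℝ → ℝ) (a x : ℝ) : ℝ :=
  exp (∫ t in a..x, (1 - k t) * sin (θ t) * cos (θ t))

theorem amplitude_pos (k θ : ℝ → ℝ) (a x : ℝ) : 0 < amplitude k θ a x := exp_pos _

@[simp] theorem amplitude_self (k θ : ℝ → ℝ) (a : ℝ) : amplitude k θ a a = 1 := by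
  simp [amplitude]

theorem IsAngle.isSolOn {k θ : ℝ → ℝ} (hk : Continuous k) (h : IsAngle k θ) (a : ℝ) :
    IsSolOn k univ (fun x => amplitude k θ a x * sin (θ x))
      (fun x => amplitude k θ a x * cos (θ x)) := by
  set c : ℝ → ℝ := fun t => (1 - k t) * sin (θ t) * cos (θ t) with hc
  have hcc : Continuous c := by
    have := h.continuous
    fun_prop
  have hA : ∀ x, HasDerivAt (amplitude k θ a) (amplitude k θ a x * c x) x := fun x =>
    (intervalIntegral.integral_hasDerivAt_right (hcc.intervalIntegrable a x)
      (hcc.stronglyMeasurableAtFilter _ _) hcc.continuousAt).exp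
  have h1 : ∀ x, HasDerivAt (fun x => amplitude k θ a x * sin (θ x))
      (amplitude k θ a x * cos (θ x)) x := by
    intro x
    convert! (hA x).mul (h x).sin using 1
    simp only [hc]
    linear_combination (-amplitude k θ a x * cos (θ x)) * sin_sq_add_cos_sq (θ x)
  have h2 : ∀ x, HasDerivAt (fun x => amplitude k θ a x * cos (θ x))
      (-k x * (amplitude k θ a x * sin (θ x))) x := by
    intro x
    convert! (hA x).mul (h x).cos using 1
    simp only [hc]
    linear_combination (amplitude k θ a x * sin (θ x)) * k x * sin_sq_add_cos_sq (θ x)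
  exact ⟨fun x _ => (h1 x).continuousAt.continuousWithinAt,
    fun x _ => (h2 x).continuousAt.continuousWithinAt, fun x _ => h1 x, fun x _ => h2 x⟩

/-- A solution that is parallel to an angle at one point is a multiple of the solution that the
angle defines. -/
theorem IsSolOn.eq_const_mul {k θ ψ p : ℝ → ℝ} {s : Set ℝ} (hs : Convex ℝ s) (hk : Continuous k)
    (h : IsSolOn k s ψ p) (hθ : IsAngle k θ) {a : ℝ} (ha : a ∈ s)
    (hpar : ψ a * cos (θ a) - p a * sin (θ a) = 0) (b : ℝ) :
    ∃ c, ∀ x ∈ s, ψ x = c * (amplitude k θ b x * sin (θ x)) ∧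
      p x = c * (amplitude k θ b x * cos (θ x)) := by
  -- An angle shifted by π/2 gives a second independent solution; a solution whose Wronskians with
  -- both vanish is zero.
  obtain ⟨θ₂, hθ₂, hθ₂a⟩ := exists_isAngle hk a (θ a + π / 2)
  have hsol := (hθ.isSolOn hk b).mono (subset_univ s)
  have hsol₂ := (hθ₂.isSolOn hk a).mono (subset_univ s)
  have hρ := (amplitude_pos k θ b a).ne'
  set c := (ψ a * sin (θ a) + p a * cos (θ a)) / amplitude k θ b a with hc
  have hD := h.sub_const_mul hsol c
  have hca : c * amplitude k θ b a = ψ a * sin (θ a) + p a * cos (θ a) := by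
    rw [hc]; field_simp
  have hz1 : ψ a - c * (amplitude k θ b a * sin (θ a)) = 0 := by
    linear_combination (-sin (θ a)) * hca - ψ a * sin_sq_add_cos_sq (θ a) + cos (θ a) * hpar
  have hz2 : p a - c * (amplitude k θ b a * cos (θ a)) = 0 := by
    linear_combination (-cos (θ a)) * hca - p a * sin_sq_add_cos_sq (θ a) - sin (θ a) * hpar
  refine ⟨c, fun x hx => ?_⟩
  have w1 := hD.wronskian_eq hs hsol hx ha
  have w2 := hD.wronskian_eq hs hsol₂ hx ha
  have w3 := hsol.wronskian_eq hs hsol₂ hx ha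
  simp only [hz1, hz2, zero_mul, sub_zero] at w1 w2
  rw [hθ₂a, sin_add_pi_div_two, cos_add_pi_div_two, amplitude_self] at w3
  set P := ψ x - c * (amplitude k θ b x * sin (θ x))
  set Q := p x - c * (amplitude k θ b x * cos (θ x))
  set s1 := amplitude k θ b x * sin (θ x)
  set c1 := amplitude k θ b x * cos (θ x)
  set s2 := amplitude k θ₂ a x * sin (θ₂ x)
  set c2 := amplitude k θ₂ a x * cos (θ₂ x)
  have hw : s1 * c2 - c1 * s2 = -amplitude k θ b a := by
    linear_combination w3 - amplitude k θ b a * sin_sq_add_cos_sq (θ a)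
  have hP : P * amplitude k θ b a = 0 := by linear_combination s2 * w1 - s1 * w2 + P * hw
  have hQ : Q * amplitude k θ b a = 0 := by linear_combination c2 * w1 - c1 * w2 + Q * hw
  have hP := (mul_eq_zero.1 hP).resolve_right hρ
  have hQ := (mul_eq_zero.1 hQ).resolve_right hρ
  exact ⟨by linarith, by linarith⟩

/-- Nonnegative solutions with nonnegative derivative are square integrable at `-∞`. -/
theorem IsSolOn.integrableOn_sq {k ψ p : ℝ → ℝ} (hk : Continuous k) (h : IsSolOn k univ ψ p)
    {x₀ μ : ℝ} (hμ : 0 < μ) (hneg : ∀ x ≤ x₀, k x ≤ -μ) (hψ : ∀ x ≤ x₀, 0 ≤ ψ x)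
    (hp : ∀ x ≤ x₀, 0 ≤ p x) :
    IntegrableOn (fun x => ψ x ^ 2) (Iic x₀) ∧ IntegrableOn (fun x => p x ^ 2) (Iic x₀) := by
  have hψc : Continuous ψ := by simpa [continuousOn_univ] using h.continuousOn
  have hpc : Continuous p := by simpa [continuousOn_univ] using h.continuousOn_deriv
  have hInt : IntegrableOn (fun x => p x ^ 2 + μ * ψ x ^ 2) (Iic x₀) := by
    refine integrableOn_Iic_of_intervalIntegral_norm_bounded (ψ x₀ * p x₀) x₀ (l := atBot)
      (a := id) (fun i => Continuous.integrableOn_Ioc (by fun_prop)) tendsto_id ?_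
    filter_upwards [eventually_le_atBot x₀] with a ha
    -- Since (ψ p)' = p² - k ψ² dominates p² + μ ψ², the boundary term at x₀ bounds the integral;
    -- the one at a has the favourable sign.
    have hftc : ∫ x in a..x₀, (p x * p x + ψ x * (-k x * ψ x)) = ψ x₀ * p x₀ - ψ a * p a :=
      intervalIntegral.integral_eq_sub_of_hasDerivAt
        (fun x _ => (h.hasDerivAt x (by simp)).mul (h.hasDerivAt_deriv x (by simp)))
        (Continuous.intervalIntegrable (by fun_prop) _ _)
    have hle : ∫ x in a..x₀, ‖p x ^ 2 + μ * ψ x ^ 2‖ ≤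
        ∫ x in a..x₀, (p x * p x + ψ x * (-k x * ψ x)) := by
      refine intervalIntegral.integral_mono_on ha
        (Continuous.intervalIntegrable (by fun_prop) _ _)
        (Continuous.intervalIntegrable (by fun_prop) _ _) fun x hx => ?_
      rw [norm_of_nonneg (by positivity)]
      nlinarith [hneg x hx.2, sq_nonneg (ψ x)]
    refine hle.trans ?_
    rw [hftc]
    linarith [mul_nonneg (hψ a ha) (hp a ha)]
  constructor
  · refine (hInt.const_mul μ⁻¹).mono' (by fun_prop) (Eventually.of_forall fun x => ?_)
    rw [norm_of_nonneg (sq_nonneg _), mul_add, inv_mul_cancel_left₀ hμ.ne']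
    have : 0 ≤ μ⁻¹ * p x ^ 2 := by positivity
    linarith
  · refine hInt.mono' (by fun_prop) (Eventually.of_forall fun x => ?_)
    rw [norm_of_nonneg (sq_nonneg _)]
    have : 0 ≤ μ * ψ x ^ 2 := by positivity
    linarith

theorem integrableOn_Iic_of_continuous {f : ℝ → ℝ} (hf : Continuous f) {x₀ : ℝ}
    (h : IntegrableOn f (Iic x₀)) (b : ℝ) : IntegrableOn f (Iic b) := by
  refine (h.union (hf.integrableOn_Icc (a := x₀) (b := b))).mono_set fun x hx => ?_
  rcases le_total x x₀ with h | h
  · exact Or.inl h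
  · exact Or.inr ⟨h, hx⟩

/-! ### The square integrable solution on a half-line -/

/-- The solution of `ψ'' + (q - Λ) ψ = 0` that decays at `-∞`, normalised at `b`. -/
def leftSol (q : ℝ → ℝ) (Λ b x : ℝ) : ℝ :=
  amplitude (fun x => q x - Λ) (leftAngle q Λ) b x * sin (leftAngle q Λ x)

/-- The derivative of `leftSol`. -/
def leftSolDeriv (q : ℝ → ℝ) (Λ b x : ℝ) : ℝ :=
  amplitude (fun x => q x - Λ) (leftAngle q Λ) b x * cos (leftAngle q Λ x)

theorem IsTailCoeff.isSolOn_leftSol {q : ℝ → ℝ} (hq : IsTailCoeff q) {Λ : ℝ} (hΛ : 0 ≤ Λ) (b : ℝ) :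
    IsSolOn (fun x => q x - Λ) univ (leftSol q Λ b) (leftSolDeriv q Λ b) :=
  (hq.isAngle hΛ).isSolOn (hq.continuous_sub Λ) b

theorem IsTailCoeff.continuous_leftSol {q : ℝ → ℝ} (hq : IsTailCoeff q) {Λ : ℝ} (hΛ : 0 ≤ Λ)
    (b : ℝ) : Continuous (leftSol q Λ b) ∧ Continuous (leftSolDeriv q Λ b) := by
  have h := hq.isSolOn_leftSol hΛ b
  exact ⟨by simpa [continuousOn_univ] using h.continuousOn,
    by simpa [continuousOn_univ] using h.continuousOn_deriv⟩

theorem IsTailCoeff.leftSol_nonneg {q : ℝ → ℝ} (hq : IsTailCoeff q) {Λ : ℝ} (hΛ : 0 ≤ Λ)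
    (b : ℝ) : ∃ x₀, ∀ x ≤ x₀, 0 < leftSol q Λ b x ∧ 0 ≤ leftSolDeriv q Λ b x := by
  obtain ⟨x₀, hx₀⟩ := hq.leftAngle_mem_Icc
  refine ⟨x₀, fun x hx => ?_⟩
  have h := (hx₀ x hx).2 Λ hΛ
  have hpos := (hq.isLeftAngle hΛ).pos x
  exact ⟨mul_pos (amplitude_pos _ _ _ _)
      (sin_pos_of_pos_of_lt_pi hpos (by linarith [h.2, pi_pos])),
    mul_nonneg (amplitude_pos _ _ _ _).le
      (cos_nonneg_of_mem_Icc ⟨by linarith [pi_pos], h.2⟩)⟩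

theorem IsTailCoeff.integrableOn_leftSol_sq {q : ℝ → ℝ} (hq : IsTailCoeff q) {Λ : ℝ} (hΛ : 0 ≤ Λ)
    (b c : ℝ) : IntegrableOn (fun x => leftSol q Λ b x ^ 2) (Iic c) ∧
      IntegrableOn (fun x => leftSolDeriv q Λ b x ^ 2) (Iic c) := by
  obtain ⟨x₀, μ, hμ, hx₀⟩ := hq.neg
  obtain ⟨x₁, hx₁⟩ := hq.leftSol_nonneg hΛ b
  obtain ⟨hc1, hc2⟩ := hq.continuous_leftSol hΛ b
  have h := (hq.isSolOn_leftSol hΛ b).integrableOn_sq (hq.continuous_sub Λ) (x₀ := min x₀ x₁) hμ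
    (fun x hx => by linarith [hx₀ x (hx.trans (min_le_left _ _))])
    (fun x hx => (hx₁ x (hx.trans (min_le_right _ _))).1.le)
    (fun x hx => (hx₁ x (hx.trans (min_le_right _ _))).2)
  exact ⟨integrableOn_Iic_of_continuous (by fun_prop) h.1 c,
    integrableOn_Iic_of_continuous (by fun_prop) h.2 c⟩

/-- Square integrable solutions on a left half-line are multiples of `leftSol`. -/
theorem IsTailCoeff.eq_const_mul_leftSol {q : ℝ → ℝ} (hq : IsTailCoeff q) {Λ : ℝ} (hΛ : 0 ≤ Λ)
    {b : ℝ} {ψ p : ℝ → ℝ} (h : IsSolOn (fun x => q x - Λ) (Iic b) ψ p)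
    (hψ : MemLp ψ 2 (volume.restrict (Iic b))) (hp : MemLp p 2 (volume.restrict (Iic b))) :
    ∃ c, ∀ x ∈ Iic b, ψ x = c * leftSol q Λ b x ∧ p x = c * leftSolDeriv q Λ b x := by
  have hsol := (hq.isSolOn_leftSol hΛ b).mono (subset_univ (Iic b))
  obtain ⟨hc1, hc2⟩ := hq.continuous_leftSol hΛ b
  obtain ⟨hi1, hi2⟩ := hq.integrableOn_leftSol_sq hΛ b b
  have hm1 : MemLp (leftSol q Λ b) 2 (volume.restrict (Iic b)) :=
    (memLp_two_iff_integrable_sq hc1.aestronglyMeasurable).2 hi1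
  have hm2 : MemLp (leftSolDeriv q Λ b) 2 (volume.restrict (Iic b)) :=
    (memLp_two_iff_integrable_sq hc2.aestronglyMeasurable).2 hi2
  have hW : IntegrableOn (fun x => ψ x * leftSolDeriv q Λ b x - p x * leftSol q Λ b x) (Iic b) :=
    (hψ.integrable_mul hm2).sub (hp.integrable_mul hm1)
  have hb : b ∈ Iic b := mem_Iic.2 le_rfl
  -- The Wronskian is constant on a set of infinite measure and integrable, as a combination of
  -- products of square integrable functions; so it is zero.
  have hconst : IntegrableOn (fun _ : ℝ => ψ b * leftSolDeriv q Λ b b - p b * leftSol q Λ b b)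
      (Iic b) := hW.congr_fun
    (fun x hx => h.wronskian_eq (convex_Iic b) hsol hx hb) measurableSet_Iic
  have h0 : ψ b * leftSolDeriv q Λ b b - p b * leftSol q Λ b b = 0 := by
    simpa [integrableOn_const_iff] using hconst
  refine h.eq_const_mul (convex_Iic b) (hq.continuous_sub Λ) (hq.isAngle hΛ) hb ?_ b
  simpa [leftSol, leftSolDeriv] using h0

/-! ### Matching the two decaying solutions -/

/-- The three coefficients of a problem on the line with jumps at `±L`. -/
structure IsStepCoeff (L : ℝ) (ql qm qr : ℝ → ℝ) : Prop where
  pos : 0 < L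
  left : IsTailCoeff ql
  mid_continuous : Continuous qm
  mid_bdd : ∃ Q, ∀ x, |qm x| ≤ Q
  right : IsTailCoeff fun x => qr (-x)

/-- The coefficient with jumps at `±L`. -/
def stepCoeff (L : ℝ) (ql qm qr : ℝ → ℝ) (x : ℝ) : ℝ :=
  if x < -L then ql x else if x ≤ L then qm x else qr x

/-- The continuation of the left angle to the middle interval. -/
def midAngle (L : ℝ) (ql qm : ℝ → ℝ) (Λ : ℝ) : ℝ → ℝ :=
  Classical.epsilon fun θ => IsAngle (fun x => qm x - Λ) θ ∧ θ (-L) = leftAngle ql Λ (-L)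

/-- The angle between the solutions that decay at `-∞` and at `+∞`. -/
def matchAngle (L : ℝ) (ql qm qr : ℝ → ℝ) (Λ : ℝ) : ℝ :=
  midAngle L ql qm Λ L + leftAngle (fun x => qr (-x)) Λ (-L)

theorem midAngle_spec {L : ℝ} {ql qm : ℝ → ℝ} (hqm : Continuous qm) (Λ : ℝ) :
    IsAngle (fun x => qm x - Λ) (midAngle L ql qm Λ) ∧
      midAngle L ql qm Λ (-L) = leftAngle ql Λ (-L) :=
  Classical.epsilon_spec (p := fun θ => IsAngle (fun x => qm x - Λ) θ ∧
    θ (-L) = leftAngle ql Λ (-L)) (exists_isAngle (hqm.sub continuous_const) _ _)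

namespace IsStepCoeff

variable {L : ℝ} {ql qm qr : ℝ → ℝ} {Λ : ℝ}

theorem isAngle_mid (h : IsStepCoeff L ql qm qr) (Λ : ℝ) :
    IsAngle (fun x => qm x - Λ) (midAngle L ql qm Λ) := (midAngle_spec h.mid_continuous Λ).1

theorem midAngle_neg (h : IsStepCoeff L ql qm qr) (Λ : ℝ) :
    midAngle L ql qm Λ (-L) = leftAngle ql Λ (-L) := (midAngle_spec h.mid_continuous Λ).2

theorem continuous_mid (h : IsStepCoeff L ql qm qr) (Λ : ℝ) : Continuous fun x => qm x - Λ :=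
  h.mid_continuous.sub continuous_const

theorem neg_le (h : IsStepCoeff L ql qm qr) : -L ≤ L := by linarith [h.pos]

theorem midAngle_pos (h : IsStepCoeff L ql qm qr) (hΛ : 0 ≤ Λ) {x : ℝ} (hx : -L ≤ x) :
    0 < midAngle L ql qm Λ x := by
  have h0 : 0 < midAngle L ql qm Λ (-L) := by
    rw [h.midAngle_neg]; exact (h.left.isLeftAngle hΛ).pos _
  rcases hx.eq_or_lt with rfl | hx
  · exact h0
  · exact (h.isAngle_mid Λ).pos_of_nonneg hx h0.le

theorem matchAngle_pos (h : IsStepCoeff L ql qm qr) (hΛ : 0 ≤ Λ) :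
    0 < matchAngle L ql qm qr Λ :=
  add_pos (h.midAngle_pos hΛ h.neg_le) ((h.right.isLeftAngle hΛ).pos _)

theorem strictAntiOn_matchAngle (h : IsStepCoeff L ql qm qr) :
    StrictAntiOn (matchAngle L ql qm qr) (Ici 0) := by
  intro Λ₁ h1 Λ₂ h2 h12
  refine add_lt_add ?_ (h.right.leftAngle_lt h1 h12 _)
  refine (h.isAngle_mid Λ₁).lt_of_lt (h.continuous_mid Λ₁) (h.isAngle_mid Λ₂)
    (a := -L) (by linarith [h.pos]) (fun x => by linarith) ?_
  rw [h.midAngle_neg, h.midAngle_neg]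
  exact (h.left.leftAngle_lt h1 h12 _).le

theorem continuousOn_matchAngle (h : IsStepCoeff L ql qm qr) :
    ContinuousOn (matchAngle L ql qm qr) (Ici 0) := by
  refine ContinuousOn.add ?_ (h.right.continuousOn_leftAngle _)
  intro Λ₀ hΛ₀
  have hη : Tendsto (fun Λ : ℝ => |Λ - Λ₀|) (𝓝[Ici 0] Λ₀) (𝓝 0) := by
    have : ContinuousWithinAt (fun Λ : ℝ => |Λ - Λ₀|) (Ici 0) Λ₀ := by fun_prop
    simpa [ContinuousWithinAt] using this
  refine (h.isAngle_mid Λ₀).tendsto (k' := fun Λ x => qm x - Λ) (h.continuous_mid Λ₀)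
    (Eventually.of_forall h.isAngle_mid) h.neg_le hη
    (Eventually.of_forall fun Λ z _ => le_of_eq ?_) ?_
  · congr 1
    ring
  · simp only [h.midAngle_neg]
    exact h.left.continuousOn_leftAngle (-L) Λ₀ hΛ₀

/-- Once Λ exceeds every coefficient by 2, both left angles and the continued middle angle stay
below π/4. -/
theorem exists_matchAngle_lt_pi (h : IsStepCoeff L ql qm qr) :
    ∃ Λ, 0 < Λ ∧ matchAngle L ql qm qr Λ < π := by
  obtain ⟨Q₁, hQ₁⟩ := h.left.bdd
  obtain ⟨Q₂, hQ₂⟩ := h.mid_bdd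
  obtain ⟨Q₃, hQ₃⟩ := h.right.bdd
  have h1 := (abs_nonneg _).trans (hQ₁ 0)
  have h2 := (abs_nonneg _).trans (hQ₂ 0)
  have h3 := (abs_nonneg _).trans (hQ₃ 0)
  have hΛ : 0 ≤ Q₁ + Q₂ + Q₃ + 2 := by linarith
  refine ⟨Q₁ + Q₂ + Q₃ + 2, by linarith, ?_⟩
  have e1 := h.left.leftAngle_lt_pi_div_four (fun x => (le_abs_self _).trans (hQ₁ x)) hΛ
    (by linarith) (-L)
  have e3 := h.right.leftAngle_lt_pi_div_four (fun x => (le_abs_self _).trans (hQ₃ x)) hΛ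
    (by linarith) (-L)
  have e2 := (h.isAngle_mid (Q₁ + Q₂ + Q₃ + 2)).lt_pi_div_four
    (fun x => by linarith [(le_abs_self _).trans (hQ₂ x)]) h.neg_le
    (by rw [h.midAngle_neg]; exact e1)
  rw [matchAngle]
  linarith [pi_pos]

end IsStepCoeff

/-! ### Counting levels -/

/-- The number of levels `k π` that a decreasing function attains. -/
theorem encard_setOf_eq_int_mul_pi {F : ℝ → ℝ} (hc : ContinuousOn F (Ici 0))
    (hanti : StrictAntiOn F (Ici 0)) (hpos : ∀ Λ, 0 ≤ Λ → 0 < F Λ)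
    (hlt : ∃ Λ, 0 < Λ ∧ F Λ < π) {n : ℕ} (h1 : n * π < F 0) (h2 : F 0 ≤ (n + 1) * π) :
    {Λ | 0 < Λ ∧ ∃ k : ℤ, F Λ = k * π}.encard = n := by
  have hπ := pi_pos
  have hinj : InjOn F {Λ | 0 < Λ ∧ ∃ k : ℤ, F Λ = k * π} :=
    hanti.injOn.mono fun Λ hΛ => mem_Ici.2 hΛ.1.le
  -- The levels attained at Λ > 0 are exactly π, …, nπ. The value F 0 itself is excluded, so (n +
  -- 1)π is not counted even if F 0 equals it.
  have himg : F '' {Λ | 0 < Λ ∧ ∃ k : ℤ, F Λ = k * π} =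
      (fun j : ℕ => (j : ℝ) * π) '' (Finset.Icc 1 n : Finset ℕ) := by
    ext y
    constructor
    · rintro ⟨Λ, ⟨hΛ, k, hk⟩, rfl⟩
      have hF0 : F Λ < F 0 := hanti (mem_Ici.2 le_rfl) (mem_Ici.2 hΛ.le) hΛ
      have hFp := hpos Λ hΛ.le
      rw [hk] at hF0 hFp ⊢
      have hk0 : (0 : ℝ) < k := by
        by_contra! hle
        nlinarith
      have hkn : (k : ℝ) < n + 1 := by
        by_contra! hle
        nlinarith
      have hk0' : 0 < k := by exact_mod_cast hk0
      have hkn' : k < n + 1 := by exact_mod_cast hkn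
      obtain ⟨j, rfl⟩ := Int.eq_ofNat_of_zero_le hk0'.le
      exact ⟨j, by simp; omega, by simp⟩
    · rintro ⟨j, hj, rfl⟩
      simp only [Finset.coe_Icc, mem_Icc] at hj
      obtain ⟨Λ₁, hΛ₁, hFΛ₁⟩ := hlt
      have hj1 : (1 : ℝ) ≤ j := by exact_mod_cast hj.1
      have hj2 : (j : ℝ) ≤ n := by exact_mod_cast hj.2
      have hmem : (j : ℝ) * π ∈ Icc (F Λ₁) (F 0) := ⟨by nlinarith, by nlinarith⟩
      obtain ⟨Λ, hΛ, hFΛ⟩ := intermediate_value_Icc' hΛ₁.le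
        (hc.mono fun x hx => mem_Ici.2 hx.1) hmem
      refine ⟨Λ, ⟨lt_of_le_of_ne hΛ.1 ?_, j, by simpa using hFΛ⟩, hFΛ⟩
      rintro rfl
      nlinarith
  rw [← hinj.encard_image, himg, Function.Injective.encard_image, encard_coe_eq_coe_finsetCard]
  · simp
  · intro i j hij
    have := mul_right_cancel₀ hπ.ne' hij
    exact_mod_cast this

/-! ### From H² eigenfunctions to matched solutions and back -/

theorem MemH2.continuous {F : Type*} [NormedAddCommGroup F] [NormedSpace ℝ F] {Ψ : ℝ → F}
    (h : MemH2 Ψ) : Continuous Ψ := h.differentiable.continuous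

theorem MemH2.continuous_deriv {F : Type*} [NormedAddCommGroup F] [NormedSpace ℝ F] {Ψ : ℝ → F}
    (h : MemH2 Ψ) : Continuous (deriv Ψ) := by
  refine continuous_iff_continuousAt.2 fun x => ?_
  have := (h.absolutelyContinuous (x - 1) (x + 1)).continuousOn
  rw [uIcc_of_le (by linarith)] at this
  exact this.continuousAt (Icc_mem_nhds (by linarith) (by linarith))

/-- By absolute continuity Ψ' is the integral of Ψ'', which equals the continuous function -kΨ
almost everywhere; hence the equation holds at every interior point. -/
theorem MemH2.isSolOn {Ψ k : ℝ → ℝ} (h : MemH2 Ψ) (hk : Continuous k) {s : Set ℝ}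
    (heq : ∀ᵐ x, x ∈ interior s → deriv (deriv Ψ) x = -k x * Ψ x) :
    IsSolOn k s Ψ (deriv Ψ) := by
  refine ⟨h.continuous.continuousOn, h.continuous_deriv.continuousOn,
    fun x _ => (h.differentiable x).hasDerivAt, fun x hx => ?_⟩
  have hc : Continuous fun x => -k x * Ψ x := by
    have := h.continuous
    fun_prop
  obtain ⟨ε, hε, hball⟩ := Metric.isOpen_iff.1 (isOpen_interior (s := s)) x hx
  rw [Real.ball_eq_Ioo] at hball
  have hev : deriv Ψ =ᶠ[𝓝 x] fun y => deriv Ψ x + ∫ t in x..y, -k t * Ψ t := by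
    filter_upwards [Ioo_mem_nhds (show x - ε < x by linarith) (show x < x + ε by linarith)]
      with y hy
    rw [← sub_eq_iff_eq_add', ← (h.absolutelyContinuous x y).integral_deriv_eq_sub]
    refine intervalIntegral.integral_congr_ae ?_
    filter_upwards [heq] with t ht htm
    refine ht (hball ?_)
    rcases le_total x y with hxy | hxy
    · rw [uIoc_of_le hxy] at htm
      exact ⟨by linarith [htm.1], by linarith [htm.2, hy.2]⟩
    · rw [uIoc_of_ge hxy] at htm
      exact ⟨by linarith [htm.1, hy.1], by linarith [htm.2]⟩
  have hd := (intervalIntegral.integral_hasDerivAt_right (hc.intervalIntegrable x x)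
    (hc.stronglyMeasurableAtFilter _ _) hc.continuousAt).const_add (deriv Ψ x)
  exact hd.congr_of_eventuallyEq hev

theorem hasDerivAt_ite_le {a : ℝ} {f f' g g' : ℝ → ℝ} (hf : ∀ x, HasDerivAt f (f' x) x)
    (hg : ∀ x, HasDerivAt g (g' x) x) (h0 : f a = g a) (h1 : f' a = g' a) (x : ℝ) :
    HasDerivAt (fun x => if x ≤ a then f x else g x) (if x ≤ a then f' x else g' x) x := by
  rcases lt_trichotomy x a with hx | rfl | hx
  · rw [if_pos hx.le]
    refine (hf x).congr_of_eventuallyEq ?_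
    filter_upwards [gt_mem_nhds hx] with y hy using if_pos (le_of_lt hy)
  · rw [if_pos le_rfl]
    have hl : HasDerivWithinAt (fun y => if y ≤ x then f y else g y) (f' x) (Iic x) x :=
      (hf x).hasDerivWithinAt.congr (fun y hy => if_pos hy) (if_pos le_rfl)
    have hr : HasDerivWithinAt (fun y => if y ≤ x then f y else g y) (f' x) (Ici x) x := by
      rw [h1]
      refine (hg x).hasDerivWithinAt.congr (fun y hy => ?_) (by simp [h0])
      rcases (mem_Ici.1 hy).eq_or_lt with rfl | hy
      · simp [h0]
      · exact if_neg (not_le.2 hy)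
    simpa using hl.union hr
  · rw [if_neg (not_le.2 hx)]
    refine (hg x).congr_of_eventuallyEq ?_
    filter_upwards [lt_mem_nhds hx] with y hy using if_neg (not_le.2 hy)

theorem locallyLipschitz_ite_le {a : ℝ} {f g : ℝ → ℝ} (hf : LocallyLipschitz f)
    (hg : LocallyLipschitz g) (h0 : f a = g a) :
    LocallyLipschitz fun x => if x ≤ a then f x else g x := by
  -- Truncating the arguments by min and max writes the glued function through sums and compositions
  -- of locally Lipschitz functions.
  have heq : (fun x => if x ≤ a then f x else g x) =
      fun x => (f (min x a) + g (max x a)) - g a := by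
    funext x
    split_ifs with h
    · rw [min_eq_left h, max_eq_right h]; ring
    · rw [min_eq_right (not_le.1 h).le, max_eq_left (not_le.1 h).le, h0]; ring
  rw [heq]
  exact ((hf.comp (LocallyLipschitz.id.min_const a)).add
    (hg.comp (LocallyLipschitz.id.max_const a))).sub (LocallyLipschitz.const _)

theorem hasDerivAt_comp_neg {f : ℝ → ℝ} {f' x : ℝ} (h : HasDerivAt f f' (-x)) :
    HasDerivAt (fun y => f (-y)) (-f') x := by
  convert! h.comp x (hasDerivAt_neg x) using 1
  ring

theorem IsSolOn.comp_neg {k ψ p : ℝ → ℝ} {b : ℝ} (h : IsSolOn k (Ici b) ψ p) :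
    IsSolOn (fun x => k (-x)) (Iic (-b)) (fun x => ψ (-x)) (fun x => -p (-x)) := by
  have hmaps : MapsTo (fun x : ℝ => -x) (Iic (-b)) (Ici b) := fun x hx => by
    simp only [mem_Iic, mem_Ici] at hx ⊢
    linarith
  have hInt : ∀ x ∈ interior (Iic (-b)), -x ∈ interior (Ici b) := fun x hx => by
    simp only [interior_Iic, interior_Ici, mem_Iio, mem_Ioi] at hx ⊢
    linarith
  refine ⟨h.continuousOn.comp continuousOn_neg hmaps,
    (h.continuousOn_deriv.comp continuousOn_neg hmaps).neg, fun x hx => ?_, fun x hx => ?_⟩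
  · exact hasDerivAt_comp_neg (h.hasDerivAt _ (hInt x hx))
  · simpa using (hasDerivAt_comp_neg (h.hasDerivAt_deriv _ (hInt x hx))).fun_neg

/-- `Ψ ∈ H²` solves `Ψ'' + q Ψ = Λ Ψ`, where `q` has jumps at `±L`. -/
def IsStepSol (L : ℝ) (ql qm qr : ℝ → ℝ) (Λ : ℝ) (Ψ : ℝ → ℝ) : Prop :=
  MemH2 Ψ ∧ ∀ᵐ x, deriv (deriv Ψ) x + stepCoeff L ql qm qr x * Ψ x = Λ * Ψ x

/-- The continuation of the left solution to the middle interval. -/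
def midSol (L : ℝ) (ql qm : ℝ → ℝ) (Λ x : ℝ) : ℝ :=
  amplitude (fun x => qm x - Λ) (midAngle L ql qm Λ) (-L) x * sin (midAngle L ql qm Λ x)

/-- The derivative of `midSol`. -/
def midSolDeriv (L : ℝ) (ql qm : ℝ → ℝ) (Λ x : ℝ) : ℝ :=
  amplitude (fun x => qm x - Λ) (midAngle L ql qm Λ) (-L) x * cos (midAngle L ql qm Λ x)

/-- The factor of the right solution in `stepSol`. -/
def rightFactor (L : ℝ) (ql qm qr : ℝ → ℝ) (Λ : ℝ) : ℝ :=
  -(amplitude (fun x => qm x - Λ) (midAngle L ql qm Λ) (-L) L * cos (matchAngle L ql qm qr Λ))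

/-- The eigenfunction for an eigenvalue `Λ`. -/
def stepSol (L : ℝ) (ql qm qr : ℝ → ℝ) (Λ x : ℝ) : ℝ :=
  if x ≤ -L then leftSol ql Λ (-L) x else if x ≤ L then midSol L ql qm Λ x else
    rightFactor L ql qm qr Λ * leftSol (fun x => qr (-x)) Λ (-L) (-x)

/-- The derivative of `stepSol`. -/
def stepSolDeriv (L : ℝ) (ql qm qr : ℝ → ℝ) (Λ x : ℝ) : ℝ :=
  if x ≤ -L then leftSolDeriv ql Λ (-L) x else if x ≤ L then midSolDeriv L ql qm Λ x else
    -rightFactor L ql qm qr Λ * leftSolDeriv (fun x => qr (-x)) Λ (-L) (-x)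

/-- Reflection reverses the sign of the derivative, so the right solution points along (sin B, -cos
B) at L. This is parallel to (sin A, cos A) iff sin (A + B) = 0, and the factor -cos (A + B) adjusts
the sign. -/
theorem stepSol_match {L : ℝ} {ql qm qr : ℝ → ℝ} {Λ : ℝ}
    (hF : sin (matchAngle L ql qm qr Λ) = 0) :
    midSol L ql qm Λ L =
        rightFactor L ql qm qr Λ * leftSol (fun x => qr (-x)) Λ (-L) (-L) ∧
      midSolDeriv L ql qm Λ L =
        -rightFactor L ql qm qr Λ * leftSolDeriv (fun x => qr (-x)) Λ (-L) (-L) := by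
  simp only [midSol, midSolDeriv, rightFactor, leftSol, leftSolDeriv, amplitude_self, one_mul]
  set A := midAngle L ql qm Λ L with hA
  set B := leftAngle (fun x => qr (-x)) Λ (-L) with hB
  have hFA : matchAngle L ql qm qr Λ = A + B := rfl
  have hAF : A = (A + B) - B := by ring
  rw [hFA] at hF ⊢
  constructor
  · conv_lhs => rw [hAF, sin_sub, hF]
    ring
  · conv_lhs => rw [hAF, cos_sub, hF]
    ring

theorem memLp_two_of_eqOn (L : ℝ) {f fl fr : ℝ → ℝ} (hf : Continuous f)
    (hl : IntegrableOn (fun x => fl x ^ 2) (Iic (-L)))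
    (hr : IntegrableOn (fun x => fr x ^ 2) (Iic (-L))) {c : ℝ} (hfl : ∀ x ≤ -L, f x = fl x)
    (hfr : ∀ x, L < x → f x = c * fr (-x)) : MemLp f 2 volume := by
  rw [memLp_two_iff_integrable_sq hf.aestronglyMeasurable, ← integrableOn_univ]
  have h1 : IntegrableOn (fun x => f x ^ 2) (Iic (-L)) :=
    hl.congr_fun (fun x hx => by simp [hfl x hx]) measurableSet_Iic
  have h2 : IntegrableOn (fun x => f x ^ 2) (Icc (-L) L) := (hf.pow 2).integrableOn_Icc
  have h3 : IntegrableOn (fun x => f x ^ 2) (Ioi L) := by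
    have h4 : IntegrableOn (fun x => fr (-x) ^ 2) (Ici L) := by
      have := ((Measure.measurePreserving_neg (volume : Measure ℝ)).integrableOn_comp_preimage
        (Homeomorph.neg ℝ).measurableEmbedding).2 hr
      rwa [neg_preimage, neg_Iic, neg_neg] at this
    have h5 : IntegrableOn (fun x => c ^ 2 * fr (-x) ^ 2) (Ioi L) :=
      (h4.mono_set Ioi_subset_Ici_self).const_mul (c ^ 2)
    refine h5.congr_fun (fun x hx => ?_) measurableSet_Ioi
    simp only [hfr x hx]
    ring
  refine ((h1.union h2).union h3).mono_set fun x _ => ?_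
  rcases le_or_gt x (-L) with hx | hx
  · exact Or.inl (Or.inl hx)
  · rcases le_or_gt x L with hx' | hx'
    · exact Or.inl (Or.inr ⟨hx.le, hx'⟩)
    · exact Or.inr hx'

namespace IsStepCoeff

variable {L : ℝ} {ql qm qr : ℝ → ℝ} {Λ : ℝ} {Ψ : ℝ → ℝ}

theorem right_continuous (h : IsStepCoeff L ql qm qr) : Continuous qr := by
  simpa [Function.comp_def] using h.right.continuous.comp continuous_neg

theorem isSolOn_midSol (h : IsStepCoeff L ql qm qr) (Λ : ℝ) :
    IsSolOn (fun x => qm x - Λ) univ (midSol L ql qm Λ) (midSolDeriv L ql qm Λ) :=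
  (h.isAngle_mid Λ).isSolOn (h.continuous_mid Λ) (-L)

theorem midSol_neg (h : IsStepCoeff L ql qm qr) (Λ : ℝ) :
    midSol L ql qm Λ (-L) = leftSol ql Λ (-L) (-L) := by
  simp [midSol, leftSol, h.midAngle_neg]

theorem midSolDeriv_neg (h : IsStepCoeff L ql qm qr) (Λ : ℝ) :
    midSolDeriv L ql qm Λ (-L) = leftSolDeriv ql Λ (-L) (-L) := by
  simp [midSolDeriv, leftSolDeriv, h.midAngle_neg]

/-- Square integrability leaves one constant on each half-line, and continuity of Ψ and Ψ' at -L
transfers the left one to the middle. The two conditions at L fix the right constant and force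
either Ψ = 0 or the matching condition. -/
theorem eq_const_mul_stepSol (h : IsStepCoeff L ql qm qr) (hΛ : 0 ≤ Λ)
    (hΨ : IsStepSol L ql qm qr Λ Ψ) :
    ∃ c, (∀ x, Ψ x = c * stepSol L ql qm qr Λ x) ∧
      (c = 0 ∨ sin (matchAngle L ql qm qr Λ) = 0) := by
  obtain ⟨hH, hae⟩ := hΨ
  have hL := h.pos
  have hl : IsSolOn (fun x => ql x - Λ) (Iic (-L)) Ψ (deriv Ψ) := by
    refine hH.isSolOn (h.left.continuous_sub Λ) ?_
    filter_upwards [hae] with x hx hxm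
    rw [interior_Iic, mem_Iio] at hxm
    rw [stepCoeff, if_pos hxm] at hx
    linarith
  have hm : IsSolOn (fun x => qm x - Λ) (Icc (-L) L) Ψ (deriv Ψ) := by
    refine hH.isSolOn (h.continuous_mid Λ) ?_
    filter_upwards [hae] with x hx hxm
    rw [interior_Icc] at hxm
    rw [stepCoeff, if_neg (not_lt.2 hxm.1.le), if_pos hxm.2.le] at hx
    linarith
  have hr : IsSolOn (fun x => qr x - Λ) (Ici L) Ψ (deriv Ψ) := by
    refine hH.isSolOn (k := fun x => qr x - Λ) (h.right_continuous.sub continuous_const) ?_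
    filter_upwards [hae] with x hx hxm
    rw [interior_Ici, mem_Ioi] at hxm
    rw [stepCoeff, if_neg (not_lt.2 (by linarith)), if_neg (not_le.2 hxm)] at hx
    linarith
  have hneg := Measure.measurePreserving_neg (volume : Measure ℝ)
  obtain ⟨c, hc⟩ := h.left.eq_const_mul_leftSol hΛ hl (hH.memLp.restrict _)
    (hH.memLp_deriv.restrict _)
  obtain ⟨c', hc'⟩ := h.right.eq_const_mul_leftSol hΛ hr.comp_neg
    ((hH.memLp.comp_measurePreserving hneg).restrict _)
    ((hH.memLp_deriv.comp_measurePreserving hneg).neg.restrict _)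
  have hmL : -L ∈ Icc (-L) L := ⟨le_rfl, h.neg_le⟩
  have hLL : L ∈ Icc (-L) L := ⟨h.neg_le, le_rfl⟩
  obtain ⟨hcl1, hcl2⟩ := hc (-L) (mem_Iic.2 le_rfl)
  obtain ⟨cm, hcm⟩ := hm.eq_const_mul (convex_Icc _ _) (h.continuous_mid Λ) (h.isAngle_mid Λ) hmL
    (by
      rw [hcl1, hcl2, h.midAngle_neg, leftSol, leftSolDeriv]
      ring) (-L)
  obtain ⟨hm1, hm2⟩ := hcm (-L) hmL
  have hcmc : cm = c := by
    rw [hcl1, leftSol, amplitude_self, amplitude_self, h.midAngle_neg] at hm1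
    rw [hcl2, leftSolDeriv, amplitude_self, amplitude_self, h.midAngle_neg] at hm2
    linear_combination (-sin (leftAngle ql Λ (-L))) * hm1 - cos (leftAngle ql Λ (-L)) * hm2 +
      (c - cm) * sin_sq_add_cos_sq (leftAngle ql Λ (-L))
  subst hcmc
  obtain ⟨hr1, hr2⟩ := hc' (-L) (mem_Iic.2 le_rfl)
  obtain ⟨hm3, hm4⟩ := hcm L hLL
  simp only [neg_neg, leftSol, leftSolDeriv, amplitude_self, one_mul] at hr1 hr2
  set A := midAngle L ql qm Λ L with hA
  set B := leftAngle (fun x => qr (-x)) Λ (-L) with hB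
  set ρ := amplitude (fun x => qm x - Λ) (midAngle L ql qm Λ) (-L) L with hρ
  have e1 : cm * (ρ * sin A) = c' * sin B := by rw [← hm3, hr1]
  have e2 : cm * (ρ * cos A) = -(c' * cos B) := by rw [← hm4, ← hr2, neg_neg]
  have hF : matchAngle L ql qm qr Λ = A + B := rfl
  have hc'eq : c' = cm * rightFactor L ql qm qr Λ := by
    rw [rightFactor, hF, ← hρ, cos_add]
    linear_combination (-sin B) * e1 + cos B * e2 - c' * sin_sq_add_cos_sq B
  refine ⟨cm, fun x => ?_, ?_⟩
  · rw [stepSol]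
    split_ifs with h1 h2
    · exact (hc x h1).1
    · exact (hcm x ⟨(not_le.1 h1).le, h2⟩).1
    · have := (hc' (-x) (by rw [mem_Iic]; linarith [not_le.1 h2])).1
      rw [neg_neg] at this
      rw [this, hc'eq]
      ring
  · have hρ0 : ρ ≠ 0 := (amplitude_pos _ _ _ _).ne'
    have : cm * ρ * sin (A + B) = 0 := by
      rw [sin_add]
      linear_combination cos B * e1 + sin B * e2
    rw [hF]
    simpa [hρ0] using this

theorem hasDerivAt_stepSol (h : IsStepCoeff L ql qm qr) (hΛ : 0 ≤ Λ)
    (hF : sin (matchAngle L ql qm qr Λ) = 0) (x : ℝ) :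
    HasDerivAt (stepSol L ql qm qr Λ) (stepSolDeriv L ql qm qr Λ x) x := by
  have hu : ∀ x : ℝ, x ∈ interior (univ : Set ℝ) := by simp
  obtain ⟨m1, m2⟩ := stepSol_match hF
  have hr : ∀ x, HasDerivAt
      (fun x => rightFactor L ql qm qr Λ * leftSol (fun x => qr (-x)) Λ (-L) (-x))
      (-rightFactor L ql qm qr Λ * leftSolDeriv (fun x => qr (-x)) Λ (-L) (-x)) x := by
    intro x
    have := (hasDerivAt_comp_neg ((h.right.isSolOn_leftSol hΛ (-L)).hasDerivAt (-x)
      (hu _))).const_mul (rightFactor L ql qm qr Λ)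
    simpa using this
  refine hasDerivAt_ite_le (fun x => (h.left.isSolOn_leftSol hΛ (-L)).hasDerivAt x (hu x))
    (hasDerivAt_ite_le (fun x => (h.isSolOn_midSol Λ).hasDerivAt x (hu x)) hr m1 m2) ?_ ?_ x
  · simp [h.neg_le, h.midSol_neg]
  · simp [h.neg_le, h.midSolDeriv_neg]

/-- The second derivative may jump at ±L, so Ψ' need not be C¹; a local Lipschitz bound survives the
gluing and yields the absolute continuity required in `MemH2`. -/
theorem locallyLipschitz_stepSolDeriv (h : IsStepCoeff L ql qm qr) (hΛ : 0 ≤ Λ)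
    (hF : sin (matchAngle L ql qm qr Λ) = 0) :
    LocallyLipschitz (stepSolDeriv L ql qm qr Λ) := by
  have hu : ∀ x : ℝ, x ∈ interior (univ : Set ℝ) := by simp
  obtain ⟨m1, m2⟩ := stepSol_match hF
  have hlip : ∀ {k ψ p : ℝ → ℝ}, Continuous k → IsSolOn k univ ψ p → LocallyLipschitz p := by
    intro k ψ p hk hs
    have hψ : Continuous ψ := by simpa [continuousOn_univ] using hs.continuousOn
    refine ContDiff.locallyLipschitz (𝕂 := ℝ) (contDiff_one_iff_deriv.2
      ⟨fun x => (hs.hasDerivAt_deriv x (hu x)).differentiableAt, ?_⟩)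
    have : deriv p = fun x => -k x * ψ x := funext fun x => (hs.hasDerivAt_deriv x (hu x)).deriv
    rw [this]
    fun_prop
  have hneg : LocallyLipschitz fun x : ℝ => -x :=
    (contDiff_neg (𝕜 := ℝ) (n := 1)).locallyLipschitz
  have hmul : LocallyLipschitz fun x : ℝ => -rightFactor L ql qm qr Λ * x :=
    ContDiff.locallyLipschitz (𝕂 := ℝ) (by fun_prop)
  refine locallyLipschitz_ite_le (hlip (h.left.continuous_sub Λ) (h.left.isSolOn_leftSol hΛ (-L)))
    (locallyLipschitz_ite_le (hlip (h.continuous_mid Λ) (h.isSolOn_midSol Λ))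
      (hmul.comp ((hlip (h.right.continuous_sub Λ) (h.right.isSolOn_leftSol hΛ (-L))).comp hneg))
      m2) ?_
  simp [h.neg_le, h.midSolDeriv_neg]

theorem hasDerivAt_stepSolDeriv (h : IsStepCoeff L ql qm qr) (hΛ : 0 ≤ Λ) {x : ℝ}
    (hx1 : x ≠ -L) (hx2 : x ≠ L) :
    HasDerivAt (stepSolDeriv L ql qm qr Λ)
      ((Λ - stepCoeff L ql qm qr x) * stepSol L ql qm qr Λ x) x := by
  have hu : ∀ x : ℝ, x ∈ interior (univ : Set ℝ) := by simp
  have hL := h.pos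
  rcases hx1.lt_or_gt with h1 | h1
  · have hd := (h.left.isSolOn_leftSol hΛ (-L)).hasDerivAt_deriv x (hu x)
    rw [stepCoeff, if_pos h1, stepSol, if_pos h1.le, ← neg_sub]
    refine hd.congr_of_eventuallyEq ?_
    filter_upwards [gt_mem_nhds h1] with y hy using if_pos (le_of_lt hy)
  · rcases hx2.lt_or_gt with h2 | h2
    · have hd := (h.isSolOn_midSol Λ).hasDerivAt_deriv x (hu x)
      rw [stepCoeff, if_neg (not_lt.2 h1.le), if_pos h2.le, stepSol, if_neg (not_le.2 h1),
        if_pos h2.le, ← neg_sub]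
      refine hd.congr_of_eventuallyEq ?_
      filter_upwards [Ioo_mem_nhds h1 h2] with y hy
      rw [stepSolDeriv, if_neg (not_le.2 hy.1), if_pos hy.2.le]
    · have hd := (hasDerivAt_comp_neg ((h.right.isSolOn_leftSol hΛ (-L)).hasDerivAt_deriv (-x)
        (hu _))).const_mul (-rightFactor L ql qm qr Λ)
      rw [stepCoeff, if_neg (not_lt.2 h1.le), if_neg (not_le.2 h2), stepSol, if_neg (not_le.2 h1),
        if_neg (not_le.2 h2)]
      have hev : stepSolDeriv L ql qm qr Λ =ᶠ[𝓝 x] fun y => -rightFactor L ql qm qr Λ *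
          leftSolDeriv (fun x => qr (-x)) Λ (-L) (-y) := by
        filter_upwards [lt_mem_nhds h2] with y hy
        rw [stepSolDeriv, if_neg (not_le.2 (by linarith)), if_neg (not_le.2 hy)]
      convert! hd.congr_of_eventuallyEq hev using 1
      simp
      ring

theorem exists_abs_stepCoeff_le (h : IsStepCoeff L ql qm qr) :
    ∃ Q, ∀ x, |stepCoeff L ql qm qr x| ≤ Q := by
  obtain ⟨Q₁, hQ₁⟩ := h.left.bdd
  obtain ⟨Q₂, hQ₂⟩ := h.mid_bdd
  obtain ⟨Q₃, hQ₃⟩ := h.right.bdd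
  refine ⟨max Q₁ (max Q₂ Q₃), fun x => ?_⟩
  rw [stepCoeff]
  split_ifs
  · exact (hQ₁ x).trans (le_max_left _ _)
  · exact (hQ₂ x).trans ((le_max_left _ _).trans (le_max_right _ _))
  · have := hQ₃ (-x)
    rw [neg_neg] at this
    exact this.trans ((le_max_right _ _).trans (le_max_right _ _))

theorem isStepSol_stepSol (h : IsStepCoeff L ql qm qr) (hΛ : 0 ≤ Λ)
    (hF : sin (matchAngle L ql qm qr Λ) = 0) :
    IsStepSol L ql qm qr Λ (stepSol L ql qm qr Λ) := by
  have hL := h.pos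
  have hd := h.hasDerivAt_stepSol hΛ hF
  have hderiv : deriv (stepSol L ql qm qr Λ) = stepSolDeriv L ql qm qr Λ :=
    funext fun x => (hd x).deriv
  have hlip := h.locallyLipschitz_stepSolDeriv hΛ hF
  have hc : Continuous (stepSol L ql qm qr Λ) :=
    continuous_iff_continuousAt.2 fun x => (hd x).continuousAt
  obtain ⟨i1, i2⟩ := h.left.integrableOn_leftSol_sq hΛ (-L) (-L)
  obtain ⟨i3, i4⟩ := h.right.integrableOn_leftSol_sq hΛ (-L) (-L)
  have hm1 : MemLp (stepSol L ql qm qr Λ) 2 volume :=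
    memLp_two_of_eqOn L hc i1 i3 (c := rightFactor L ql qm qr Λ) (fun x hx => if_pos hx)
      fun x hx => by
        rw [stepSol, if_neg (not_le.2 (by linarith)), if_neg (not_le.2 hx)]
  have hm2 : MemLp (stepSolDeriv L ql qm qr Λ) 2 volume :=
    memLp_two_of_eqOn L hlip.continuous i2 i4 (c := -rightFactor L ql qm qr Λ)
      (fun x hx => if_pos hx) fun x hx => by
        rw [stepSolDeriv, if_neg (not_le.2 (by linarith)), if_neg (not_le.2 hx)]
  have hae : ∀ᵐ x, deriv (stepSolDeriv L ql qm qr Λ) x =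
      (Λ - stepCoeff L ql qm qr x) * stepSol L ql qm qr Λ x := by
    filter_upwards [Measure.ae_ne volume (-L), Measure.ae_ne volume L] with x h1 h2
    exact (h.hasDerivAt_stepSolDeriv hΛ h1 h2).deriv
  refine ⟨⟨fun x => (hd x).differentiableAt, fun a b => ?_, hm1, hderiv ▸ hm2, ?_⟩, ?_⟩
  · rw [hderiv]
    obtain ⟨K, hK⟩ := (hlip.locallyLipschitzOn (s := uIcc a b)).exists_lipschitzOnWith_of_compact
      isCompact_uIcc
    exact hK.absolutelyContinuousOnInterval
  · rw [hderiv]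
    obtain ⟨Q, hQ⟩ := h.exists_abs_stepCoeff_le
    refine hm1.of_le_mul (c := Λ + Q) (stronglyMeasurable_deriv _).aestronglyMeasurable ?_
    filter_upwards [hae] with x hx
    rw [hx, norm_mul]
    gcongr
    rw [norm_eq_abs]
    refine (abs_sub _ _).trans ?_
    rw [abs_of_nonneg hΛ]
    linarith [hQ x]
  · rw [hderiv]
    filter_upwards [hae] with x hx
    rw [hx]
    ring

theorem stepSol_ne_zero (h : IsStepCoeff L ql qm qr) (hΛ : 0 ≤ Λ) :
    stepSol L ql qm qr Λ ≠ 0 := by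
  obtain ⟨x₀, hx₀⟩ := h.left.leftSol_nonneg hΛ (-L)
  intro h0
  have := congrFun h0 (min x₀ (-L))
  rw [stepSol, if_pos (min_le_right _ _)] at this
  exact (hx₀ _ (min_le_left _ _)).1.ne' this

end IsStepCoeff

/-! ### Zeros of the eigenfunction -/

theorem IsLeftAngle.exists_eq_pi {k θ : ℝ → ℝ} (h : IsLeftAngle k θ) {b : ℝ} (hb : π ≤ θ b) :
    ∃ x ≤ b, θ x = π := by
  obtain ⟨h, x₀, hx₀⟩ := h
  have h1 := (hx₀ _ (min_le_left x₀ b)).2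
  obtain ⟨x, hx, hxe⟩ := intermediate_value_Icc (min_le_right x₀ b) h.continuous.continuousOn
    ⟨(by linarith [pi_pos] : θ (min x₀ b) ≤ π), hb⟩
  exact ⟨x, hx.2, hxe⟩

theorem IsAngle.le_pi_of_lt {k θ : ℝ → ℝ} (h : IsAngle k θ) {a b : ℝ} (hab : a ≤ b)
    (hb : θ b < π) : θ a < π := by
  by_contra! hcon
  rcases hab.eq_or_lt with rfl | hab
  · linarith
  · have := h.nat_mul_pi_lt 1 hab (by simpa using hcon)
    simp at this
    linarith

namespace IsStepCoeff

variable {L : ℝ} {ql qm qr : ℝ → ℝ} {Λ : ℝ}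

/-- Zeros occur where an angle is a multiple of π. Both the left and the right angle are positive
and start below π, and they cross π only upwards. If their sum at the junction is π, neither reaches
π; if it is at least 2π, one of them must have passed through π. -/
theorem stepSol_ne_zero_iff (h : IsStepCoeff L ql qm qr) (hΛ : 0 ≤ Λ) {k : ℕ} (hk : 1 ≤ k)
    (hF : matchAngle L ql qm qr Λ = k * π) :
    (∀ x, stepSol L ql qm qr Λ x ≠ 0) ↔ k = 1 := by
  have hL := h.pos
  have hπ := pi_pos
  have hang := h.left.isLeftAngle hΛ
  have hangr := h.right.isLeftAngle hΛ
  have hr0 : rightFactor L ql qm qr Λ ≠ 0 := by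
    rw [rightFactor, hF, cos_nat_mul_pi]
    exact neg_ne_zero.2 (mul_ne_zero (amplitude_pos _ _ _ _).ne' (by simp))
  have hA := h.midAngle_pos hΛ h.neg_le
  have hB := hangr.pos (-L)
  rw [matchAngle] at hF
  constructor
  · intro hz
    by_contra hk1
    have hk2 : (2 : ℝ) ≤ k := by exact_mod_cast (show 2 ≤ k by omega)
    have hor : π ≤ midAngle L ql qm Λ L ∨ π ≤ leftAngle (fun x => qr (-x)) Λ (-L) := by
      by_contra! hcon
      nlinarith [hcon.1, hcon.2]
    rcases hor with hor | hor
    · rcases le_or_gt π (leftAngle ql Λ (-L)) with h1 | h1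
      · obtain ⟨x, hx, hxe⟩ := hang.exists_eq_pi h1
        refine hz x ?_
        rw [stepSol, if_pos hx, leftSol, hxe, sin_pi, mul_zero]
      · rw [← h.midAngle_neg] at h1
        obtain ⟨x, hx, hxe⟩ := intermediate_value_Icc h.neg_le
          (h.isAngle_mid Λ).continuous.continuousOn ⟨h1.le, hor⟩
        rcases hx.1.eq_or_lt with rfl | hx1
        · linarith
        refine hz x ?_
        rw [stepSol, if_neg (not_le.2 hx1), if_pos hx.2, midSol, hxe, sin_pi, mul_zero]
    · obtain ⟨x, hx, hxe⟩ := hangr.exists_eq_pi hor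
      -- If the right angle equals π exactly at the junction, the zero is at L, which belongs to the
      -- middle piece.
      rcases hx.eq_or_lt with rfl | hx
      · refine hz L ?_
        have := (stepSol_match (Λ := Λ) (by rw [matchAngle, hF, sin_nat_mul_pi])).1
        rw [stepSol, if_neg (not_le.2 (by linarith)), if_pos le_rfl, this, leftSol, hxe, sin_pi]
        simp
      · refine hz (-x) ?_
        rw [stepSol, if_neg (not_le.2 (by linarith)), if_neg (not_le.2 (by linarith)), neg_neg,
          leftSol, hxe, sin_pi]
        simp
  · rintro rfl
    rw [Nat.cast_one, one_mul] at hF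
    intro x
    rw [stepSol]
    split_ifs with h1 h2
    · refine mul_ne_zero (amplitude_pos _ _ _ _).ne' (sin_pos_of_pos_of_lt_pi (hang.pos x) ?_).ne'
      refine hang.1.le_pi_of_lt h1 ?_
      rw [← h.midAngle_neg]
      exact (h.isAngle_mid Λ).le_pi_of_lt h.neg_le (by linarith)
    · have h1 := not_le.1 h1
      refine mul_ne_zero (amplitude_pos _ _ _ _).ne'
        (sin_pos_of_pos_of_lt_pi (h.midAngle_pos hΛ h1.le) ?_).ne'
      exact (h.isAngle_mid Λ).le_pi_of_lt h2 (by linarith)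
    · have h2 := not_le.1 h2
      refine mul_ne_zero hr0 (mul_ne_zero (amplitude_pos _ _ _ _).ne'
        (sin_pos_of_pos_of_lt_pi (hangr.pos _) ?_).ne')
      exact hangr.1.le_pi_of_lt (by linarith : -x ≤ -L) (by linarith)

end IsStepCoeff

/-! ### Complex modes and the reduction of stability to positive eigenvalues -/

theorem deriv_ofReal_comp (f : ℝ → ℝ) (x : ℝ) :
    deriv (fun x => (f x : ℂ)) x = ((deriv f x : ℝ) : ℂ) := by
  by_cases h : DifferentiableAt ℝ f x
  · exact h.hasDerivAt.ofReal_comp.deriv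
  · rw [deriv_zero_of_not_differentiableAt h, deriv_zero_of_not_differentiableAt, Complex.ofReal_zero]
    intro h'
    exact h (Complex.reCLM.differentiableAt.comp x h')

theorem AbsolutelyContinuousOnInterval.of_dist_le {X Y : Type*} [PseudoMetricSpace X]
    [PseudoMetricSpace Y] {f : ℝ → X} {g : ℝ → Y} {a b : ℝ}
    (hf : AbsolutelyContinuousOnInterval f a b) (h : ∀ x y, dist (g x) (g y) ≤ dist (f x) (f y)) :
    AbsolutelyContinuousOnInterval g a b := by
  rw [absolutelyContinuousOnInterval_iff] at hf ⊢
  intro ε hε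
  obtain ⟨δ, hδ, hδ'⟩ := hf ε hε
  exact ⟨δ, hδ, fun E hE hlt => (Finset.sum_le_sum fun i _ => h _ _).trans_lt (hδ' E hE hlt)⟩

theorem MemH2.ofReal {Ψ : ℝ → ℝ} (h : MemH2 Ψ) : MemH2 fun x => (Ψ x : ℂ) := by
  have hd : deriv (fun x => (Ψ x : ℂ)) = fun x => ((deriv Ψ x : ℝ) : ℂ) :=
    funext (deriv_ofReal_comp Ψ)
  have hdd : deriv (fun x => ((deriv Ψ x : ℝ) : ℂ)) = fun x => ((deriv (deriv Ψ) x : ℝ) : ℂ) :=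
    funext (deriv_ofReal_comp (deriv Ψ))
  refine ⟨fun x => ((h.differentiable x).hasDerivAt.ofReal_comp).differentiableAt,
    fun a b => ?_, h.memLp.ofReal, ?_, ?_⟩
  · rw [hd]
    exact AbsolutelyContinuousOnInterval.of_dist_le (h.absolutelyContinuous a b)
      fun x y => by rw [Complex.dist_eq, ← Complex.ofReal_sub, Complex.norm_real, dist_eq_norm]
  · rw [hd]
    exact h.memLp_deriv.ofReal
  · rw [hd, hdd]
    exact h.memLp_deriv_deriv.ofReal

theorem MemH2.re_im {Ψ : ℝ → ℂ} (h : MemH2 Ψ) :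
    MemH2 (fun x => (Ψ x).re) ∧ MemH2 (fun x => (Ψ x).im) ∧
      ∀ᵐ x, deriv (deriv fun x => (Ψ x).re) x = (deriv (deriv Ψ) x).re ∧
        deriv (deriv fun x => (Ψ x).im) x = (deriv (deriv Ψ) x).im := by
  have hre : ∀ {f : ℝ → ℂ} {f' : ℂ} {x : ℝ}, HasDerivAt f f' x →
      HasDerivAt (fun x => (f x).re) f'.re x := fun {f f' x} hf => by
    exact Complex.reCLM.hasFDerivAt.comp_hasDerivAt x hf
  have him : ∀ {f : ℝ → ℂ} {f' : ℂ} {x : ℝ}, HasDerivAt f f' x →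
      HasDerivAt (fun x => (f x).im) f'.im x := fun {f f' x} hf => by
    exact Complex.imCLM.hasFDerivAt.comp_hasDerivAt x hf
  have hd := fun x => (h.differentiable x).hasDerivAt
  have dre : deriv (fun x => (Ψ x).re) = fun x => (deriv Ψ x).re :=
    funext fun x => (hre (hd x)).deriv
  have dim : deriv (fun x => (Ψ x).im) = fun x => (deriv Ψ x).im :=
    funext fun x => (him (hd x)).deriv
  have acre : ∀ a b, AbsolutelyContinuousOnInterval (fun x => (deriv Ψ x).re) a b := fun a b =>
    AbsolutelyContinuousOnInterval.of_dist_le (h.absolutelyContinuous a b) fun x y => by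
      rw [Complex.dist_eq, dist_eq, ← Complex.sub_re]
      exact Complex.abs_re_le_norm _
  have acim : ∀ a b, AbsolutelyContinuousOnInterval (fun x => (deriv Ψ x).im) a b := fun a b =>
    AbsolutelyContinuousOnInterval.of_dist_le (h.absolutelyContinuous a b) fun x y => by
      rw [Complex.dist_eq, dist_eq, ← Complex.sub_im]
      exact Complex.abs_im_le_norm _
  -- Real and imaginary parts may be exchanged with the derivative only where Ψ' is differentiable,
  -- which absolute continuity provides almost everywhere.
  have hae : ∀ᵐ x, HasDerivAt (deriv Ψ) (deriv (deriv Ψ) x) x := by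
    have : ∀ n : ℕ, ∀ᵐ x, x ∈ uIcc (-n : ℝ) n → DifferentiableAt ℝ (deriv Ψ) x := by
      intro n
      filter_upwards [(acre (-n) n).ae_differentiableAt, (acim (-n) n).ae_differentiableAt]
        with x h1 h2 hx
      have := (h1 hx).hasDerivAt.ofReal_comp.add ((h2 hx).hasDerivAt.ofReal_comp.mul_const Complex.I)
      refine (this.differentiableAt).congr_of_eventuallyEq (Eventually.of_forall fun y => ?_)
      exact (Complex.re_add_im (deriv Ψ y)).symm
    filter_upwards [ae_all_iff.2 this] with x hx
    obtain ⟨n, hn⟩ := exists_nat_ge |x|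
    refine (hx n ?_).hasDerivAt
    rw [uIcc_of_le (by linarith [abs_nonneg x])]
    exact abs_le.1 hn
  have hae' : ∀ᵐ x, deriv (deriv fun x => (Ψ x).re) x = (deriv (deriv Ψ) x).re ∧
      deriv (deriv fun x => (Ψ x).im) x = (deriv (deriv Ψ) x).im := by
    rw [dre, dim]
    filter_upwards [hae] with x hx using ⟨(hre hx).deriv, (him hx).deriv⟩
  refine ⟨⟨fun x => (hre (hd x)).differentiableAt, dre ▸ acre, h.memLp.re, dre ▸ h.memLp_deriv.re,
    h.memLp_deriv_deriv.re.ae_eq ?_⟩, ⟨fun x => (him (hd x)).differentiableAt, dim ▸ acim,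
    h.memLp.im, dim ▸ h.memLp_deriv.im, h.memLp_deriv_deriv.im.ae_eq ?_⟩, hae'⟩
  · filter_upwards [hae'] with x hx using hx.1.symm
  · filter_upwards [hae'] with x hx using hx.2.symm

theorem eq_zero_of_monotone_of_integrable {f : ℝ → ℝ} (hm : Monotone f) (hi : Integrable f) :
    f = 0 := by
  funext x
  rcases lt_trichotomy (f x) 0 with h | h | h
  · have : IntegrableOn (fun _ : ℝ => f x) (Iic x) := by
      refine Integrable.mono' (hi.integrableOn (s := Iic x)).norm (by fun_prop) ?_
      filter_upwards [ae_restrict_mem measurableSet_Iic] with y hy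
      have := hm (mem_Iic.1 hy)
      rw [norm_eq_abs, norm_eq_abs, abs_of_neg h, abs_of_neg (by linarith)]
      linarith
    simp [integrableOn_const_iff, h.ne] at this
  · exact h
  · have : IntegrableOn (fun _ : ℝ => f x) (Ici x) := by
      refine Integrable.mono' (hi.integrableOn (s := Ici x)).norm (by fun_prop) ?_
      filter_upwards [ae_restrict_mem measurableSet_Ici] with y hy
      have := hm (mem_Ici.1 hy)
      rw [norm_eq_abs, norm_eq_abs, abs_of_pos h, abs_of_pos (by linarith)]
      linarith
    simp [integrableOn_const_iff, h.ne'] at this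

/-- A symmetric operator has real eigenvalues: the real and imaginary parts `a` and `b` of an
eigenfunction for `lam + i mu` vanish unless `mu = 0`. -/
theorem eq_zero_of_nonreal_eigenvalue {a b q : ℝ → ℝ} (ha : MemH2 a) (hb : MemH2 b) {lam mu : ℝ}
    (hmu : mu ≠ 0) (hae : ∀ᵐ x, deriv (deriv a) x + q x * a x = lam * a x - mu * b x)
    (hbe : ∀ᵐ x, deriv (deriv b) x + q x * b x = lam * b x + mu * a x) :
    ∀ x, a x = 0 ∧ b x = 0 := by
  have hac := ha.continuous; have hbc := hb.continuous
  have hac' := ha.continuous_deriv; have hbc' := hb.continuous_deriv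
  -- The derivative of H is μ²(a² + b²) almost everywhere, so H is monotone. It is also integrable,
  -- hence zero, and so is a² + b².
  set H : ℝ → ℝ := fun x => mu * (a x * deriv b x - deriv a x * b x) with hH
  have haC1 : ∀ {f : ℝ → ℝ}, MemH2 f → ∀ x y, AbsolutelyContinuousOnInterval f x y :=
    fun {f} hf x y => ((contDiff_one_iff_deriv.2
      ⟨hf.differentiable, hf.continuous_deriv⟩).contDiffOn).absolutelyContinuousOnInterval
  have hInt : ∀ x y, H y - H x = ∫ t in x..y, mu ^ 2 * (a t ^ 2 + b t ^ 2) := by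
    intro x y
    have e1 := (haC1 ha x y).integral_deriv_mul_eq_sub (hb.absolutelyContinuous x y)
    have e2 := (haC1 hb x y).integral_deriv_mul_eq_sub (ha.absolutelyContinuous x y)
    have i1 : IntervalIntegrable (fun t => deriv a t * deriv b t + a t * deriv (deriv b) t)
        volume x y := ((hac'.mul hbc').intervalIntegrable _ _).add
      ((hb.absolutelyContinuous x y).intervalIntegrable_deriv.continuousOn_mul hac.continuousOn)
    have i2 : IntervalIntegrable (fun t => deriv b t * deriv a t + b t * deriv (deriv a) t)
        volume x y := ((hbc'.mul hac').intervalIntegrable _ _).add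
      ((ha.absolutelyContinuous x y).intervalIntegrable_deriv.continuousOn_mul hbc.continuousOn)
    have e3 : H y - H x = mu * ((a y * deriv b y - a x * deriv b x) -
        (b y * deriv a y - b x * deriv a x)) := by
      simp only [hH]; ring
    rw [e3, ← e1, ← e2, ← intervalIntegral.integral_sub i1 i2,
      ← intervalIntegral.integral_const_mul]
    refine intervalIntegral.integral_congr_ae ?_
    filter_upwards [hae, hbe] with t h1 h2 _
    linear_combination mu * a t * h2 - mu * b t * h1
  have hcont : Continuous fun t => mu ^ 2 * (a t ^ 2 + b t ^ 2) := by fun_prop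
  have hmono : Monotone H := by
    intro x y hxy
    have := hInt x y
    have h0 : 0 ≤ ∫ t in x..y, mu ^ 2 * (a t ^ 2 + b t ^ 2) :=
      intervalIntegral.integral_nonneg hxy fun t _ => by positivity
    linarith
  have hI : Integrable H :=
    ((ha.memLp.integrable_mul hb.memLp_deriv).sub
      (ha.memLp_deriv.integrable_mul hb.memLp)).const_mul mu
  have hz := eq_zero_of_monotone_of_integrable hmono hI
  intro x
  have hd : HasDerivAt (fun y => ∫ t in (0 : ℝ)..y, mu ^ 2 * (a t ^ 2 + b t ^ 2))
      (mu ^ 2 * (a x ^ 2 + b x ^ 2)) x :=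
    intervalIntegral.integral_hasDerivAt_right (hcont.intervalIntegrable _ _)
      (hcont.stronglyMeasurableAtFilter _ _) hcont.continuousAt
  have hconst : (fun y => ∫ t in (0 : ℝ)..y, mu ^ 2 * (a t ^ 2 + b t ^ 2)) = fun _ => 0 := by
    funext y
    rw [← hInt, hz]
    simp
  rw [hconst] at hd
  have h0 := hd.unique (hasDerivAt_const x 0)
  have h1 : a x ^ 2 + b x ^ 2 = 0 := (mul_eq_zero.1 h0).resolve_left (pow_ne_zero 2 hmu)
  constructor <;> nlinarith [sq_nonneg (a x), sq_nonneg (b x)]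

/-- A front is stable if and only if its linearisation has no positive eigenvalue. -/
theorem isStable_iff {P : Potential} {α L : ℝ} (hα : 0 ≤ α) {u : ℝ → ℝ} :
    IsStable P α L u ↔ positiveEigenvalues P L u = ∅ := by
  constructor
  · intro hst
    by_contra hne
    obtain ⟨Λ, hΛ, Ψ, hH, hΨ0, hae⟩ := nonempty_iff_ne_empty.2 hne
    -- The positive root of z² + αz = Λ.
    set z : ℝ := (-α + √(α ^ 2 + 4 * Λ)) / 2 with hz
    have hs : √(α ^ 2 + 4 * Λ) ^ 2 = α ^ 2 + 4 * Λ := sq_sqrt (by positivity)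
    have hzpos : 0 < z := by
      have : α < √(α ^ 2 + 4 * Λ) := lt_sqrt_of_sq_lt (by linarith)
      rw [hz]; linarith
    have hzeq : z ^ 2 + α * z = Λ := by
      rw [hz]; linear_combination (1 / 4) * hs
    have := hst z ⟨fun x => (Ψ x : ℂ), hH.ofReal, fun h0 => hΨ0 (funext fun x => ?_), ?_⟩
    · simp at this
      linarith
    · simpa using congrFun h0 x
    · filter_upwards [hae] with x hx
      have hd : deriv (fun x => (Ψ x : ℂ)) = fun x => ((deriv Ψ x : ℝ) : ℂ) :=
        funext (deriv_ofReal_comp Ψ)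
      rw [linearisation, hd, deriv_ofReal_comp (deriv Ψ)]
      rw [linearisation] at hx
      have hx' : ((deriv (deriv Ψ) x : ℝ) : ℂ) +
          iteratedDeriv 2 (P.V L x) (u x) • (Ψ x : ℂ) = Λ * Ψ x := by
        rw [Complex.real_smul]
        exact_mod_cast hx
      rw [hx', ← hzeq]
      push_cast
      ring
  · intro hempty z ⟨Ψ, hH, hΨ0, hae⟩
    by_contra! hzre
    obtain ⟨ha, hb, hdd⟩ := hH.re_im
    set w : ℂ := z ^ 2 + α * z with hw
    set q : ℝ → ℝ := fun x => iteratedDeriv 2 (P.V L x) (u x) with hq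
    have hae' : ∀ᵐ x, deriv (deriv Ψ) x + q x • Ψ x = w * Ψ x := by
      filter_upwards [hae] with x hx
      rw [linearisation] at hx
      rw [hw]
      linear_combination -hx
    have hea : ∀ᵐ x, deriv (deriv fun x => (Ψ x).re) x + q x * (Ψ x).re =
        w.re * (Ψ x).re - w.im * (Ψ x).im := by
      filter_upwards [hae', hdd] with x hx h2
      rw [h2.1]
      simpa using congrArg Complex.re hx
    have heb : ∀ᵐ x, deriv (deriv fun x => (Ψ x).im) x + q x * (Ψ x).im =
        w.re * (Ψ x).im + w.im * (Ψ x).re := by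
      filter_upwards [hae', hdd] with x hx h2
      rw [h2.2]
      simpa using congrArg Complex.im hx
    have him : w.im = 0 := by
      by_contra hne
      have := eq_zero_of_nonreal_eigenvalue ha hb hne hea heb
      exact hΨ0 (funext fun x => Complex.ext (this x).1 (this x).2)
    -- The second factor is positive because Re z > 0 and α ≥ 0. So a real w forces a real z, and
    -- then w = z² + αz > 0.
    have hwim : w.im = z.im * (2 * z.re + α) := by
      simp [hw, sq]; ring
    have hzim : z.im = 0 := by
      rw [hwim] at him
      exact (mul_eq_zero.1 him).resolve_right (by linarith)
    have hwre : 0 < w.re := by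
      have : w.re = z.re ^ 2 + α * z.re := by
        simp [hw, sq, hzim]
      rw [this]
      positivity
    have hno : ∀ Φ : ℝ → ℝ, MemH2 Φ → (∀ᵐ x, deriv (deriv Φ) x + q x * Φ x = w.re * Φ x) →
        Φ = 0 := by
      intro Φ hΦ hΦe
      by_contra hne
      exact (hempty ▸ (show w.re ∈ positiveEigenvalues P L u from
        ⟨hwre, Φ, hΦ, hne, hΦe⟩) : w.re ∈ (∅ : Set ℝ))
    simp only [him, zero_mul, sub_zero, add_zero] at hea heb
    have h1 := hno _ ha hea
    have h2 := hno _ hb heb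
    exact hΨ0 (funext fun x => Complex.ext (congrFun h1 x) (congrFun h2 x))

/-! ### The spectrum of the linearisation about a front -/

/-- `∂²V/∂u²` along `u`, in the left potential. -/
def leftCoeff (P : Potential) (u : ℝ → ℝ) (x : ℝ) : ℝ := iteratedDeriv 2 P.left (u x)

/-- `∂²V/∂u²` along `u`, in the middle potential. -/
def midCoeff (P : Potential) (u : ℝ → ℝ) (x : ℝ) : ℝ := iteratedDeriv 2 P.mid (u x)

/-- `∂²V/∂u²` along `u`, in the right potential. -/
def rightCoeff (P : Potential) (u : ℝ → ℝ) (x : ℝ) : ℝ := iteratedDeriv 2 P.right (u x)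

theorem isEigenfunction_iff {P : Potential} {L Λ : ℝ} {u Ψ : ℝ → ℝ} :
    IsEigenfunction P L u Λ Ψ ↔
      IsStepSol L (leftCoeff P u) (midCoeff P u) (rightCoeff P u) Λ Ψ ∧ Ψ ≠ 0 := by
  have : ∀ x, linearisation P L u Ψ x = deriv (deriv Ψ) x +
      stepCoeff L (leftCoeff P u) (midCoeff P u) (rightCoeff P u) x * Ψ x := by
    intro x
    rw [linearisation, stepCoeff, Potential.V, smul_eq_mul]
    split_ifs <;> rfl
  simp only [IsEigenfunction, IsStepSol, this]
  tauto

section Spectrum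

variable {P : Potential} {L : ℝ} {u : ℝ → ℝ}

/-- The angle whose multiples of `π` count the eigenvalues of the linearisation about `u`. -/
def frontAngle (P : Potential) (L : ℝ) (u : ℝ → ℝ) : ℝ :=
  matchAngle L (leftCoeff P u) (midCoeff P u) (rightCoeff P u) 0

/-- For Λ > 0 being an eigenvalue means that the match angle is a multiple of π. This angle
decreases from the front angle to a value below π, so it passes n levels. Equality is allowed in the
upper bound since the level (n + 1)π would be attained only at Λ = 0. -/
theorem encard_positiveEigenvalues
    (h : IsStepCoeff L (leftCoeff P u) (midCoeff P u) (rightCoeff P u)) {n : ℕ}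
    (h1 : n * π < frontAngle P L u) (h2 : frontAngle P L u ≤ (n + 1) * π) :
    (positiveEigenvalues P L u).encard = n := by
  rw [← encard_setOf_eq_int_mul_pi h.continuousOn_matchAngle h.strictAntiOn_matchAngle
    (fun Λ hΛ => h.matchAngle_pos hΛ) h.exists_matchAngle_lt_pi h1 h2]
  congr 1
  ext Λ
  refine and_congr_right fun hΛ => ?_
  constructor
  · rintro ⟨Ψ, hΨ⟩
    obtain ⟨hs, h0⟩ := isEigenfunction_iff.1 hΨ
    obtain ⟨c, hc, hc0⟩ := h.eq_const_mul_stepSol hΛ.le hs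
    rcases hc0 with rfl | hsin
    · exact absurd (funext fun x => by simp [hc x]) h0
    · obtain ⟨k, hk⟩ := sin_eq_zero_iff.1 hsin
      exact ⟨k, hk.symm⟩
  · rintro ⟨k, hk⟩
    have hsin := sin_eq_zero_iff.2 ⟨k, hk.symm⟩
    exact ⟨_, isEigenfunction_iff.2 ⟨h.isStepSol_stepSol hΛ.le hsin, h.stepSol_ne_zero hΛ.le⟩⟩

theorem exists_eigenfunction_zero
    (h : IsStepCoeff L (leftCoeff P u) (midCoeff P u) (rightCoeff P u)) {k : ℕ} (hk : 1 ≤ k)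
    (hF : frontAngle P L u = k * π) :
    ∃ Ψ, IsEigenfunction P L u 0 Ψ ∧
      (∀ Φ, IsEigenfunction P L u 0 Φ → ∃ c : ℝ, Φ = c • Ψ) ∧ ((∀ x, Ψ x ≠ 0) ↔ k = 1) := by
  have hsin : sin (matchAngle L (leftCoeff P u) (midCoeff P u) (rightCoeff P u) 0) = 0 := by
    rw [frontAngle] at hF
    rw [hF, sin_nat_mul_pi]
  refine ⟨_, isEigenfunction_iff.2 ⟨h.isStepSol_stepSol le_rfl hsin, h.stepSol_ne_zero le_rfl⟩,
    fun Φ hΦ => ?_, h.stepSol_ne_zero_iff le_rfl hk hF⟩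
  obtain ⟨c, hc, -⟩ := h.eq_const_mul_stepSol le_rfl (isEigenfunction_iff.1 hΦ).1
  exact ⟨c, funext hc⟩

end Spectrum

/-! ### Tails of fronts -/

/-- A front on the left half-line `(-∞, b]`, where it is governed by the potential `V`. -/
structure IsTail (V : ℝ → ℝ) (um b : ℝ) (u : ℝ → ℝ) : Prop where
  potential_smooth : ContDiff ℝ 3 V
  smooth : ContDiff ℝ 1 u
  ode : ∀ x < b, HasDerivAt (deriv u) (-deriv V (u x)) x
  tendsto : Tendsto u atBot (𝓝 um)
  decay : ∃ C κ : ℝ, 0 < κ ∧ ∀ x, |deriv u x| ≤ C * exp (κ * x)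
  bdd : ∃ M, ∀ x, |u x| ≤ M
  deriv_ne : deriv u b ≠ 0

theorem hasDerivAt_of_contDiff_three {V : ℝ → ℝ} (hV : ContDiff ℝ 3 V) (y : ℝ) :
    HasDerivAt V (deriv V y) y :=
  (hV.differentiable (by norm_num) y).hasDerivAt

theorem contDiff_deriv_of_contDiff_three {V : ℝ → ℝ} (hV : ContDiff ℝ 3 V) :
    ContDiff ℝ 2 (deriv V) := by
  have : ContDiff ℝ (2 + 1) V := by norm_num; exact hV
  exact (contDiff_succ_iff_deriv.1 this).2.2

theorem contDiff_iteratedDeriv_two {V : ℝ → ℝ} (hV : ContDiff ℝ 3 V) :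
    ContDiff ℝ 1 (iteratedDeriv 2 V) := by
  have h : ContDiff ℝ (1 + 1) (deriv V) := by norm_num; exact contDiff_deriv_of_contDiff_three hV
  rw [iteratedDeriv_succ, iteratedDeriv_one]
  exact (contDiff_succ_iff_deriv.1 h).2.2

theorem hasDerivAt_deriv_of_contDiff_three {V : ℝ → ℝ} (hV : ContDiff ℝ 3 V) (y : ℝ) :
    HasDerivAt (deriv V) (iteratedDeriv 2 V y) y := by
  rw [iteratedDeriv_succ, iteratedDeriv_one]
  exact ((contDiff_deriv_of_contDiff_three hV).differentiable (by norm_num) y).hasDerivAt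

namespace IsTail

variable {V : ℝ → ℝ} {um b : ℝ} {u : ℝ → ℝ}

theorem continuous (h : IsTail V um b u) : Continuous u := h.smooth.continuous

theorem continuous_deriv (h : IsTail V um b u) : Continuous (deriv u) :=
  h.smooth.continuous_deriv le_rfl

theorem hasDerivAt (h : IsTail V um b u) (x : ℝ) : HasDerivAt u (deriv u x) x :=
  (h.smooth.differentiable (by norm_num) x).hasDerivAt

theorem tendsto_deriv (h : IsTail V um b u) : Tendsto (deriv u) atBot (𝓝 0) := by
  obtain ⟨C, κ, hκ, hd⟩ := h.decay
  refine squeeze_zero_norm hd ?_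
  have h1 : Tendsto (fun x => exp (κ * x)) atBot (𝓝 0) :=
    tendsto_exp_atBot.comp (tendsto_id.const_mul_atBot hκ)
  simpa using h1.const_mul C

theorem energy (h : IsTail V um b u) {x : ℝ} (hx : x ≤ b) :
    deriv u x ^ 2 / 2 + V (u x) = V um := by
  have hVc := h.potential_smooth.continuous
  have hc := h.continuous
  have hc' := h.continuous_deriv
  have hconst : ∀ y ∈ Iic b, deriv u y ^ 2 / 2 + V (u y) = deriv u x ^ 2 / 2 + V (u x) := by
    intro y hy
    refine eq_of_hasDerivAt_zero (f := fun y => deriv u y ^ 2 / 2 + V (u y)) (convex_Iic b)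
      (by fun_prop) (fun z hz => ?_) hy hx
    rw [interior_Iic] at hz
    convert! (((h.ode z hz).pow 2).div_const 2).add
      ((hasDerivAt_of_contDiff_three h.potential_smooth (u z)).comp z (h.hasDerivAt z)) using 1
    simp
    ring
  have hlim : Tendsto (fun y => deriv u y ^ 2 / 2 + V (u y)) atBot (𝓝 (0 ^ 2 / 2 + V um)) :=
    ((h.tendsto_deriv.pow 2).div_const 2).add ((hVc.tendsto um).comp h.tendsto)
  have hlim' : Tendsto (fun y => deriv u y ^ 2 / 2 + V (u y)) atBot
      (𝓝 (deriv u x ^ 2 / 2 + V (u x))) := by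
    refine tendsto_const_nhds.congr' ?_
    filter_upwards [eventually_le_atBot b] with y hy using (hconst y hy).symm
  have := tendsto_nhds_unique hlim' hlim
  rw [this]
  ring

/-- On unit intervals near -∞ the mean value theorem makes -V'(u) at some point a difference of two
values of u', which tend to 0. -/
theorem deriv_potential_eq_zero (h : IsTail V um b u) : deriv V um = 0 := by
  have hVc : Continuous (deriv V) := (contDiff_deriv_of_contDiff_three h.potential_smooth).continuous
  have h1 : Tendsto (fun x => deriv V (u x)) atBot (𝓝 (deriv V um)) :=
    (hVc.tendsto um).comp h.tendsto
  by_contra hne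
  have hpos : 0 < |deriv V um| / 4 := by positivity
  have e1 := (Metric.tendsto_nhds.1 h1 _ hpos)
  have e2 := (Metric.tendsto_nhds.1 h.tendsto_deriv _ hpos)
  obtain ⟨x₁, hx₁⟩ := eventually_atBot.1 (e1.and e2)
  set x := min x₁ b - 1
  have hx : x < min x₁ b := sub_one_lt _
  have hxb : x < b := hx.trans_le (min_le_right _ _)
  obtain ⟨ξ, hξ, hξe⟩ := exists_hasDerivAt_eq_slope (deriv u) (fun y => -deriv V (u y))
    (show x - 1 < x by linarith) h.continuous_deriv.continuousOn
    (fun y hy => h.ode y (hy.2.trans hxb))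
  have a1 := (hx₁ ξ (by linarith [hξ.2, min_le_left x₁ b])).1
  have a2 := (hx₁ x (by linarith [min_le_left x₁ b])).2
  have a3 := (hx₁ (x - 1) (by linarith [min_le_left x₁ b])).2
  rw [dist_eq] at a1 a2 a3
  simp only [sub_sub_cancel, div_one] at hξe
  rw [abs_lt] at a1 a2 a3
  rcases lt_or_gt_of_ne hne with hn | hn
  · rw [abs_of_neg hn] at a1 a2 a3
    linarith [a1.1, a1.2, a2.1, a2.2, a3.1, a3.2]
  · rw [abs_of_pos hn] at a1 a2 a3
    linarith [a1.1, a1.2, a2.1, a2.2, a3.1, a3.2]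

/-- Differentiating the front equation shows that u' solves the linearised one. The subtracted 0
keeps the form q - Λ, at Λ = 0. -/
theorem isSolOn (h : IsTail V um b u) :
    IsSolOn (fun x => iteratedDeriv 2 V (u x) - 0) (Iic b) (deriv u)
      (fun x => -deriv V (u x)) := by
  have hVc : Continuous (deriv V) := (contDiff_deriv_of_contDiff_three h.potential_smooth).continuous
  have hc := h.continuous
  refine ⟨h.continuous_deriv.continuousOn, by fun_prop, fun x hx => ?_, fun x _ => ?_⟩
  · rw [interior_Iic] at hx
    exact h.ode x hx
  · convert! ((hasDerivAt_deriv_of_contDiff_three h.potential_smooth (u x)).comp x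
      (h.hasDerivAt x)).neg using 1
    ring

theorem continuous_coeff (h : IsTail V um b u) :
    Continuous fun x => iteratedDeriv 2 V (u x) - 0 :=
  ((contDiff_iteratedDeriv_two h.potential_smooth).continuous.comp h.continuous).sub
    continuous_const

/-- If u' and u'' both vanished at one point, u' would be zero up to b by uniqueness, contrary to
`deriv_ne`. -/
theorem deriv_ne_or (h : IsTail V um b u) {x : ℝ} (hx : x ≤ b) (h0 : deriv u x = 0) :
    deriv V (u x) ≠ 0 := by
  intro h1
  obtain ⟨θ, hθ, hθx⟩ := exists_isAngle h.continuous_coeff x 0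
  obtain ⟨c, hc⟩ := h.isSolOn.eq_const_mul (convex_Iic b) h.continuous_coeff hθ (mem_Iic.2 hx)
    (by simp [h0, h1]) x
  have hcx := (hc x hx).2
  rw [h1, hθx] at hcx
  simp at hcx
  apply h.deriv_ne
  rw [(hc b (mem_Iic.2 le_rfl)).1, ← hcx, zero_mul]

/-- On the energy level of the limit, u = um gives u' = 0 as well, while V'(um) = 0; this is the
trivial solution. -/
theorem ne_limit (h : IsTail V um b u) {x : ℝ} (hx : x ≤ b) : u x ≠ um := by
  intro h0
  have he := h.energy hx
  rw [h0] at he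
  have : deriv u x = 0 := by
    have : deriv u x ^ 2 = 0 := by linarith
    simpa using this
  exact h.deriv_ne_or hx this (by rw [h0]; exact h.deriv_potential_eq_zero)

/-- Integrating the bound on u' from -∞ costs a factor 1/κ. -/
theorem abs_sub_le (h : IsTail V um b u) :
    ∃ C κ : ℝ, 0 < κ ∧ ∀ x, |deriv u x| ≤ C * exp (κ * x) ∧ |u x - um| ≤ C * exp (κ * x) := by
  obtain ⟨C, κ, hκ, hd⟩ := h.decay
  have hC : 0 ≤ C := by
    have := (abs_nonneg _).trans (hd 0)
    simpa using this
  have hexp : ∀ x, HasDerivAt (fun x => C / κ * exp (κ * x)) (C * exp (κ * x)) x := by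
    intro x
    convert! ((((hasDerivAt_id x).const_mul κ).exp).const_mul (C / κ)) using 1
    simp
    field_simp
  have hlim : Tendsto (fun x => C / κ * exp (κ * x)) atBot (𝓝 0) := by
    have h1 : Tendsto (fun x => exp (κ * x)) atBot (𝓝 0) :=
      tendsto_exp_atBot.comp (tendsto_id.const_mul_atBot hκ)
    simpa using h1.const_mul (C / κ)
  have hw : Tendsto (fun x => u x - um) atBot (𝓝 0) := by
    simpa using h.tendsto.sub_const um
  have key : ∀ s : ℝ, |s| = 1 → ∀ x, s * (u x - um) ≤ C / κ * exp (κ * x) := by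
    intro s hs x
    have hd' : ∀ x, HasDerivAt (fun x => C / κ * exp (κ * x) - s * (u x - um))
        (C * exp (κ * x) - s * deriv u x) x := fun x =>
      (hexp x).sub (((h.hasDerivAt x).sub_const um).const_mul s)
    have hm : Monotone (fun x => C / κ * exp (κ * x) - s * (u x - um)) := by
      refine monotone_of_deriv_nonneg (fun x => (hd' x).differentiableAt) fun x => ?_
      rw [(hd' x).deriv]
      have : s * deriv u x ≤ |deriv u x| := by
        calc s * deriv u x ≤ |s * deriv u x| := le_abs_self _
          _ = |deriv u x| := by rw [abs_mul, hs, one_mul]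
      linarith [hd x]
    have hl : Tendsto (fun x => C / κ * exp (κ * x) - s * (u x - um)) atBot (𝓝 0) := by
      simpa using hlim.sub (hw.const_mul s)
    have := hm.le_of_tendsto hl x
    linarith
  refine ⟨max C (C / κ), κ, hκ, fun x => ⟨(hd x).trans ?_, ?_⟩⟩
  · gcongr
    exact le_max_left _ _
  · have h1 := key 1 (by simp) x
    have h2 := key (-1) (by simp) x
    refine (abs_le.2 ⟨?_, ?_⟩ : |u x - um| ≤ C / κ * exp (κ * x)).trans ?_
    · linarith
    · linarith
    · gcongr
      exact le_max_right _ _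

/-- Exponential decay forces the limit state to be hyperbolic. -/
theorem iteratedDeriv_two_neg (h : IsTail V um b u) : iteratedDeriv 2 V um < 0 := by
  by_contra! hnn
  obtain ⟨C, κ, hκ, hd⟩ := h.abs_sub_le
  -- A bound |u'| ≤ ε |u - um| prevents |u - um| from decaying faster than exp (εx), and ε < κ
  -- contradicts the decay of `abs_sub_le`.
  set ε := κ / 2 with hε
  have hεpos : 0 < ε := by positivity
  have hV2 : ContDiff ℝ 2 V := h.potential_smooth.of_le (by norm_num)
  have htay := (taylor_isLittleO_univ (x₀ := um) (n := 2) hV2).def (c := ε ^ 2 / 2) (by positivity)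
  obtain ⟨x₁, hx₁⟩ := eventually_atBot.1 (h.tendsto.eventually htay)
  -- Here V'(um) = 0 and V''(um) ≥ 0, so Taylor's formula gives V(um) - V(u) ≤ ε²/2 · (u - um)²; the
  -- left side is u'²/2.
  have hbound : ∀ x ≤ min x₁ b, |deriv u x| ≤ ε * |u x - um| := by
    intro x hx
    have h1 := hx₁ x (hx.trans (min_le_left _ _))
    have he := h.energy (hx.trans (min_le_right _ _))
    rw [taylor_within_apply] at h1
    simp only [Finset.sum_range_succ, Finset.sum_range_zero, iteratedDerivWithin_univ,
      iteratedDeriv_zero, iteratedDeriv_one, h.deriv_potential_eq_zero, Nat.factorial] at h1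
    simp only [norm_eq_abs, abs_pow, sq_abs] at h1
    have h2 := (abs_le.1 h1).1
    simp at h2
    have h3 : deriv u x ^ 2 ≤ (ε * (u x - um)) ^ 2 := by
      nlinarith [mul_nonneg hnn (sq_nonneg (u x - um))]
    have := sq_le_sq.1 h3
    rwa [abs_mul, abs_of_pos hεpos] at this
  set x₀ := min x₁ b
  have hder : ∀ x, HasDerivAt (fun x => (u x - um) ^ 2 * exp (-(2 * ε) * x))
      ((2 * (u x - um) * deriv u x - 2 * ε * (u x - um) ^ 2) * exp (-(2 * ε) * x)) x := by
    intro x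
    have h2 : HasDerivAt (fun x => exp (-(2 * ε) * x)) (exp (-(2 * ε) * x) * (-(2 * ε) * 1)) x :=
      ((hasDerivAt_id x).const_mul (-(2 * ε))).exp
    convert! (((h.hasDerivAt x).sub_const um).pow 2).mul h2 using 1
    simp
    ring
  have hanti : AntitoneOn (fun x => (u x - um) ^ 2 * exp (-(2 * ε) * x)) (Iic x₀) := by
    refine antitoneOn_of_deriv_nonpos (convex_Iic x₀)
      (fun x _ => (hder x).continuousAt.continuousWithinAt)
      (fun x _ => (hder x).differentiableAt.differentiableWithinAt) fun x hx => ?_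
    rw [interior_Iic] at hx
    rw [(hder x).deriv]
    refine mul_nonpos_of_nonpos_of_nonneg ?_ (exp_pos _).le
    have h1 := hbound x (le_of_lt hx)
    have h2 : (u x - um) * deriv u x ≤ |u x - um| * |deriv u x| := by
      rw [← abs_mul]; exact le_abs_self _
    have h3 : |u x - um| * |u x - um| = (u x - um) ^ 2 := by rw [← sq, sq_abs]
    nlinarith [abs_nonneg (u x - um)]
  have hpos : 0 < (u x₀ - um) ^ 2 * exp (-(2 * ε) * x₀) := by
    have := sub_ne_zero.2 (h.ne_limit (min_le_right x₁ b))
    positivity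
  have hlim : Tendsto (fun x => C ^ 2 * exp (κ * x)) atBot (𝓝 0) := by
    have h1 : Tendsto (fun x => exp (κ * x)) atBot (𝓝 0) :=
      tendsto_exp_atBot.comp (tendsto_id.const_mul_atBot hκ)
    simpa using h1.const_mul (C ^ 2)
  refine absurd (ge_of_tendsto hlim ?_) (not_le.2 hpos)
  filter_upwards [eventually_le_atBot x₀] with x hx
  refine (hanti (mem_Iic.2 hx) (mem_Iic.2 le_rfl) hx).trans ?_
  have h1 : (u x - um) ^ 2 ≤ (C * exp (κ * x)) ^ 2 := by
    rw [← sq_abs]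
    exact pow_le_pow_left₀ (abs_nonneg _) (hd x).2 2
  have h2 : (C * exp (κ * x)) ^ 2 * exp (-(2 * ε) * x) = C ^ 2 * exp (κ * x) := by
    rw [mul_pow, ← exp_nat_mul, mul_assoc, ← exp_add]
    congr 2
    push_cast
    rw [hε]; ring
  calc (u x - um) ^ 2 * exp (-(2 * ε) * x) ≤ (C * exp (κ * x)) ^ 2 * exp (-(2 * ε) * x) := by
        gcongr
    _ = _ := h2

theorem isTailCoeff (h : IsTail V um b u) : IsTailCoeff fun x => iteratedDeriv 2 V (u x) := by
  have hc := (contDiff_iteratedDeriv_two h.potential_smooth).continuous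
  refine ⟨hc.comp h.continuous, ?_, ?_⟩
  · obtain ⟨M, hM⟩ := h.bdd
    obtain ⟨Q, hQ⟩ := (isCompact_Icc (a := -M) (b := M)).exists_bound_of_continuousOn hc.continuousOn
    exact ⟨Q, fun x => hQ _ (abs_le.1 (hM x))⟩
  · have hneg := h.iteratedDeriv_two_neg
    have hlim := (hc.tendsto um).comp h.tendsto
    have hev := hlim.eventually (gt_mem_nhds (show iteratedDeriv 2 V um <
      iteratedDeriv 2 V um / 2 by linarith))
    obtain ⟨x₀, hx₀⟩ := eventually_atBot.1 hev
    refine ⟨x₀, -(iteratedDeriv 2 V um / 2), by linarith, fun x hx => ?_⟩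
    have := hx₀ x hx
    simp only [Function.comp_apply] at this
    linarith

/-- Exponential decay makes u' and V'(u) square integrable, so u' is the decaying solution for Λ =
0. -/
theorem eq_const_mul_leftSol (h : IsTail V um b u) :
    ∃ c, ∀ x ∈ Iic b, deriv u x = c * leftSol (fun x => iteratedDeriv 2 V (u x)) 0 b x ∧
      -deriv V (u x) = c * leftSolDeriv (fun x => iteratedDeriv 2 V (u x)) 0 b x := by
  obtain ⟨C, κ, hκ, hd⟩ := h.abs_sub_le
  have hV' := contDiff_deriv_of_contDiff_three h.potential_smooth
  obtain ⟨M, hM⟩ := h.bdd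
  have hexp : MemLp (fun x => exp (κ * x)) 2 (volume.restrict (Iic b)) := by
    have hc : Continuous fun x => exp (κ * x) := by fun_prop
    rw [memLp_two_iff_integrable_sq hc.aestronglyMeasurable]
    have := integrableOn_exp_mul_Iic (show 0 < 2 * κ by positivity) b
    refine this.congr_fun (fun x _ => ?_) measurableSet_Iic
    simp only
    rw [← exp_nat_mul]
    congr 1
    push_cast
    ring
  obtain ⟨K, hK⟩ := (hV'.of_le (by norm_num : (1 : WithTop ℕ∞) ≤ 2)).contDiffOn.exists_lipschitzOnWith
    (by decide) (convex_Icc (-(M + |um|)) (M + |um|)) isCompact_Icc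
  have hM0 : 0 ≤ M := (abs_nonneg _).trans (hM 0)
  have hum : um ∈ Icc (-(M + |um|)) (M + |um|) := abs_le.1 (by linarith)
  have hc := h.continuous
  have hVc := hV'.continuous
  refine h.isTailCoeff.eq_const_mul_leftSol le_rfl h.isSolOn ?_ ?_
  · refine hexp.of_le_mul (c := C) h.continuous_deriv.aestronglyMeasurable
      (Eventually.of_forall fun x => ?_)
    rw [norm_of_nonneg (exp_pos _).le]
    exact (hd x).1
  · refine hexp.of_le_mul (c := K * C) (by fun_prop) (Eventually.of_forall fun x => ?_)
    rw [norm_of_nonneg (exp_pos _).le, norm_neg, norm_eq_abs]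
    have := hK.dist_le_mul (u x) (abs_le.1 (by linarith [hM x, abs_nonneg um])) um hum
    rw [dist_eq, dist_eq, h.deriv_potential_eq_zero, sub_zero] at this
    refine this.trans ?_
    rw [mul_assoc]
    gcongr
    exact (hd x).2

/-- The angle of a tail is determined by the state at its end point. -/
theorem leftAngle_spec (h : IsTail V um b u) :
    let A := leftAngle (fun x => iteratedDeriv 2 V (u x)) 0 b
    ∃ c, 0 < c * (u b - um) ∧ deriv u b = c * sin A ∧ -deriv V (u b) = c * cos A ∧
      0 < A ∧ A < 2 * π := by
  intro A
  set θ := leftAngle (fun x => iteratedDeriv 2 V (u x)) 0 with hθ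
  have hang : IsLeftAngle _ θ := h.isTailCoeff.isLeftAngle le_rfl
  obtain ⟨c, hc⟩ := h.eq_const_mul_leftSol
  obtain ⟨hcb1, hcb2⟩ := hc b (mem_Iic.2 le_rfl)
  simp only [leftSol, leftSolDeriv, amplitude_self, one_mul] at hcb1 hcb2
  have hc0 : c ≠ 0 := by
    rintro rfl
    exact h.deriv_ne (by simpa using hcb1)
  have hπ := pi_pos
  have hderw : ∀ x, HasDerivAt (fun x => c * (u x - um)) (c * deriv u x) x := fun x =>
    ((h.hasDerivAt x).sub_const um).const_mul c
  have hcw : Continuous fun x => c * (u x - um) := by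
    have := h.continuous
    fun_prop
  have hlimw : Tendsto (fun x => c * (u x - um)) atBot (𝓝 0) := by
    simpa using (h.tendsto.sub_const um).const_mul c
  have hder : ∀ x ∈ Iic b, c * deriv u x = c ^ 2 *
      leftSol (fun x => iteratedDeriv 2 V (u x)) 0 b x := fun x hx => by
    rw [(hc x hx).1]; ring
  -- Near -∞ the derivative c u' = c² `leftSol` is positive, so c(u - um) rises from its limit 0; it
  -- keeps its sign up to b because u never equals um.
  have hposw : ∀ x ≤ b, 0 < c * (u x - um) := by
    obtain ⟨x₀, hx₀⟩ := h.isTailCoeff.leftSol_nonneg le_rfl b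
    set y := min x₀ b
    have hmono : MonotoneOn (fun x => c * (u x - um)) (Iic y) := by
      refine monotoneOn_of_deriv_nonneg (convex_Iic y) hcw.continuousOn
        (fun x _ => (hderw x).differentiableAt.differentiableWithinAt) fun x hx => ?_
      rw [interior_Iic] at hx
      have hx : x ≤ y := le_of_lt hx
      rw [(hderw x).deriv, hder x (hx.trans (min_le_right _ _))]
      exact mul_nonneg (sq_nonneg _) (hx₀ x (hx.trans (min_le_left _ _))).1.le
    have hne : ∀ x ≤ b, c * (u x - um) ≠ 0 := fun x hx =>
      mul_ne_zero hc0 (sub_ne_zero.2 (h.ne_limit hx))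
    have hy : 0 < c * (u y - um) := by
      refine lt_of_le_of_ne (le_of_tendsto hlimw ?_) (hne y (min_le_right _ _)).symm
      filter_upwards [eventually_le_atBot y] with x hx
      exact hmono (mem_Iic.2 hx) (mem_Iic.2 le_rfl) hx
    intro x hx
    by_contra! hcon
    obtain ⟨z, hz, hz0⟩ := (convex_Iic b).isPreconnected.intermediate_value (mem_Iic.2 hx)
      (mem_Iic.2 (min_le_right x₀ b)) hcw.continuousOn ⟨hcon, hy.le⟩
    exact hne z hz hz0
  refine ⟨c, hposw b le_rfl, hcb1, hcb2, hang.pos b, ?_⟩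
  -- An angle of at least 2π means that c(u - um) rises up to x₁ (angle π) and falls up to x₂ (angle
  -- 2π). On the rise some x₃ < x₁ has u(x₃) = u(x₂), so energy gives u'(x₃) = u'(x₂) = 0, although
  -- the angle at x₃ lies in (0, π).
  by_contra! hcon
  have hcon : 2 * π ≤ θ b := hcon
  obtain ⟨x₁, hx₁, hx₁e⟩ := hang.exists_eq_pi (b := b) (by linarith)
  obtain ⟨x₂, hx₂, hx₂e⟩ := intermediate_value_Icc hx₁ hang.1.continuous.continuousOn
    ⟨(by linarith : θ x₁ ≤ 2 * π), hcon⟩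
  have hx₁₂ : x₁ < x₂ := by
    refine lt_of_le_of_ne hx₂.1 ?_
    rintro rfl
    linarith
  have hdec : StrictAntiOn (fun x => c * (u x - um)) (Icc x₁ x₂) := by
    refine strictAntiOn_of_deriv_neg (convex_Icc _ _) hcw.continuousOn fun x hx => ?_
    rw [interior_Icc] at hx
    rw [(hderw x).deriv, hder x (hx.2.le.trans hx₂.2)]
    have h1 : π < θ x := by
      simpa using hang.1.nat_mul_pi_lt 1 hx.1 (by simpa using hx₁e.ge)
    have h2 : θ x < 2 * π := by
      by_contra! hge
      have := hang.1.nat_mul_pi_lt 2 hx.2 (by simpa using hge)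
      simp only [Nat.cast_ofNat] at this
      linarith
    have h3 : sin (θ x) < 0 := by
      have := sin_pos_of_pos_of_lt_pi (show 0 < θ x - π by linarith) (by linarith)
      rw [sin_sub_pi] at this
      linarith
    exact mul_neg_of_pos_of_neg (by positivity)
      (mul_neg_of_pos_of_neg (amplitude_pos _ _ _ _) h3)
  have hlt := hdec (left_mem_Icc.2 hx₁₂.le) (right_mem_Icc.2 hx₁₂.le) hx₁₂
  obtain ⟨y, hy⟩ := (hlimw.eventually (gt_mem_nhds (hposw x₂ hx₂.2))).and
    (eventually_le_atBot x₁) |>.exists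
  obtain ⟨x₃, hx₃, hx₃e⟩ := intermediate_value_Icc hy.2 hcw.continuousOn ⟨hy.1.le, hlt.le⟩
  have hx₃₁ : x₃ < x₁ := by
    refine lt_of_le_of_ne hx₃.2 ?_
    rintro rfl
    exact hlt.ne hx₃e.symm
  have hu : u x₃ = u x₂ := by
    have := mul_left_cancel₀ hc0 hx₃e
    linarith
  have e2 := h.energy hx₂.2
  have e3 := h.energy (hx₃₁.le.trans hx₁)
  have hz2 : deriv u x₂ = 0 := by
    rw [(hc x₂ hx₂.2).1, leftSol, ← hθ, hx₂e, sin_two_pi]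
    simp
  rw [hu, ← e2, hz2] at e3
  have hz3 : deriv u x₃ = 0 := by
    have : deriv u x₃ ^ 2 = 0 := by linarith
    simpa using this
  rw [(hc x₃ (hx₃₁.le.trans hx₁)).1, leftSol, ← hθ] at hz3
  have hsin : 0 < sin (θ x₃) := by
    refine sin_pos_of_pos_of_lt_pi (hang.pos x₃) ?_
    by_contra! hge
    have := hang.1.nat_mul_pi_lt 1 hx₃₁ (by simpa using hge)
    simp only [Nat.cast_one, one_mul] at this
    linarith
  exact mul_ne_zero hc0 (mul_ne_zero (amplitude_pos _ _ _ _).ne' hsin.ne') hz3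

end IsTail

/-! ### Fronts and their reflections -/

/-- The potentials seen after the reflection `x ↦ -x`. -/
def Potential.reflect (P : Potential) : Potential :=
  ⟨P.right, P.mid, P.left, P.right_smooth, P.mid_smooth, P.left_smooth⟩

theorem Potential.V_of_lt (P : Potential) {L x : ℝ} (h : x < -L) : P.V L x = P.left := by
  simp [Potential.V, h]

theorem Potential.V_of_mem_Ioo (P : Potential) {L x : ℝ} (h : x ∈ Ioo (-L) L) :
    P.V L x = P.mid := by
  simp [Potential.V, h.1.le, h.2.le]

theorem Potential.V_reflect (P : Potential) {L x : ℝ} (hL : 0 < L) (h1 : x ≠ -L) (h2 : x ≠ L) :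
    P.reflect.V L x = P.V L (-x) := by
  simp only [Potential.V, Potential.reflect]
  rcases lt_or_gt_of_ne h1 with h | h
  · rw [if_pos h, if_neg (by linarith), if_neg (by linarith)]
  · rw [if_neg (by linarith)]
    rcases lt_or_gt_of_ne h2 with h' | h'
    · rw [if_pos h'.le, if_neg (by linarith), if_pos (by linarith)]
    · rw [if_neg (by linarith), if_pos (by linarith)]

namespace IsFront

variable {P : Potential} {L um up : ℝ} {u : ℝ → ℝ}

theorem hasDerivAt (h : IsFront P L um up u) (x : ℝ) : HasDerivAt u (deriv u x) x :=
  (h.smooth.differentiable (by norm_num) x).hasDerivAt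

theorem continuous (h : IsFront P L um up u) : Continuous u := h.smooth.continuous

theorem continuous_deriv (h : IsFront P L um up u) : Continuous (deriv u) :=
  h.smooth.continuous_deriv le_rfl

theorem reflect (h : IsFront P L um up u) (hL : 0 < L) :
    IsFront P.reflect L up um fun x => u (-x) := by
  have hd : deriv (fun x => u (-x)) = fun x => -deriv u (-x) := funext fun x => deriv_comp_neg u x
  refine ⟨h.smooth.comp contDiff_neg, fun x h1 h2 => ?_, h.tendsto_right.comp tendsto_neg_atBot_atTop,
    h.tendsto_left.comp tendsto_neg_atTop_atBot, ?_⟩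
  · rw [hd, P.V_reflect hL h1 h2]
    have := h.ode (-x) (fun h' => h2 (by linarith)) (fun h' => h1 (by linarith))
    convert! (hasDerivAt_comp_neg this).neg using 1
    ring
  · obtain ⟨C, κ, hκ, hC⟩ := h.decay
    refine ⟨C, κ, hκ, fun x => ?_⟩
    rw [hd, abs_neg, ← abs_neg x]
    exact hC (-x)

theorem exists_abs_le (h : IsFront P L um up u) : ∃ M, ∀ x, |u x| ≤ M := by
  have hb := h.continuous.isBounded_range_iff_isBigO_atTop_atBot.2
    ⟨h.tendsto_right.isBigO_one ℝ, h.tendsto_left.isBigO_one ℝ⟩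
  obtain ⟨M, hM⟩ := hb.exists_norm_le
  exact ⟨M, fun x => hM _ (mem_range_self x)⟩

theorem isTail (h : IsFront P L um up u) (hL : 0 < L) (hp : deriv u (-L) ≠ 0) :
    IsTail P.left um (-L) u := by
  refine ⟨P.left_smooth, h.smooth, fun x hx => ?_, h.tendsto_left, ?_, h.exists_abs_le, hp⟩
  · have := h.ode x hx.ne (by linarith)
    rwa [P.V_of_lt hx] at this
  · obtain ⟨C, κ, hκ, hC⟩ := h.decay
    have hC0 : 0 ≤ C := by
      have := (abs_nonneg _).trans (hC 0)
      simpa using this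
    refine ⟨C, κ, hκ, fun x => (hC x).trans ?_⟩
    refine mul_le_mul_of_nonneg_left (exp_le_exp.2 ?_) hC0
    nlinarith [neg_abs_le x]

theorem isTail_reflect (h : IsFront P L um up u) (hL : 0 < L) (hp : deriv u L ≠ 0) :
    IsTail P.right up (-L) fun x => u (-x) := by
  refine (h.reflect hL).isTail hL ?_
  rw [deriv_comp_neg, neg_neg]
  exact neg_ne_zero.2 hp

theorem isStepCoeff (h : IsFront P L um up u) (hL : 0 < L) (hpl : deriv u (-L) ≠ 0)
    (hpr : deriv u L ≠ 0) : IsStepCoeff L (leftCoeff P u) (midCoeff P u) (rightCoeff P u) := by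
  have hc := (contDiff_iteratedDeriv_two P.mid_smooth).continuous
  refine ⟨hL, (h.isTail hL hpl).isTailCoeff, hc.comp h.continuous, ?_,
    (h.isTail_reflect hL hpr).isTailCoeff⟩
  obtain ⟨M, hM⟩ := h.exists_abs_le
  obtain ⟨Q, hQ⟩ := (isCompact_Icc (a := -M) (b := M)).exists_bound_of_continuousOn hc.continuousOn
  exact ⟨Q, fun x => hQ _ (abs_le.1 (hM x))⟩

end IsFront

/-! ### Continuity of the tail angle in the end state -/

/-- A shift by π takes (0, 2π) to (-π, π), where the angle is the principal argument, continuous off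
the slit. -/
theorem tendsto_of_sin_cos {ι : Type*} {l : Filter ι} {A : ι → ℝ} {a : ℝ}
    (hA : ∀ᶠ i in l, A i ∈ Ioo 0 (2 * π)) (ha : a ∈ Ioo 0 (2 * π))
    (hs : Tendsto (fun i => sin (A i)) l (𝓝 (sin a)))
    (hc : Tendsto (fun i => cos (A i)) l (𝓝 (cos a))) : Tendsto A l (𝓝 a) := by
  have key : ∀ x ∈ Ioo 0 (2 * π),
      x = π + Complex.arg (((-cos x : ℝ) : ℂ) + ((-sin x : ℝ) : ℂ) * Complex.I) := by
    intro x hx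
    have := Complex.arg_cos_add_sin_mul_I (θ := x - π) ⟨by linarith [hx.1], by linarith [hx.2]⟩
    rw [← cos_sub_pi, ← sin_sub_pi]
    push_cast at this ⊢
    rw [this]
    ring
  have hmem : (((-cos a : ℝ) : ℂ) + ((-sin a : ℝ) : ℂ) * Complex.I) ∈ Complex.slitPlane := by
    rw [Complex.mem_slitPlane_iff]
    by_contra! hcon
    simp only [Complex.add_re, Complex.ofReal_re, Complex.re_ofReal_mul, Complex.I_re, mul_zero,
      add_zero, Complex.add_im, Complex.ofReal_im, Complex.im_ofReal_mul, Complex.I_im, mul_one,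
      zero_add, neg_nonpos, neg_eq_zero] at hcon
    have h1 := sin_sq_add_cos_sq a
    rw [hcon.2] at h1
    have h2 : cos a = 1 := by nlinarith [hcon.1]
    rw [cos_eq_one_iff_of_lt_of_lt (by linarith [ha.1, pi_pos]) ha.2] at h2
    exact ha.1.ne' h2
  rw [key a ha]
  refine Tendsto.congr' (f₁ := fun i =>
    π + Complex.arg (((-cos (A i) : ℝ) : ℂ) + ((-sin (A i) : ℝ) : ℂ) * Complex.I)) ?_ ?_
  · filter_upwards [hA] with i hi using (key _ hi).symm
  · refine ((Complex.continuousAt_arg hmem).tendsto.comp ?_).const_add π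
    exact ((Complex.continuous_ofReal.tendsto _).comp hc.neg).add
      (((Complex.continuous_ofReal.tendsto _).comp hs.neg).mul_const _)

/-- The state determines c: its modulus is the length of (s, t), and its sign is that of w. Thus c
depends continuously on the state while w ≠ 0. -/
theorem eq_div_abs_mul_sqrt {c w s t A : ℝ} (h : 0 < c * w) (hs : s = c * sin A)
    (ht : t = c * cos A) : c = w / |w| * √(s ^ 2 + t ^ 2) := by
  have h1 : s ^ 2 + t ^ 2 = c ^ 2 := by
    rw [hs, ht]
    linear_combination c ^ 2 * sin_sq_add_cos_sq A
  have hw : w ≠ 0 := by rintro rfl; simp at h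
  rw [h1, sqrt_sq_eq_abs]
  rcases pos_and_pos_or_neg_and_neg_of_mul_pos h with ⟨hc, hw'⟩ | ⟨hc, hw'⟩
  · rw [abs_of_pos hc, abs_of_pos hw', div_self hw, one_mul]
  · rw [abs_of_neg hc, abs_of_neg hw', div_neg, div_self hw]; ring

/-- The angle of a tail depends continuously on the state at the end point. -/
theorem IsTail.tendsto_leftAngle {ι : Type*} {l : Filter ι} {V : ℝ → ℝ} {um b₀ : ℝ} {u₀ : ℝ → ℝ}
    {b : ι → ℝ} {u : ι → ℝ → ℝ} (h₀ : IsTail V um b₀ u₀) (h : ∀ᶠ i in l, IsTail V um (b i) (u i))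
    (hu : Tendsto (fun i => u i (b i)) l (𝓝 (u₀ b₀)))
    (hp : Tendsto (fun i => deriv (u i) (b i)) l (𝓝 (deriv u₀ b₀))) :
    Tendsto (fun i => leftAngle (fun x => iteratedDeriv 2 V (u i x)) 0 (b i)) l
      (𝓝 (leftAngle (fun x => iteratedDeriv 2 V (u₀ x)) 0 b₀)) := by
  set C : ℝ → ℝ → ℝ := fun v p => (v - um) / |v - um| * √(p ^ 2 + (-deriv V v) ^ 2) with hC
  have hspec : ∀ {b : ℝ} {u : ℝ → ℝ}, IsTail V um b u →
      let A := leftAngle (fun x => iteratedDeriv 2 V (u x)) 0 b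
      C (u b) (deriv u b) ≠ 0 ∧ sin A = deriv u b / C (u b) (deriv u b) ∧
        cos A = -deriv V (u b) / C (u b) (deriv u b) ∧ A ∈ Ioo 0 (2 * π) := by
    intro b u h A
    obtain ⟨c, h1, h2, h3, h4, h5⟩ := h.leftAngle_spec
    have hc := eq_div_abs_mul_sqrt h1 h2 h3
    have hc0 : c ≠ 0 := by rintro rfl; simp at h1
    have hcC : C (u b) (deriv u b) = c := hc.symm
    rw [hcC]
    exact ⟨hc0, by rw [h2]; field_simp; rfl, by rw [h3]; field_simp; rfl, h4, h5⟩
  obtain ⟨k1, k2, k3, k4⟩ := hspec h₀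
  have hV := (contDiff_deriv_of_contDiff_three h₀.potential_smooth).continuous
  have hVt : Tendsto (fun i => -deriv V (u i (b i))) l (𝓝 (-deriv V (u₀ b₀))) :=
    ((hV.tendsto _).comp hu).neg
  have hw := hu.sub_const um
  have hCt : Tendsto (fun i => C (u i (b i)) (deriv (u i) (b i))) l (𝓝 (C (u₀ b₀) (deriv u₀ b₀))) := by
    refine (hw.div hw.abs ?_).mul ((hp.pow 2).add (hVt.pow 2)).sqrt
    exact abs_ne_zero.2 (sub_ne_zero.2 (h₀.ne_limit le_rfl))
  refine tendsto_of_sin_cos (h.mono fun i hi => (hspec hi).2.2.2) k4 ?_ ?_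
  · rw [k2]
    exact (hp.div hCt k1).congr' (h.mono fun i hi => ((hspec hi).2.1).symm)
  · rw [k3]
    exact (hVt.div hCt k1).congr' (h.mono fun i hi => ((hspec hi).2.2.1).symm)

/-! ### Dependence of the middle part on its length and left state -/

theorem exists_taylor_bounds {V : ℝ → ℝ} (hV : ContDiff ℝ 3 V) (M : ℝ) :
    ∃ B, 0 ≤ B ∧ ∀ a ∈ Icc (-M) M, ∀ b ∈ Icc (-M) M, |deriv V a| ≤ B ∧
      |iteratedDeriv 2 V a| ≤ B ∧ |deriv V b - deriv V a| ≤ B * |b - a| ∧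
      |iteratedDeriv 2 V b - iteratedDeriv 2 V a| ≤ B * |b - a| ∧
      |deriv V b - deriv V a - iteratedDeriv 2 V a * (b - a)| ≤ B * (b - a) ^ 2 := by
  have h1 := contDiff_deriv_of_contDiff_three hV
  have h2 := contDiff_iteratedDeriv_two hV
  obtain ⟨B₁, hB₁⟩ := (isCompact_Icc (a := -M) (b := M)).exists_bound_of_continuousOn
    h1.continuous.continuousOn
  obtain ⟨B₂, hB₂⟩ := (isCompact_Icc (a := -M) (b := M)).exists_bound_of_continuousOn
    h2.continuous.continuousOn
  obtain ⟨K, hK⟩ := h2.contDiffOn.exists_lipschitzOnWith (by decide) (convex_Icc (-M) M)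
    isCompact_Icc
  set B := max 0 (max B₁ (max B₂ K)) with hB
  have b1 : B₁ ≤ B := (le_max_left _ _).trans (le_max_right _ _)
  have b2 : B₂ ≤ B := ((le_max_left _ _).trans (le_max_right _ _)).trans (le_max_right _ _)
  have b3 : (K : ℝ) ≤ B := ((le_max_right _ _).trans (le_max_right _ _)).trans (le_max_right _ _)
  have hB0 : 0 ≤ B := le_max_left _ _
  have hmv : ∀ a b, ∃ ξ ∈ uIcc a b, deriv V b - deriv V a = iteratedDeriv 2 V ξ * (b - a) := by
    intro a b
    rcases lt_trichotomy a b with h | rfl | h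
    · obtain ⟨ξ, hξ, e⟩ := exists_hasDerivAt_eq_slope (deriv V) (iteratedDeriv 2 V) h
        h1.continuous.continuousOn fun x _ => hasDerivAt_deriv_of_contDiff_three hV x
      refine ⟨ξ, Ioo_subset_Icc_self.trans Icc_subset_uIcc hξ, ?_⟩
      rw [e, div_mul_cancel₀ _ (sub_ne_zero.2 h.ne')]
    · exact ⟨a, left_mem_uIcc, by simp⟩
    · obtain ⟨ξ, hξ, e⟩ := exists_hasDerivAt_eq_slope (deriv V) (iteratedDeriv 2 V) h
        h1.continuous.continuousOn fun x _ => hasDerivAt_deriv_of_contDiff_three hV x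
      refine ⟨ξ, Ioo_subset_Icc_self.trans Icc_subset_uIcc' hξ, ?_⟩
      rw [e]
      have := sub_ne_zero.2 h.ne'
      field_simp
      ring
  have hlip : ∀ a ∈ Icc (-M) M, ∀ b ∈ Icc (-M) M,
      |iteratedDeriv 2 V b - iteratedDeriv 2 V a| ≤ B * |b - a| := fun a ha b hb =>
    (hK.dist_le_mul b hb a ha).trans (mul_le_mul_of_nonneg_right b3 (abs_nonneg _))
  refine ⟨B, hB0, fun a ha b hb => ⟨(hB₁ a ha).trans b1, (hB₂ a ha).trans b2, ?_,
    hlip a ha b hb, ?_⟩⟩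
  · obtain ⟨ξ, hξ, e⟩ := hmv a b
    rw [e, abs_mul]
    exact mul_le_mul_of_nonneg_right
      ((hB₂ ξ ((convex_Icc (-M) M).ordConnected.uIcc_subset ha hb hξ)).trans b2) (abs_nonneg _)
  · obtain ⟨ξ, hξ, e⟩ := hmv a b
    rw [e, ← sub_mul, abs_mul, ← sq_abs (b - a), sq, ← mul_assoc]
    refine mul_le_mul_of_nonneg_right
      ((hlip a ha ξ ((convex_Icc (-M) M).ordConnected.uIcc_subset ha hb hξ)).trans ?_) (abs_nonneg _)
    exact mul_le_mul_of_nonneg_left (abs_sub_left_of_mem_uIcc hξ) hB0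

/-- A solution of `u'' + V'(u) = 0` on `[-L, L]` and its derivative, as functions of the scaled
variable `y = x / L ∈ [-1, 1]`. -/
structure IsScaledSol (V : ℝ → ℝ) (L : ℝ) (U p : ℝ → ℝ) : Prop where
  continuousOn : ContinuousOn U (Icc (-1) 1)
  continuousOn_deriv : ContinuousOn p (Icc (-1) 1)
  hasDerivAt : ∀ y ∈ Ioo (-1 : ℝ) 1, HasDerivAt U (L * p y) y
  hasDerivAt_deriv : ∀ y ∈ Ioo (-1 : ℝ) 1, HasDerivAt p (-(L * deriv V (U y))) y

/-- Young's inequality for the derivative of a squared distance x² + y²: k is the length, l its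
change, and b the increment of V'. -/
theorem two_mul_mul_add_mul_le {x y a b c m n : ℝ} (hb : |b| ≤ c * |x|) (hc : 0 ≤ c) (l : ℝ)
    (hm : |m| ≤ a) (hn : |n| ≤ a) {k k₀ : ℝ} (hk : |k| ≤ k₀) :
    2 * x * (k * y + l * m) - 2 * y * (k * b + l * n) ≤
      (k₀ * (1 + c) + 1) * (x ^ 2 + y ^ 2) + 2 * a ^ 2 * l ^ 2 := by
  have hk0 : 0 ≤ k₀ := (abs_nonneg _).trans hk
  have ha : 0 ≤ a := (abs_nonneg _).trans hm
  have e1 : 2 * x * (k * y) ≤ k₀ * (x ^ 2 + y ^ 2) := by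
    have : x * y * k ≤ |x * y| * k₀ := (le_abs_self _).trans (by rw [abs_mul]; gcongr)
    have h2 : 2 * |x * y| ≤ x ^ 2 + y ^ 2 := by
      rw [abs_mul, ← sq_abs x, ← sq_abs y]; nlinarith [sq_nonneg (|x| - |y|)]
    nlinarith
  have e2 : -(2 * y * (k * b)) ≤ k₀ * c * (x ^ 2 + y ^ 2) := by
    have : -(y * b * k) ≤ |y| * (c * |x|) * k₀ := (neg_le_abs _).trans (by
      rw [abs_mul, abs_mul]; gcongr)
    have h2 : 2 * (|y| * |x|) ≤ x ^ 2 + y ^ 2 := by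
      rw [← sq_abs x, ← sq_abs y]; nlinarith [sq_nonneg (|x| - |y|)]
    nlinarith [mul_nonneg hk0 hc]
  have hm2 : m ^ 2 ≤ a ^ 2 := sq_le_sq' (by linarith [neg_le_of_abs_le hm]) (le_of_abs_le hm)
  have hn2 : n ^ 2 ≤ a ^ 2 := sq_le_sq' (by linarith [neg_le_of_abs_le hn]) (le_of_abs_le hn)
  have e3 : 2 * x * (l * m) ≤ x ^ 2 + a ^ 2 * l ^ 2 := by
    nlinarith [sq_nonneg (x - l * m), mul_le_mul_of_nonneg_right hm2 (sq_nonneg l)]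
  have e4 : -(2 * y * (l * n)) ≤ y ^ 2 + a ^ 2 * l ^ 2 := by
    nlinarith [sq_nonneg (y + l * n), mul_le_mul_of_nonneg_right hn2 (sq_nonneg l)]
  linarith

namespace IsScaledSol

variable {V : ℝ → ℝ} {L₀ : ℝ} {U₀ p₀ : ℝ → ℝ}

/-- The squared distance of the data (length and left state) of two solutions. -/
def dataDist (L₀ : ℝ) (U₀ p₀ : ℝ → ℝ) (L : ℝ) (U p : ℝ → ℝ) : ℝ :=
  (U (-1) - U₀ (-1)) ^ 2 + (p (-1) - p₀ (-1)) ^ 2 + (L - L₀) ^ 2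

theorem dataDist_nonneg (L₀ : ℝ) (U₀ p₀ : ℝ → ℝ) (L : ℝ) (U p : ℝ → ℝ) :
    0 ≤ dataDist L₀ U₀ p₀ L U p := by
  unfold dataDist; positivity

/-- Lipschitz dependence of a solution on its length and its left state. -/
theorem exists_lipschitz (hV : ContDiff ℝ 3 V) (h₀ : IsScaledSol V L₀ U₀ p₀) :
    ∃ K M : ℝ, 1 ≤ K ∧ (∀ y ∈ Icc (-1 : ℝ) 1, |U₀ y| ≤ M ∧ |p₀ y| ≤ M) ∧
      ∀ {L : ℝ} {U p : ℝ → ℝ}, IsScaledSol V L U p →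
      K * dataDist L₀ U₀ p₀ L U p < 1 → ∀ y ∈ Icc (-1 : ℝ) 1,
        (U y - U₀ y) ^ 2 + (p y - p₀ y) ^ 2 ≤ K * dataDist L₀ U₀ p₀ L U p ∧ |U y| ≤ M + 1 := by
  obtain ⟨M₁, hM₁⟩ := isCompact_Icc.exists_bound_of_continuousOn h₀.continuousOn
  obtain ⟨M₂, hM₂⟩ := isCompact_Icc.exists_bound_of_continuousOn h₀.continuousOn_deriv
  set M := max M₁ M₂
  have hUM : ∀ y ∈ Icc (-1 : ℝ) 1, |U₀ y| ≤ M := fun y hy => (hM₁ y hy).trans (le_max_left _ _)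
  have hpM : ∀ y ∈ Icc (-1 : ℝ) 1, |p₀ y| ≤ M := fun y hy => (hM₂ y hy).trans (le_max_right _ _)
  obtain ⟨B, hB0, hB⟩ := exists_taylor_bounds hV (M + 1)
  have hM0 : 0 ≤ M := (abs_nonneg _).trans (hUM 0 (by norm_num))
  set a := M + B
  set G := (|L₀| + 1) * (1 + B) + 1
  have hG0 : 0 ≤ G := by positivity
  -- Grönwall over an interval of length 2 with source 2a²(L - L₀)², which accounts for 4a² and exp
  -- (2G).
  set K := (1 + 4 * a ^ 2) * exp (G * 2) with hK
  have hK1 : 1 ≤ K := by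
    have : 1 ≤ exp (G * 2) := one_le_exp (by positivity)
    nlinarith [sq_nonneg a]
  refine ⟨K, M, hK1, fun y hy => ⟨hUM y hy, hpM y hy⟩, fun {L U p} h hD => ?_⟩
  set D := dataDist L₀ U₀ p₀ L U p with hDdef
  have hD0 : 0 ≤ D := dataDist_nonneg _ _ _ _ _ _
  have hLD : (L - L₀) ^ 2 ≤ D := by
    rw [hDdef, dataDist]; nlinarith [sq_nonneg (U (-1) - U₀ (-1)), sq_nonneg (p (-1) - p₀ (-1))]
  have hL : |L| ≤ |L₀| + 1 := by
    have h1 : |L - L₀| ≤ 1 := by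
      rw [← abs_one, ← sq_le_sq]; nlinarith
    have h2 := abs_add_le (L - L₀) L₀
    rw [sub_add_cancel] at h2
    linarith
  have hmem : ∀ y ∈ Icc (-1 : ℝ) 1, (U y - U₀ y) ^ 2 + (p y - p₀ y) ^ 2 ≤ 1 → |U y| ≤ M + 1 := by
    intro y hy hle
    have h1 : |U y - U₀ y| ≤ 1 := by
      rw [← abs_one, ← sq_le_sq]; nlinarith [sq_nonneg (p y - p₀ y)]
    have h2 := abs_add_le (U y - U₀ y) (U₀ y)
    rw [sub_add_cancel] at h2
    linarith [hUM y hy]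
  set f : ℝ → ℝ := fun y => (U y - U₀ y) ^ 2 + (p y - p₀ y) ^ 2 with hf
  have hle : (f (-1) + 2 * a ^ 2 * (L - L₀) ^ 2 * (1 - -1)) * exp (G * (1 - -1)) ≤ K * D := by
    have e : (1 : ℝ) - -1 = 2 := by norm_num
    rw [e, hK, mul_right_comm _ _ D]
    refine mul_le_mul_of_nonneg_right ?_ (exp_pos _).le
    have h1 : f (-1) ≤ D := by
      simp only [hf, hDdef, dataDist]; nlinarith [sq_nonneg (L - L₀)]
    nlinarith [mul_le_mul_of_nonneg_left hLD (sq_nonneg a)]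
  -- With the threshold R = 1 the solution stays in [-(M + 1), M + 1], where the bounds on V' are
  -- available.
  have key := gronwall_bootstrap (f := f)
    (f' := fun y => 2 * (U y - U₀ y) * (L * p y - L₀ * p₀ y) +
      2 * (p y - p₀ y) * (-(L * deriv V (U y)) - -(L₀ * deriv V (U₀ y))))
    (a := -1) (b := 1) (K := G) (ε := 2 * a ^ 2 * (L - L₀) ^ 2) (R := 1) hG0 (by positivity)
    (by positivity) (((h.continuousOn.sub h₀.continuousOn).pow 2).add
      ((h.continuousOn_deriv.sub h₀.continuousOn_deriv).pow 2)) (fun y hy => by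
      convert! (((h.hasDerivAt y hy).sub (h₀.hasDerivAt y hy)).pow 2).add
        (((h.hasDerivAt_deriv y hy).sub (h₀.hasDerivAt_deriv y hy)).pow 2) using 1
      simp) ?_ (hle.trans_lt hD)
  · intro y hy
    have h1 := (key y hy).trans hle
    exact ⟨h1, hmem y hy (h1.trans hD.le)⟩
  · intro y hy hfy
    have hy' := Ioo_subset_Icc_self hy
    have hU := hmem y hy' hfy
    obtain ⟨b1, -, b3, -, -⟩ := hB (U₀ y) (abs_le.1 ((hUM y hy').trans (by linarith))) (U y)
      (abs_le.1 hU)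
    have := two_mul_mul_add_mul_le (x := U y - U₀ y) (y := p y - p₀ y) b3 hB0 (L - L₀)
      (show |p₀ y| ≤ a by linarith [hpM y hy']) (show |deriv V (U₀ y)| ≤ a by linarith) hL
    calc _ = 2 * (U y - U₀ y) * (L * (p y - p₀ y) + (L - L₀) * p₀ y) - 2 * (p y - p₀ y) *
          (L * (deriv V (U y) - deriv V (U₀ y)) + (L - L₀) * deriv V (U₀ y)) := by ring
      _ ≤ _ := this

/-- The Prüfer angle along a solution depends continuously on the solution. -/
theorem tendsto_angle {ι : Type*} {l : Filter ι} (hV : ContDiff ℝ 3 V)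
    (h₀ : IsScaledSol V L₀ U₀ p₀) {L : ι → ℝ} {U p Θ : ι → ℝ → ℝ} {Θ₀ : ℝ → ℝ}
    (h : ∀ᶠ i in l, IsScaledSol V (L i) (U i) (p i))
    (hD : Tendsto (fun i => dataDist L₀ U₀ p₀ (L i) (U i) (p i)) l (𝓝 0))
    (hΘc₀ : ContinuousOn Θ₀ (Icc (-1) 1)) (hΘ₀ : ∀ y ∈ Ioo (-1 : ℝ) 1, HasDerivAt Θ₀
      (L₀ * (cos (Θ₀ y) ^ 2 + iteratedDeriv 2 V (U₀ y) * sin (Θ₀ y) ^ 2)) y)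
    (hΘc : ∀ᶠ i in l, ContinuousOn (Θ i) (Icc (-1) 1))
    (hΘ : ∀ᶠ i in l, ∀ y ∈ Ioo (-1 : ℝ) 1, HasDerivAt (Θ i)
      (L i * (cos (Θ i y) ^ 2 + iteratedDeriv 2 V (U i y) * sin (Θ i y) ^ 2)) y)
    (hinit : Tendsto (fun i => Θ i (-1)) l (𝓝 (Θ₀ (-1)))) :
    Tendsto (fun i => Θ i 1) l (𝓝 (Θ₀ 1)) := by
  obtain ⟨K, M, hK1, hM, hlip⟩ := h₀.exists_lipschitz hV
  obtain ⟨B, hB0, hB⟩ := exists_taylor_bounds hV (M + 1)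
  set D := fun i => dataDist L₀ U₀ p₀ (L i) (U i) (p i) with hDdef
  set k := (|L₀| + 1) * (1 + B) with hk
  set η := fun i => (|L₀| + 1) * (B * √(K * D i)) + (1 + B) * √(D i) with hη
  set E := fun i => ((Θ i (-1) - Θ₀ (-1)) ^ 2 + η i ^ 2 * (1 - -1)) * exp ((2 * k + 1) * (1 - -1))
    with hE
  have hη0 : Tendsto η l (𝓝 0) := by
    have h1 := ((hD.const_mul K).sqrt.const_mul B).const_mul (|L₀| + 1)
    have h2 := hD.sqrt.const_mul (1 + B)
    simpa using h1.add h2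
  have hE0 : Tendsto E l (𝓝 0) := by
    have h1 := hinit.sub_const (Θ₀ (-1))
    have h2 := (((h1.pow 2).add ((hη0.pow 2).mul_const (1 - -1))).mul_const
      (exp ((2 * k + 1) * (1 - -1))))
    simpa [hE] using h2
  have hsq : Tendsto (fun i => (Θ i 1 - Θ₀ 1) ^ 2) l (𝓝 0) := by
    refine squeeze_zero' (Eventually.of_forall fun i => sq_nonneg _) ?_ hE0
    have hsmall : ∀ᶠ i in l, K * D i < 1 := by
      have := hD.const_mul K
      rw [mul_zero] at this
      exact this.eventually (gt_mem_nhds one_pos)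
    filter_upwards [h, hΘc, hΘ, hsmall] with i hi hic hid his
    have hLD : |L i - L₀| ≤ √(D i) := by
      refine abs_le_sqrt ?_
      simp only [hDdef, dataDist]
      nlinarith [sq_nonneg (U i (-1) - U₀ (-1)), sq_nonneg (p i (-1) - p₀ (-1))]
    have hD1 : √(D i) ≤ 1 := by
      rw [sqrt_le_one]
      nlinarith [dataDist_nonneg L₀ U₀ p₀ (L i) (U i) (p i)]
    have hL : |L i| ≤ |L₀| + 1 := by
      have h2 := abs_add_le (L i - L₀) L₀
      rw [sub_add_cancel] at h2
      linarith
    refine sq_le_of_abs_deriv_le (d := fun y => Θ i y - Θ₀ y) (by norm_num) (by positivity)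
      (hic.sub hΘc₀) (fun y hy => (hid y hy).sub (hΘ₀ y hy)) fun y hy => ?_
    have hy' := Ioo_subset_Icc_self hy
    obtain ⟨hd, hU⟩ := hlip hi his y hy'
    have hU₀ : U₀ y ∈ Icc (-(M + 1)) (M + 1) := abs_le.1 ((hM y hy').1.trans (by linarith))
    obtain ⟨-, -, -, b4, -⟩ := hB (U₀ y) hU₀ (U i y) (abs_le.1 hU)
    have b2 := (hB (U i y) (abs_le.1 hU) (U₀ y) hU₀).2.1
    have b2' := (hB (U₀ y) hU₀ (U₀ y) hU₀).2.1
    have hUd : |U i y - U₀ y| ≤ √(K * D i) :=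
      abs_le_sqrt (by nlinarith [sq_nonneg (p i y - p₀ y)])
    have e1 := abs_prufer_sub_prufer_le b2 (b4.trans (mul_le_mul_of_nonneg_left hUd hB0))
      (Θ i y) (Θ₀ y)
    have e2 : |cos (Θ₀ y) ^ 2 + iteratedDeriv 2 V (U₀ y) * sin (Θ₀ y) ^ 2| ≤ 1 + B := by
      refine (abs_add_le _ _).trans (add_le_add ?_ ?_)
      · rw [abs_of_nonneg (sq_nonneg _)]; exact cos_sq_le_one _
      · rw [abs_mul, abs_of_nonneg (sq_nonneg (sin _))]
        nlinarith [sin_sq_le_one (Θ₀ y), sq_nonneg (sin (Θ₀ y)), abs_nonneg (iteratedDeriv 2 V (U₀ y))]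
    -- The difference of slopes splits into a change of angle and coefficient at length L i, and a
    -- change of length at the reference slope.
    calc _ = |L i * ((cos (Θ i y) ^ 2 + iteratedDeriv 2 V (U i y) * sin (Θ i y) ^ 2) -
            (cos (Θ₀ y) ^ 2 + iteratedDeriv 2 V (U₀ y) * sin (Θ₀ y) ^ 2)) +
            (L i - L₀) * (cos (Θ₀ y) ^ 2 + iteratedDeriv 2 V (U₀ y) * sin (Θ₀ y) ^ 2)| := by
          congr 1; ring
      _ ≤ (|L₀| + 1) * ((1 + B) * |Θ i y - Θ₀ y| + B * √(K * D i)) + √(D i) * (1 + B) := by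
          refine (abs_add_le _ _).trans (add_le_add ?_ ?_)
          · rw [abs_mul]; gcongr
          · rw [abs_mul]; gcongr
      _ = k * |Θ i y - Θ₀ y| + η i := by rw [hk, hη]; ring
  have h1 := hsq.sqrt
  simp only [sqrt_sq_eq_abs, sqrt_zero] at h1
  have h2 := (tendsto_zero_iff_abs_tendsto_zero _).2 h1
  simpa using h2.add_const (Θ₀ 1)

/-- The bilinear pairing of the variation of a solution with a solution of the linearised equation
is conserved up to the change of length and quadratic errors. -/
theorem exists_pairing_le (hV : ContDiff ℝ 3 V) (h₀ : IsScaledSol V L₀ U₀ p₀) {ψ η : ℝ → ℝ}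
    (hψc : ContinuousOn ψ (Icc (-1) 1)) (hηc : ContinuousOn η (Icc (-1) 1))
    (hψ : ∀ y ∈ Ioo (-1 : ℝ) 1, HasDerivAt ψ (L₀ * η y) y)
    (hη : ∀ y ∈ Ioo (-1 : ℝ) 1, HasDerivAt η (-(L₀ * iteratedDeriv 2 V (U₀ y) * ψ y)) y) :
    ∃ K C : ℝ, 0 < K ∧ ∀ {L : ℝ} {U p : ℝ → ℝ}, IsScaledSol V L U p →
      K * dataDist L₀ U₀ p₀ L U p < 1 →
      |(ψ 1 * (p 1 - p₀ 1) - η 1 * (U 1 - U₀ 1)) -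
        (ψ (-1) * (p (-1) - p₀ (-1)) - η (-1) * (U (-1) - U₀ (-1))) +
        2 * (L - L₀) * (ψ (-1) * deriv V (U₀ (-1)) + η (-1) * p₀ (-1))| ≤
        C * dataDist L₀ U₀ p₀ L U p := by
  obtain ⟨K, M, hK1, hM, hlip⟩ := h₀.exists_lipschitz hV
  obtain ⟨B, hB0, hB⟩ := exists_taylor_bounds hV (M + 1)
  obtain ⟨N₁, hN₁⟩ := isCompact_Icc.exists_bound_of_continuousOn hψc
  obtain ⟨N₂, hN₂⟩ := isCompact_Icc.exists_bound_of_continuousOn hηc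
  have hN₁0 : 0 ≤ N₁ := (norm_nonneg _).trans (hN₁ 0 (by norm_num))
  have hN₂0 : 0 ≤ N₂ := (norm_nonneg _).trans (hN₂ 0 (by norm_num))
  have hVc := (contDiff_deriv_of_contDiff_three hV).continuous
  -- J is constant in y: up to sign it is the Wronskian of ψ with the derivative of the reference
  -- solution.
  set J := ψ (-1) * deriv V (U₀ (-1)) + η (-1) * p₀ (-1) with hJ
  have hJy : ∀ y ∈ Icc (-1 : ℝ) 1, ψ y * deriv V (U₀ y) + η y * p₀ y = J := by
    intro y hy
    refine eq_of_hasDerivAt_zero (f := fun y => ψ y * deriv V (U₀ y) + η y * p₀ y)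
      (convex_Icc (-1) 1) ((hψc.mul (hVc.comp_continuousOn h₀.continuousOn)).add
        (hηc.mul h₀.continuousOn_deriv)) (fun z hz => ?_) hy (by norm_num)
    rw [interior_Icc] at hz
    convert! ((hψ z hz).mul ((hasDerivAt_deriv_of_contDiff_three hV (U₀ z)).comp z
      (h₀.hasDerivAt z hz))).add ((hη z hz).mul (h₀.hasDerivAt_deriv z hz)) using 1
    simp only [Function.comp_apply]
    ring
  refine ⟨K, 2 * (N₂ * K + N₁ * (B * K) + N₁ * |L₀| * (B * K)), by linarith, fun {L U p} h hD => ?_⟩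
  set D := dataDist L₀ U₀ p₀ L U p with hDdef
  have hD0 : 0 ≤ D := dataDist_nonneg _ _ _ _ _ _
  have hLD : |L - L₀| ≤ √(K * D) := by
    refine abs_le_sqrt ?_
    have : (L - L₀) ^ 2 ≤ D := by
      simp only [hDdef, dataDist]
      nlinarith [sq_nonneg (U (-1) - U₀ (-1)), sq_nonneg (p (-1) - p₀ (-1))]
    nlinarith
  have hs : √(K * D) * √(K * D) = K * D := mul_self_sqrt (by positivity)
  -- To first order the pairing changes at the constant rate -(L - L₀)J. The linear term cancels
  -- this, so the slope of G is quadratic in the variation.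
  set G : ℝ → ℝ := fun y => ψ y * (p y - p₀ y) - η y * (U y - U₀ y) + (L - L₀) * J * y with hG
  obtain ⟨ξ, hξ, e⟩ := exists_hasDerivAt_eq_slope G (fun y => -(η y * ((L - L₀) * (p y - p₀ y))) -
      ψ y * ((L - L₀) * (deriv V (U y) - deriv V (U₀ y))) - ψ y * L₀ *
        (deriv V (U y) - deriv V (U₀ y) - iteratedDeriv 2 V (U₀ y) * (U y - U₀ y)))
    (show (-1 : ℝ) < 1 by norm_num)
    (((hψc.mul (h.continuousOn_deriv.sub h₀.continuousOn_deriv)).sub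
      (hηc.mul (h.continuousOn.sub h₀.continuousOn))).add (continuousOn_const.mul continuousOn_id))
    (fun y hy => by
      convert! ((((hψ y hy).mul ((h.hasDerivAt_deriv y hy).sub (h₀.hasDerivAt_deriv y hy))).sub
        ((hη y hy).mul ((h.hasDerivAt y hy).sub (h₀.hasDerivAt y hy)))).add
        ((hasDerivAt_id y).const_mul ((L - L₀) * J))) using 1
      rw [← hJy y (Ioo_subset_Icc_self hy)]
      simp only [Pi.sub_apply]
      ring)
  have hξ' := Ioo_subset_Icc_self hξ
  obtain ⟨hd, hU⟩ := hlip h hD ξ hξ'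
  obtain ⟨-, -, b3, -, b5⟩ := hB (U₀ ξ) (abs_le.1 ((hM ξ hξ').1.trans (by linarith))) (U ξ)
    (abs_le.1 hU)
  have hUd : |U ξ - U₀ ξ| ≤ √(K * D) := abs_le_sqrt (by nlinarith [sq_nonneg (p ξ - p₀ ξ)])
  have hpd : |p ξ - p₀ ξ| ≤ √(K * D) := abs_le_sqrt (by nlinarith [sq_nonneg (U ξ - U₀ ξ)])
  have e1 : |η ξ * ((L - L₀) * (p ξ - p₀ ξ))| ≤ N₂ * (K * D) := by
    rw [abs_mul, abs_mul, ← hs]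
    have := hN₂ ξ hξ'
    rw [norm_eq_abs] at this
    gcongr
  have e2 : |ψ ξ * ((L - L₀) * (deriv V (U ξ) - deriv V (U₀ ξ)))| ≤ N₁ * (B * (K * D)) := by
    rw [abs_mul, abs_mul]
    have := hN₁ ξ hξ'
    rw [norm_eq_abs] at this
    have h2 : |L - L₀| * |deriv V (U ξ) - deriv V (U₀ ξ)| ≤ √(K * D) * (B * √(K * D)) := by
      gcongr
      exact b3.trans (mul_le_mul_of_nonneg_left hUd hB0)
    rw [mul_left_comm, hs] at h2
    gcongr
  have e3 : |ψ ξ * L₀ * (deriv V (U ξ) - deriv V (U₀ ξ) - iteratedDeriv 2 V (U₀ ξ) * (U ξ - U₀ ξ))|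
      ≤ N₁ * |L₀| * (B * (K * D)) := by
    rw [abs_mul, abs_mul]
    have := hN₁ ξ hξ'
    rw [norm_eq_abs] at this
    gcongr
    exact b5.trans (mul_le_mul_of_nonneg_left (by nlinarith [sq_nonneg (p ξ - p₀ ξ)]) hB0)
  have e4 : G 1 - G (-1) = (ψ 1 * (p 1 - p₀ 1) - η 1 * (U 1 - U₀ 1)) -
        (ψ (-1) * (p (-1) - p₀ (-1)) - η (-1) * (U (-1) - U₀ (-1))) + 2 * (L - L₀) * J := by
    simp only [hG]; ring
  rw [← e4]
  have e5 : G 1 - G (-1) = 2 * ((G 1 - G (-1)) / (1 - -1)) := by ring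
  rw [e5, ← e, abs_mul, abs_two]
  calc _ ≤ 2 * (N₂ * (K * D) + N₁ * (B * (K * D)) + N₁ * |L₀| * (B * (K * D))) := by
        gcongr
        refine (abs_sub _ _).trans (add_le_add ((abs_sub _ _).trans (add_le_add ?_ e2)) e3)
        rwa [abs_neg]
    _ = _ := by ring

end IsScaledSol

theorem IsFront.isScaledSol {P : Potential} {L um up : ℝ} {u : ℝ → ℝ} (h : IsFront P L um up u)
    (hL : 0 < L) :
    IsScaledSol P.mid L (fun y => u (L * y)) (fun y => deriv u (L * y)) := by
  have hc := h.continuous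
  have hc' := h.continuous_deriv
  have hlin : ∀ y, HasDerivAt (fun y => L * y) L y := fun y => by
    simpa using (hasDerivAt_id y).const_mul L
  refine ⟨by fun_prop, by fun_prop, fun y _ => ?_, fun y hy => ?_⟩
  · convert! (h.hasDerivAt (L * y)).comp y (hlin y) using 1
    ring
  · have hm : L * y ∈ Ioo (-L) L := ⟨by nlinarith [hy.1], by nlinarith [hy.2]⟩
    have := h.ode (L * y) hm.1.ne' hm.2.ne
    rw [P.V_of_mem_Ioo hm] at this
    convert! this.comp y (hlin y) using 1
    ring

/-! ### Differentiating along the branch -/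

/-- The end state of a tail with energy `e`, as a function of the energy `g` of its continuation. -/
theorem hasDerivAt_endState {V W v p : ℝ → ℝ} {e g₀ : ℝ} (hV : ContDiff ℝ 3 V)
    (hW : ContDiff ℝ 3 W) (hv : ContinuousAt v g₀) (hp : ContinuousAt p g₀)
    (hWe : ∀ᶠ g in 𝓝 g₀, p g ^ 2 / 2 + W (v g) = g)
    (hVe : ∀ᶠ g in 𝓝 g₀, p g ^ 2 / 2 + V (v g) = e) (hp0 : p g₀ ≠ 0)
    (hne : deriv W (v g₀) - deriv V (v g₀) ≠ 0) :
    HasDerivAt v (deriv W (v g₀) - deriv V (v g₀))⁻¹ g₀ ∧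
      HasDerivAt p (-deriv V (v g₀) / (p g₀ * (deriv W (v g₀) - deriv V (v g₀)))) g₀ := by
  have hv' : HasDerivAt v (deriv W (v g₀) - deriv V (v g₀))⁻¹ g₀ := by
    -- Subtracting the two energy identities gives W(v) - V(v) + e = g, so v locally inverts an
    -- explicit function.
    refine HasDerivAt.of_local_left_inverse (f := fun y => W y - V y + e) hv
      (((hasDerivAt_of_contDiff_three hW _).sub (hasDerivAt_of_contDiff_three hV _)).add_const e)
      hne ?_
    filter_upwards [hWe, hVe] with g h1 h2
    linarith
  refine ⟨hv', ?_⟩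
  have hs : HasDerivAt (fun g => 2 * (e - V (v g)))
      (2 * -(deriv V (v g₀) * (deriv W (v g₀) - deriv V (v g₀))⁻¹)) g₀ :=
    (((hasDerivAt_of_contDiff_three hV _).comp g₀ hv').const_sub e).const_mul 2
  have hs0 : 2 * (e - V (v g₀)) = p g₀ ^ 2 := by linarith [hVe.self_of_nhds]
  have hsq := hs.sqrt (by rw [hs0]; positivity)
  rw [hs0, sqrt_sq_eq_abs] at hsq
  -- Energy gives p = ±√(2(e - V(v))), with a locally constant sign.
  rcases lt_or_gt_of_ne hp0 with hn | hn
  · rw [abs_of_neg hn] at hsq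
    have hev : p =ᶠ[𝓝 g₀] fun g => -√(2 * (e - V (v g))) := by
      filter_upwards [hVe, hp.eventually (gt_mem_nhds hn)] with g h1 h2
      rw [show 2 * (e - V (v g)) = p g ^ 2 by linarith, sqrt_sq_eq_abs, abs_of_neg h2, neg_neg]
    convert! hsq.fun_neg.congr_of_eventuallyEq hev using 1
    field_simp
  · rw [abs_of_pos hn] at hsq
    have hev : p =ᶠ[𝓝 g₀] fun g => √(2 * (e - V (v g))) := by
      filter_upwards [hVe, hp.eventually (lt_mem_nhds hn)] with g h1 h2
      rw [show 2 * (e - V (v g)) = p g ^ 2 by linarith, sqrt_sq_eq_abs, abs_of_pos h2]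
    convert! hsq.congr_of_eventuallyEq hev using 1
    field_simp

/-- The sign of this number relates the slope of the length curve to the front angle. -/
def orientation (P : Potential) (um up L : ℝ) (u : ℝ → ℝ) : ℝ :=
  bifLeft P L u * bifRight P L u * ((u (-L) - um) * (u L - up))

namespace IsFrontBranch

variable {P : Potential} {um up : ℝ} {J : Set ℝ} {L : ℝ → ℝ} {u : ℝ → ℝ → ℝ} {g : ℝ}

theorem eventually_mem (hb : IsFrontBranch P um up J L u) (hg : g ∈ J) : ∀ᶠ g' in 𝓝 g, g' ∈ J :=
  hb.isOpen.mem_nhds hg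

theorem isTail_left (hb : IsFrontBranch P um up J L u) (hg : g ∈ J)
    (hbif : bifLeft P (L g) (u g) ≠ 0) : IsTail P.left um (-L g) (u g) :=
  (hb.front g hg).isTail (hb.length_pos g hg) (left_ne_zero_of_mul hbif)

theorem isTail_right (hb : IsFrontBranch P um up J L u) (hg : g ∈ J)
    (hbif : bifRight P (L g) (u g) ≠ 0) : IsTail P.right up (-L g) fun x => u g (-x) :=
  (hb.front g hg).isTail_reflect (hb.length_pos g hg) (left_ne_zero_of_mul hbif)

theorem isStepCoeff (hb : IsFrontBranch P um up J L u) (hg : g ∈ J)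
    (hbif : bifLeft P (L g) (u g) ≠ 0 ∧ bifRight P (L g) (u g) ≠ 0) :
    IsStepCoeff (L g) (leftCoeff P (u g)) (midCoeff P (u g)) (rightCoeff P (u g)) :=
  (hb.front g hg).isStepCoeff (hb.length_pos g hg) (left_ne_zero_of_mul hbif.1)
    (left_ne_zero_of_mul hbif.2)

theorem hamiltonian_Icc (hb : IsFrontBranch P um up J L u) (hg : g ∈ J) :
    ∀ x ∈ Icc (-L g) (L g), deriv (u g) x ^ 2 / 2 + P.mid (u g x) = g := by
  have hc := (hb.front g hg).continuous
  have hc' := (hb.front g hg).continuous_deriv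
  have hm := P.mid_smooth.continuous
  have hL := hb.length_pos g hg
  have : EqOn (fun x => deriv (u g) x ^ 2 / 2 + P.mid (u g x)) (fun _ => g)
      (closure (Ioo (-L g) (L g))) :=
    EqOn.closure (hb.hamiltonian g hg) (by fun_prop) (by fun_prop)
  rwa [closure_Ioo (by linarith)] at this

theorem continuousAt_length (hb : IsFrontBranch P um up J L u) (hg : g ∈ J) : ContinuousAt L g :=
  hb.length_smooth.continuousOn.continuousAt (hb.eventually_mem hg)

theorem hasDerivAt_length (hb : IsFrontBranch P um up J L u) (hg : g ∈ J) :
    HasDerivAt L (deriv L g) g :=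
  ((hb.length_smooth.differentiableOn (by norm_num)).differentiableAt
    (hb.eventually_mem hg)).hasDerivAt

theorem tendsto_dataDist (hb : IsFrontBranch P um up J L u) (hg : g ∈ J) :
    Tendsto (fun g' => IsScaledSol.dataDist (L g) (fun y => u g (L g * y))
      (fun y => deriv (u g) (L g * y)) (L g') (fun y => u g' (L g' * y))
      (fun y => deriv (u g') (L g' * y))) (𝓝 g) (𝓝 0) := by
  have h1 := ((hb.continuous_ul.continuousAt (hb.eventually_mem hg)).tendsto.sub_const
    (u g (-L g))).pow 2
  have h2 := ((hb.continuous_pl.continuousAt (hb.eventually_mem hg)).tendsto.sub_const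
    (deriv (u g) (-L g))).pow 2
  have h3 := ((hb.continuousAt_length hg).tendsto.sub_const (L g)).pow 2
  simpa [IsScaledSol.dataDist] using (h1.add h2).add h3

/-- The front angle is continuous along a branch. -/
theorem continuousAt_frontAngle (hb : IsFrontBranch P um up J L u)
    (hbif : ∀ g ∈ J, bifLeft P (L g) (u g) ≠ 0 ∧ bifRight P (L g) (u g) ≠ 0) (hg : g ∈ J) :
    ContinuousAt (fun g => frontAngle P (L g) (u g)) g := by
  have hJ := hb.eventually_mem hg
  have hleft : Tendsto (fun g' => leftAngle (leftCoeff P (u g')) 0 (-L g')) (𝓝 g)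
      (𝓝 (leftAngle (leftCoeff P (u g)) 0 (-L g))) :=
    (hb.isTail_left hg (hbif g hg).1).tendsto_leftAngle
      (hJ.mono fun g' hg' => hb.isTail_left hg' (hbif g' hg').1)
      (hb.continuous_ul.continuousAt hJ) (hb.continuous_pl.continuousAt hJ)
  have hright : Tendsto (fun g' => leftAngle (fun x => rightCoeff P (u g') (-x)) 0 (-L g')) (𝓝 g)
      (𝓝 (leftAngle (fun x => rightCoeff P (u g) (-x)) 0 (-L g))) := by
    refine (hb.isTail_right hg (hbif g hg).2).tendsto_leftAngle
      (hJ.mono fun g' hg' => hb.isTail_right hg' (hbif g' hg').2) ?_ ?_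
    · simpa using (hb.continuous_ur.continuousAt hJ).tendsto
    · simpa [deriv_comp_neg] using (hb.continuous_pr.continuousAt hJ).tendsto.neg
  -- Rescaling to [-1, 1] puts the middle angles of different fronts on a common interval.
  set Θ : ℝ → ℝ → ℝ := fun g' y =>
    midAngle (L g') (leftCoeff P (u g')) (midCoeff P (u g')) 0 (L g' * y) with hΘ
  have hang : ∀ g' ∈ J, IsAngle (fun x => midCoeff P (u g') x - 0)
      (midAngle (L g') (leftCoeff P (u g')) (midCoeff P (u g')) 0) := fun g' hg' =>
    (hb.isStepCoeff hg' (hbif g' hg')).isAngle_mid 0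
  have hcont : ∀ g' ∈ J, ContinuousOn (Θ g') (Icc (-1) 1) := fun g' hg' => by
    have := (hang g' hg').continuous
    fun_prop
  have hder : ∀ g' ∈ J, ∀ y ∈ Ioo (-1 : ℝ) 1, HasDerivAt (Θ g') (L g' * (cos (Θ g' y) ^ 2 +
      iteratedDeriv 2 P.mid (u g' (L g' * y)) * sin (Θ g' y) ^ 2)) y := by
    intro g' hg' y _
    have hlin : HasDerivAt (fun y => L g' * y) (L g') y := by
      simpa using (hasDerivAt_id y).const_mul (L g')
    convert! (hang g' hg' (L g' * y)).comp y hlin using 1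
    simp only [sub_zero, midCoeff]
    ring
  have hinit : ∀ g' ∈ J, Θ g' (-1) = leftAngle (leftCoeff P (u g')) 0 (-L g') := fun g' hg' => by
    simp only [hΘ, mul_neg, mul_one]
    exact (hb.isStepCoeff hg' (hbif g' hg')).midAngle_neg 0
  have hmid : Tendsto (fun g' => Θ g' 1) (𝓝 g) (𝓝 (Θ g 1)) := by
    refine IsScaledSol.tendsto_angle P.mid_smooth
      ((hb.front g hg).isScaledSol (hb.length_pos g hg))
      (hJ.mono fun g' hg' => (hb.front g' hg').isScaledSol (hb.length_pos g' hg'))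
      (hb.tendsto_dataDist hg) (hcont g hg) (hder g hg) (hJ.mono hcont) (hJ.mono hder) ?_
    rw [hinit g hg]
    exact hleft.congr' (hJ.mono fun g' hg' => (hinit g' hg').symm)
  have := hmid.add hright
  simpa [ContinuousAt, frontAngle, matchAngle, hΘ] using this

theorem continuousAt_orientation (hb : IsFrontBranch P um up J L u) (hg : g ∈ J) :
    ContinuousAt (fun g => orientation P um up (L g) (u g)) g := by
  have hJ := hb.eventually_mem hg
  have h1 := hb.continuous_ul.continuousAt hJ
  have h2 := hb.continuous_pl.continuousAt hJ
  have h3 := hb.continuous_ur.continuousAt hJ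
  have h4 := hb.continuous_pr.continuousAt hJ
  have hl := (contDiff_deriv_of_contDiff_three P.left_smooth).continuous
  have hm := (contDiff_deriv_of_contDiff_three P.mid_smooth).continuous
  have hr := (contDiff_deriv_of_contDiff_three P.right_smooth).continuous
  unfold orientation bifLeft bifRight
  exact ((h2.mul ((hm.continuousAt.comp h1).sub (hl.continuousAt.comp h1))).mul
    (h4.mul ((hr.continuousAt.comp h3).sub (hm.continuousAt.comp h3)))).mul
    ((h1.sub continuousAt_const).mul (h3.sub continuousAt_const))

theorem orientation_ne_zero (hb : IsFrontBranch P um up J L u) (hg : g ∈ J)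
    (hbif : bifLeft P (L g) (u g) ≠ 0 ∧ bifRight P (L g) (u g) ≠ 0) :
    orientation P um up (L g) (u g) ≠ 0 := by
  have h1 := (hb.isTail_left hg hbif.1).ne_limit le_rfl
  have h2 := (hb.isTail_right hg hbif.2).ne_limit le_rfl
  rw [neg_neg] at h2
  exact mul_ne_zero (mul_ne_zero hbif.1 hbif.2)
    (mul_ne_zero (sub_ne_zero.2 h1) (sub_ne_zero.2 h2))

/-- The variation of the end states along the branch. -/
theorem hasDerivAt_left (hb : IsFrontBranch P um up J L u)
    (hbif : ∀ g ∈ J, bifLeft P (L g) (u g) ≠ 0 ∧ bifRight P (L g) (u g) ≠ 0) (hg : g ∈ J) :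
    HasDerivAt (fun g => u g (-L g)) (deriv (u g) (-L g) / bifLeft P (L g) (u g)) g ∧
      HasDerivAt (fun g => deriv (u g) (-L g))
        (-deriv P.left (u g (-L g)) / bifLeft P (L g) (u g)) g := by
  have hJ := hb.eventually_mem hg
  have hp := left_ne_zero_of_mul (hbif g hg).1
  have h := hasDerivAt_endState (v := fun g => u g (-L g)) (p := fun g => deriv (u g) (-L g))
    (e := P.left um) P.left_smooth P.mid_smooth (hb.continuous_ul.continuousAt hJ)
    (hb.continuous_pl.continuousAt hJ)
    (hJ.mono fun g' hg' => hb.hamiltonian_Icc hg' _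
      (left_mem_Icc.2 (by linarith [hb.length_pos g' hg'])))
    (hJ.mono fun g' hg' => (hb.isTail_left hg' (hbif g' hg').1).energy le_rfl) hp
    (right_ne_zero_of_mul (hbif g hg).1)
  refine ⟨?_, h.2⟩
  convert! h.1 using 1
  rw [bifLeft, div_mul_cancel_left₀ hp]

theorem hasDerivAt_right (hb : IsFrontBranch P um up J L u)
    (hbif : ∀ g ∈ J, bifLeft P (L g) (u g) ≠ 0 ∧ bifRight P (L g) (u g) ≠ 0) (hg : g ∈ J) :
    HasDerivAt (fun g => u g (L g)) (-deriv (u g) (L g) / bifRight P (L g) (u g)) g ∧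
      HasDerivAt (fun g => deriv (u g) (L g))
        (deriv P.right (u g (L g)) / bifRight P (L g) (u g)) g := by
  have hJ := hb.eventually_mem hg
  have hp := left_ne_zero_of_mul (hbif g hg).2
  have hne := right_ne_zero_of_mul (hbif g hg).2
  -- At the right end the bifurcation function takes the potentials in the opposite order; hence the
  -- signs differ from those at the left end.
  have hne' : deriv P.mid (u g (L g)) - deriv P.right (u g (L g)) ≠ 0 := by
    rw [← neg_sub]; exact neg_ne_zero.2 hne
  have h := hasDerivAt_endState (v := fun g => u g (L g)) (p := fun g => deriv (u g) (L g))
    (e := P.right up) P.right_smooth P.mid_smooth (hb.continuous_ur.continuousAt hJ)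
    (hb.continuous_pr.continuousAt hJ)
    (hJ.mono fun g' hg' => hb.hamiltonian_Icc hg' _
      (right_mem_Icc.2 (by linarith [hb.length_pos g' hg'])))
    (hJ.mono fun g' hg' => by
      have := (hb.isTail_right hg' (hbif g' hg').2).energy le_rfl
      simpa [deriv_comp_neg] using this) hp hne'
  constructor
  · convert! h.1 using 1
    rw [bifRight]
    field_simp
    ring
  · convert! h.2 using 1
    rw [bifRight]
    field_simp
    ring

theorem variation (hb : IsFrontBranch P um up J L u)
    (hbif : ∀ g ∈ J, bifLeft P (L g) (u g) ≠ 0 ∧ bifRight P (L g) (u g) ≠ 0) (hg : g ∈ J)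
    {ψ η : ℝ → ℝ} (hsol : IsSolOn (fun x => midCoeff P (u g) x) univ ψ η) :
    (ψ (L g) * (deriv P.right (u g (L g)) / bifRight P (L g) (u g)) -
        η (L g) * (-deriv (u g) (L g) / bifRight P (L g) (u g))) -
      (ψ (-L g) * (-deriv P.left (u g (-L g)) / bifLeft P (L g) (u g)) -
        η (-L g) * (deriv (u g) (-L g) / bifLeft P (L g) (u g))) +
      2 * deriv L g * (ψ (-L g) * deriv P.mid (u g (-L g)) + η (-L g) * deriv (u g) (-L g)) = 0 := by
  have hJ := hb.eventually_mem hg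
  obtain ⟨hul, hpl⟩ := hb.hasDerivAt_left hbif hg
  obtain ⟨hur, hpr⟩ := hb.hasDerivAt_right hbif hg
  have hL := hb.hasDerivAt_length hg
  have hψc : Continuous ψ := continuousOn_univ.1 hsol.continuousOn
  have hηc : Continuous η := continuousOn_univ.1 hsol.continuousOn_deriv
  have hlin : ∀ y, HasDerivAt (fun y => L g * y) (L g) y := fun y => by
    simpa using (hasDerivAt_id y).const_mul (L g)
  obtain ⟨K, C, hK, hC⟩ := ((hb.front g hg).isScaledSol (hb.length_pos g hg)).exists_pairing_le
    P.mid_smooth (ψ := fun y => ψ (L g * y)) (η := fun y => η (L g * y)) (by fun_prop)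
    (by fun_prop) (fun y _ => by
      convert! (hsol.hasDerivAt (L g * y) (by simp)).comp y (hlin y) using 1
      ring) (fun y _ => by
      convert! (hsol.hasDerivAt_deriv (L g * y) (by simp)).comp y (hlin y) using 1
      simp only [midCoeff]
      ring)
  set Q := ψ (-L g) * deriv P.mid (u g (-L g)) + η (-L g) * deriv (u g) (-L g)
  -- Its derivative at g is the left-hand side of the claim, while the pairing estimate bounds φ g'
  -- - φ g by the squared distance of the data, which is o(g' - g).
  set φ : ℝ → ℝ := fun g' => (ψ (L g) * deriv (u g') (L g') - η (L g) * u g' (L g')) -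
    (ψ (-L g) * deriv (u g') (-L g') - η (-L g) * u g' (-L g')) + 2 * L g' * Q with hφ
  have hφd : HasDerivAt φ ((ψ (L g) * (deriv P.right (u g (L g)) / bifRight P (L g) (u g)) -
        η (L g) * (-deriv (u g) (L g) / bifRight P (L g) (u g))) -
      (ψ (-L g) * (-deriv P.left (u g (-L g)) / bifLeft P (L g) (u g)) -
        η (-L g) * (deriv (u g) (-L g) / bifLeft P (L g) (u g))) + 2 * deriv L g * Q) g :=
    (((hpr.const_mul _).sub (hur.const_mul _)).sub ((hpl.const_mul _).sub (hul.const_mul _))).add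
      ((hL.const_mul 2).mul_const Q)
  refine hφd.unique ?_
  rw [hasDerivAt_iff_isLittleO]
  simp only [smul_zero, sub_zero]
  have hlo : (fun g' => (u g' (-L g') - u g (-L g)) ^ 2 + (deriv (u g') (-L g') -
      deriv (u g) (-L g)) ^ 2 + (L g' - L g) ^ 2) =o[𝓝 g] fun g' => g' - g := by
    have key : ∀ {f : ℝ → ℝ} {f' : ℝ}, HasDerivAt f f' g →
        (fun g' => (f g' - f g) ^ 2) =o[𝓝 g] fun g' => g' - g := by
      intro f f' hf
      have h1 := hf.isBigO_sub
      have h2 : (fun g' => f g' - f g) =o[𝓝 g] fun _ => (1 : ℝ) := by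
        rw [Asymptotics.isLittleO_one_iff]
        simpa using hf.continuousAt.tendsto.sub_const (f g)
      simpa [sq] using h2.mul_isBigO h1
    exact ((key hul).add (key hpl)).add (key hL)
  refine Asymptotics.IsBigO.trans_isLittleO (Asymptotics.IsBigO.of_bound C ?_) hlo
  have hsmall : ∀ᶠ g' in 𝓝 g, K * IsScaledSol.dataDist (L g) (fun y => u g (L g * y))
      (fun y => deriv (u g) (L g * y)) (L g') (fun y => u g' (L g' * y))
      (fun y => deriv (u g') (L g' * y)) < 1 := by
    have := (hb.tendsto_dataDist hg).const_mul K
    rw [mul_zero] at this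
    exact this.eventually (gt_mem_nhds one_pos)
  filter_upwards [hJ, hsmall] with g' hg' hs
  have h1 := hC ((hb.front g' hg').isScaledSol (hb.length_pos g' hg')) hs
  simp only [IsScaledSol.dataDist, mul_neg, mul_one] at h1
  rw [norm_eq_abs, norm_of_nonneg (by positivity)]
  refine le_trans (le_of_eq ?_) h1
  congr 1
  simp only [hφ]
  ring

/-- The slope of the length curve determines the front angle modulo `π`, up to a positive factor. -/
theorem exists_sin_frontAngle_eq (hb : IsFrontBranch P um up J L u)
    (hbif : ∀ g ∈ J, bifLeft P (L g) (u g) ≠ 0 ∧ bifRight P (L g) (u g) ≠ 0) (hg : g ∈ J) :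
    ∃ m, 0 < m ∧
      sin (frontAngle P (L g) (u g)) = m * (orientation P um up (L g) (u g) * deriv L g) := by
  have hstep := hb.isStepCoeff hg (hbif g hg)
  obtain ⟨hBl, hBr⟩ := hbif g hg
  obtain ⟨cl, l1, l2, l3, -⟩ := (hb.isTail_left hg hBl).leftAngle_spec
  obtain ⟨cr, r1, r2, r3, -⟩ := (hb.isTail_right hg hBr).leftAngle_spec
  rw [deriv_comp_neg] at r2
  rw [neg_neg] at r1 r2 r3
  have hsol := hstep.isSolOn_midSol 0
  simp only [sub_zero] at hsol
  have hvar := hb.variation hbif hg hsol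
  rw [hstep.midSol_neg, hstep.midSolDeriv_neg] at hvar
  simp only [leftSol, leftSolDeriv, amplitude_self, one_mul, midSol, midSolDeriv] at hvar
  rw [frontAngle, matchAngle, sin_add]
  change deriv (u g) (-L g) = cl * sin (leftAngle (leftCoeff P (u g)) 0 (-L g)) at l2
  change -deriv P.left (u g (-L g)) = cl * cos (leftAngle (leftCoeff P (u g)) 0 (-L g)) at l3
  change -deriv (u g) (L g) = cr * sin (leftAngle (fun x => rightCoeff P (u g) (-x)) 0 (-L g)) at r2
  change -deriv P.right (u g (L g)) =
    cr * cos (leftAngle (fun x => rightCoeff P (u g) (-x)) 0 (-L g)) at r3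
  set ρ := amplitude (fun x => midCoeff P (u g) x - 0)
    (midAngle (L g) (leftCoeff P (u g)) (midCoeff P (u g)) 0) (-L g) (L g)
  have hρ : 0 < ρ := amplitude_pos _ _ _ _
  set A := leftAngle (leftCoeff P (u g)) 0 (-L g)
  set A' := leftAngle (fun x => rightCoeff P (u g) (-x)) 0 (-L g)
  set θ := midAngle (L g) (leftCoeff P (u g)) (midCoeff P (u g)) 0 (L g)
  have hcl : cl ≠ 0 := by rintro rfl; simp at l1
  have hcr : cr ≠ 0 := by rintro rfl; simp at r1
  have hwl : u g (-L g) - um ≠ 0 := by intro h; simp [h] at l1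
  have hwr : u g (L g) - up ≠ 0 := by intro h; simp [h] at r1
  -- The 2 is the length of [-1, 1]; the denominator is positive because cl and cr have the signs of
  -- the deviations from um and up.
  refine ⟨2 / (ρ * (cl * (u g (-L g) - um)) * (cr * (u g (L g) - up))), by positivity, ?_⟩
  -- The conserved quantity of the middle interval, evaluated at the left end.
  have hk : cl * (sin A * deriv P.mid (u g (-L g)) + cos A * deriv (u g) (-L g)) =
      bifLeft P (L g) (u g) := by
    rw [bifLeft]
    linear_combination -deriv P.mid (u g (-L g)) * l2 - deriv (u g) (-L g) * l3
  have hpr' : deriv P.right (u g (L g)) = -(cr * cos A') := by linarith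
  rw [l3, l2, r2, hpr'] at hvar
  rw [← l2] at hvar
  -- The left pairing drops out: there the variation of the state is parallel to (ψ, ψ'). At the
  -- right the pairing contains sin (θ + A').
  have hvar' : ρ * cr * (sin θ * cos A' + cos θ * sin A') / bifRight P (L g) (u g) =
      2 * deriv L g * bifLeft P (L g) (u g) / cl := by
    rw [← hk, mul_comm cl, mul_div_assoc (2 * deriv L g), mul_div_cancel_right₀ _ hcl]
    rw [l2] at hvar ⊢
    linear_combination -hvar
  rw [div_eq_div_iff hBr hcl] at hvar'
  rw [orientation]
  field_simp
  linear_combination hvar'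

end IsFrontBranch

/-! ### Sign of a function near a zero of finite order -/

/-- A function has the sign of its leading Taylor term. -/
theorem VanishesToOrder.eventually_mul_pos {f : ℝ → ℝ} {a : ℝ} {n : ℕ} (h : VanishesToOrder f a n) :
    ∀ᶠ x in 𝓝[≠] a, 0 < f x * (iteratedDeriv n f a * (x - a) ^ n) := by
  obtain ⟨hc, hz, hne⟩ := h
  obtain ⟨s, hs, hsf⟩ := hc.contDiffOn le_rfl (by simp)
  obtain ⟨r, hr, hrs⟩ := Metric.mem_nhds_iff.1 hs
  have ha : a ∈ Metric.ball a r := Metric.mem_ball_self hr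
  have hcon := hsf.mono hrs
  set c := (n.factorial : ℝ)⁻¹ * iteratedDeriv n f a with hcdef
  have hc0 : c ≠ 0 := mul_ne_zero (by positivity) hne
  have hT := taylor_isLittleO (convex_ball a r) ha hcon
  have heq : ∀ x, taylorWithinEval f n (Metric.ball a r) a x = c * (x - a) ^ n := by
    intro x
    rw [taylor_within_apply, Finset.sum_range_succ, Finset.sum_eq_zero, zero_add,
      iteratedDerivWithin_of_isOpen Metric.isOpen_ball ha, smul_eq_mul, hcdef]
    · ring
    · intro k hk
      rw [iteratedDerivWithin_of_isOpen Metric.isOpen_ball ha, hz k (Finset.mem_range.1 hk),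
        smul_zero]
  rw [nhdsWithin_eq_nhds.2 (Metric.ball_mem_nhds a hr)] at hT
  have hb := hT.def (c := |c| / 2) (by positivity)
  filter_upwards [hb.filter_mono nhdsWithin_le_nhds, self_mem_nhdsWithin] with x hx hxa
  rw [heq, norm_eq_abs, norm_eq_abs] at hx
  have hpow : (x - a) ^ n ≠ 0 := pow_ne_zero n (sub_ne_zero.2 hxa)
  set t := c * (x - a) ^ n with ht
  have ht0 : t ≠ 0 := mul_ne_zero hc0 hpow
  have hx' : |f x - t| ≤ |t| / 2 := by
    rw [ht, abs_mul]; linarith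
  have key : 0 < f x * t := by
    have h1 : |(f x - t) * t| ≤ |t| / 2 * |t| := by
      rw [abs_mul]; gcongr
    have h2 := (abs_le.1 h1).1
    have h3 : |t| * |t| = t ^ 2 := by rw [← sq, sq_abs]
    have h4 : 0 < t ^ 2 := by positivity
    nlinarith
  have e : f x * (iteratedDeriv n f a * (x - a) ^ n) = n.factorial * (f x * t) := by
    rw [ht, hcdef]
    field_simp
  rw [e]
  positivity

theorem VanishesToOrder.exists_const_mul_pos {f : ℝ → ℝ} {a : ℝ} {n : ℕ}
    (h : VanishesToOrder f a n) {s : ℝ} (hs : s ≠ 0) :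
    ∃ t, t ≠ 0 ∧ ∀ᶠ x in 𝓝[≠] a, 0 < s * f x * (t * (x - a) ^ n) := by
  refine ⟨s * iteratedDeriv n f a, mul_ne_zero hs h.2.2, ?_⟩
  filter_upwards [h.eventually_mul_pos] with x hx
  have e : s * f x * (s * iteratedDeriv n f a * (x - a) ^ n) =
      s ^ 2 * (f x * (iteratedDeriv n f a * (x - a) ^ n)) := by ring
  rw [e]
  positivity

theorem VanishesToOrder.sign_of_even {f : ℝ → ℝ} {a : ℝ} {n : ℕ} (h : VanishesToOrder f a n)
    (hn : Even n) {s : ℝ} (hs : s ≠ 0) :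
    (∀ᶠ x in 𝓝[≠] a, 0 < s * f x) ∨ ∀ᶠ x in 𝓝[≠] a, s * f x < 0 := by
  obtain ⟨t, ht, hev⟩ := h.exists_const_mul_pos hs
  rcases lt_or_gt_of_ne ht with ht | ht
  · right
    filter_upwards [hev, self_mem_nhdsWithin] with x hx hxa
    exact (neg_iff_neg_of_mul_pos hx).2
      (mul_neg_of_neg_of_pos ht (hn.pow_pos (sub_ne_zero.2 hxa)))
  · left
    filter_upwards [hev, self_mem_nhdsWithin] with x hx hxa
    exact (pos_iff_pos_of_mul_pos hx).2 (mul_pos ht (hn.pow_pos (sub_ne_zero.2 hxa)))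

theorem VanishesToOrder.sign_of_odd {f : ℝ → ℝ} {a : ℝ} {n : ℕ} (h : VanishesToOrder f a n)
    (hn : Odd n) {s : ℝ} (hs : s ≠ 0) :
    ((∀ᶠ x in 𝓝[<] a, s * f x < 0) ∧ ∀ᶠ x in 𝓝[>] a, 0 < s * f x) ∨
      ((∀ᶠ x in 𝓝[<] a, 0 < s * f x) ∧ ∀ᶠ x in 𝓝[>] a, s * f x < 0) := by
  obtain ⟨t, ht, hev⟩ := h.exists_const_mul_pos hs
  have hl : ∀ᶠ x in 𝓝[<] a, 0 < s * f x * (t * (x - a) ^ n) ∧ (x - a) ^ n < 0 := by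
    filter_upwards [hev.filter_mono (nhdsWithin_mono a fun x hx => ne_of_lt hx),
      self_mem_nhdsWithin] with x hx hxa
    exact ⟨hx, hn.pow_neg (sub_neg.2 hxa)⟩
  have hr : ∀ᶠ x in 𝓝[>] a, 0 < s * f x * (t * (x - a) ^ n) ∧ 0 < (x - a) ^ n := by
    filter_upwards [hev.filter_mono (nhdsWithin_mono a fun x hx => ne_of_gt hx),
      self_mem_nhdsWithin] with x hx hxa
    exact ⟨hx, pow_pos (sub_pos.2 hxa) n⟩
  rcases lt_or_gt_of_ne ht with ht | ht
  · exact Or.inr ⟨hl.mono fun x hx => (pos_iff_pos_of_mul_pos hx.1).2 (mul_pos_of_neg_of_neg ht hx.2),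
      hr.mono fun x hx => (neg_iff_neg_of_mul_pos hx.1).2 (mul_neg_of_neg_of_pos ht hx.2)⟩
  · exact Or.inl ⟨hl.mono fun x hx => (neg_iff_neg_of_mul_pos hx.1).2 (mul_neg_of_pos_of_neg ht hx.2),
      hr.mono fun x hx => (pos_iff_pos_of_mul_pos hx.1).2 (mul_pos ht hx.2)⟩

theorem not_changesAt {S : ℝ → Prop} {a : ℝ} {c : Prop} (h : ∀ᶠ g in 𝓝[≠] a, (S g ↔ c)) :
    ¬ ChangesAt S a := by
  have hl : ∀ᶠ g in 𝓝[<] a, (S g ↔ c) := h.filter_mono (nhdsWithin_mono _ fun x hx => ne_of_lt hx)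
  have hr : ∀ᶠ g in 𝓝[>] a, (S g ↔ c) := h.filter_mono (nhdsWithin_mono _ fun x hx => ne_of_gt hx)
  rintro (⟨h1, h2⟩ | ⟨h1, h2⟩)
  · obtain ⟨x, hx⟩ := (h1.and hl).exists
    obtain ⟨y, hy⟩ := (h2.and hr).exists
    tauto
  · obtain ⟨x, hx⟩ := (h1.and hl).exists
    obtain ⟨y, hy⟩ := (h2.and hr).exists
    tauto

/-! ### The number of positive eigenvalues along the branch -/

namespace IsFrontBranch

variable {P : Potential} {um up : ℝ} {J : Set ℝ} {L : ℝ → ℝ} {u : ℝ → ℝ → ℝ} {g : ℝ}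

theorem frontAngle_pos (hb : IsFrontBranch P um up J L u)
    (hbif : ∀ g ∈ J, bifLeft P (L g) (u g) ≠ 0 ∧ bifRight P (L g) (u g) ≠ 0) (hg : g ∈ J) :
    0 < frontAngle P (L g) (u g) :=
  (hb.isStepCoeff hg (hbif g hg)).matchAngle_pos le_rfl

theorem sin_frontAngle_eq_zero_iff (hb : IsFrontBranch P um up J L u)
    (hbif : ∀ g ∈ J, bifLeft P (L g) (u g) ≠ 0 ∧ bifRight P (L g) (u g) ≠ 0) (hg : g ∈ J) :
    sin (frontAngle P (L g) (u g)) = 0 ↔ deriv L g = 0 := by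
  obtain ⟨m, hm, e⟩ := hb.exists_sin_frontAngle_eq hbif hg
  rw [e, mul_eq_zero, mul_eq_zero]
  simp [hm.ne', hb.orientation_ne_zero hg (hbif g hg)]

/-- Where the length curve is not stationary, the number of positive eigenvalues is locally
constant. -/
theorem exists_eventually_encard_eq (hb : IsFrontBranch P um up J L u)
    (hbif : ∀ g ∈ J, bifLeft P (L g) (u g) ≠ 0 ∧ bifRight P (L g) (u g) ≠ 0) (hg : g ∈ J)
    (hL : deriv L g ≠ 0) :
    ∃ N : ℕ, ∀ᶠ g' in 𝓝 g, (positiveEigenvalues P (L g') (u g')).encard = N := by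
  have hF := hb.frontAngle_pos hbif hg
  have hπ := pi_pos
  set F := frontAngle P (L g) (u g) with hFdef
  -- The angle lies strictly between consecutive multiples of π, and by continuity it stays there.
  have h1 : ⌊F / π⌋₊ * π ≤ F := (le_div_iff₀ hπ).1 (Nat.floor_le (by positivity))
  have h2 : F < (⌊F / π⌋₊ + 1) * π := (div_lt_iff₀ hπ).1 (Nat.lt_floor_add_one _)
  have h3 : ⌊F / π⌋₊ * π ≠ F := by
    intro h
    refine hL ((hb.sin_frontAngle_eq_zero_iff hbif hg).1 ?_)
    rw [← hFdef, ← h, sin_nat_mul_pi]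
  have hc := hb.continuousAt_frontAngle hbif hg
  refine ⟨⌊F / π⌋₊, ?_⟩
  filter_upwards [hb.eventually_mem hg, hc.eventually (lt_mem_nhds (lt_of_le_of_ne h1 h3)),
    hc.eventually (gt_mem_nhds h2)] with g' hg' h4 h5
  exact encard_positiveEigenvalues (hb.isStepCoeff hg' (hbif g' hg')) h4 h5.le

/-- Near a stationary point of the length curve, the number of positive eigenvalues is determined
by the sign of its slope. -/
theorem exists_eventually_encard_eq_of_sign (hb : IsFrontBranch P um up J L u)
    (hbif : ∀ g ∈ J, bifLeft P (L g) (u g) ≠ 0 ∧ bifRight P (L g) (u g) ≠ 0) (hg : g ∈ J)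
    (hL : deriv L g = 0) :
    ∃ j : ℕ, frontAngle P (L g) (u g) = (j + 1 : ℕ) * π ∧ ∃ s : ℝ, s ≠ 0 ∧ ∀ᶠ g' in 𝓝 g,
      (s * deriv L g' < 0 → (positiveEigenvalues P (L g') (u g')).encard = j) ∧
      (0 < s * deriv L g' → (positiveEigenvalues P (L g') (u g')).encard = j + 1) := by
  have hF := hb.frontAngle_pos hbif hg
  have hπ := pi_pos
  obtain ⟨k, hk⟩ := sin_eq_zero_iff.1 ((hb.sin_frontAngle_eq_zero_iff hbif hg).2 hL)
  have hk0 : 0 < k := by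
    rw [← hk] at hF
    exact_mod_cast pos_of_mul_pos_left hF hπ.le
  -- At the level (j + 1)π, nearby angles below it give j eigenvalues and those above it j + 1.
  obtain ⟨j, rfl⟩ : ∃ j : ℕ, k = (j + 1 : ℕ) := ⟨k.toNat - 1, by omega⟩
  rw [Int.cast_natCast] at hk
  set S := orientation P um up (L g) (u g) with hS
  have hS0 : S ≠ 0 := hb.orientation_ne_zero hg (hbif g hg)
  -- The power of -1 comes from shifting the sine by (j + 1)π, so that s L' has the sign of the
  -- deviation of the angle from its level.
  refine ⟨j, hk.symm, (-1) ^ (j + 1) * S, mul_ne_zero (by simp) hS0, ?_⟩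
  have hc := hb.continuousAt_frontAngle hbif hg
  have hSc : ∀ᶠ g' in 𝓝 g, 0 < S * orientation P um up (L g') (u g') := by
    refine ((hb.continuousAt_orientation hg).const_mul S).eventually (lt_mem_nhds ?_)
    exact mul_self_pos.2 hS0
  have hlow : (j : ℝ) * π < frontAngle P (L g) (u g) := by
    rw [← hk]; push_cast; nlinarith
  have hupp : frontAngle P (L g) (u g) < (j + 2 : ℝ) * π := by
    rw [← hk]; push_cast; nlinarith
  filter_upwards [hb.eventually_mem hg, hSc, hc.eventually (lt_mem_nhds hlow),
    hc.eventually (gt_mem_nhds hupp)] with g' hg' hS' h1 h2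
  have hstep := hb.isStepCoeff hg' (hbif g' hg')
  obtain ⟨m, hm, e⟩ := hb.exists_sin_frontAngle_eq hbif hg'
  set F' := frontAngle P (L g') (u g')
  set S' := orientation P um up (L g') (u g')
  have hsin : sin (F' - (j + 1 : ℕ) * π) = (-1) ^ (j + 1) * sin F' := sin_sub_nat_mul_pi _ _
  have hprod : 0 < sin (F' - (j + 1 : ℕ) * π) * ((-1) ^ (j + 1) * S * deriv L g') ∨
      deriv L g' = 0 := by
    by_cases h0 : deriv L g' = 0
    · exact Or.inr h0
    · left
      have e2 : sin (F' - (j + 1 : ℕ) * π) * ((-1) ^ (j + 1) * S * deriv L g') =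
          m * (S * S') * deriv L g' ^ 2 := by
        rw [hsin, e]
        have : ((-1 : ℝ) ^ (j + 1)) * (-1) ^ (j + 1) = 1 := by
          rw [← mul_pow]; simp
        linear_combination (m * S * S' * deriv L g' ^ 2) * this
      rw [e2]
      positivity
  refine ⟨fun hneg => ?_, fun hpos => ?_⟩
  · have h3 := hprod.resolve_right (by rintro h; simp [h] at hneg)
    have h4 := (neg_iff_neg_of_mul_pos h3).2 hneg
    refine encard_positiveEigenvalues hstep h1 ?_
    by_contra! hcon
    refine absurd (sin_nonneg_of_nonneg_of_le_pi (x := F' - (j + 1 : ℕ) * π) ?_ ?_) (not_le.2 h4)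
    · push_cast; linarith
    · push_cast; linarith
  · have h3 := hprod.resolve_right (by rintro h; simp [h] at hpos)
    have h4 := (pos_iff_pos_of_mul_pos h3).2 hpos
    have := encard_positiveEigenvalues hstep (n := j + 1) ?_ ?_
    · simpa using this
    · by_contra! hcon
      refine absurd (sin_nonpos_of_nonpos_of_neg_pi_le (x := F' - (j + 1 : ℕ) * π) ?_ ?_)
        (not_le.2 h4)
      · push_cast; push_cast at hcon; linarith
      · push_cast; linarith
    · push_cast; linarith

end IsFrontBranch

theorem isStable_iff_encard {P : Potential} {α L : ℝ} {u : ℝ → ℝ} (hα : 0 ≤ α) :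
    IsStable P α L u ↔ (positiveEigenvalues P L u).encard = 0 := by
  rw [isStable_iff hα, encard_eq_zero]

end InhomWave

end

/-! ### The stability criterion -/

open InhomWave in
theorem theorem2 (P : Potential) (α : ℝ) (hα : 0 ≤ α) (um up : ℝ) (J : Set ℝ)
    (L : ℝ → ℝ) (u : ℝ → ℝ → ℝ) (hbranch : IsFrontBranch P um up J L u)
    (hbif : ∀ g ∈ J, bifLeft P (L g) (u g) ≠ 0 ∧ bifRight P (L g) (u g) ≠ 0)
    (hsimple : ∀ g ∈ J, ∀ x, deriv (u g) x = 0 → deriv (deriv (u g)) x ≠ 0)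
    (gh : ℝ) (hgh : gh ∈ J) (hord : ∃ n : ℕ, VanishesToOrder (deriv L) gh n) :
    (deriv L gh = 0 → ∃ Ψ, IsEigenfunction P (L gh) (u gh) 0 Ψ ∧
      ∀ Φ, IsEigenfunction P (L gh) (u gh) 0 Φ → ∃ c : ℝ, Φ = c • Ψ) ∧
    (ChangesAt (fun g => IsStable P α (L g) (u g)) gh ↔
      deriv L gh = 0 ∧
      (∃ n : ℕ, Odd n ∧ VanishesToOrder (deriv L) gh n) ∧
      (∃ Ψ, IsEigenfunction P (L gh) (u gh) 0 Ψ ∧ ∀ x, Ψ x ≠ 0)) ∧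
    (deriv L gh = 0 → (∃ n : ℕ, Odd n ∧ VanishesToOrder (deriv L) gh n) →
      ∃ N : ℕ,
        ((∀ᶠ g in nhdsWithin gh (Set.Iio gh),
            (positiveEigenvalues P (L g) (u g)).encard = N) ∧
          ∀ᶠ g in nhdsWithin gh (Set.Ioi gh),
            (positiveEigenvalues P (L g) (u g)).encard = N + 1) ∨
        ((∀ᶠ g in nhdsWithin gh (Set.Iio gh),
            (positiveEigenvalues P (L g) (u g)).encard = N + 1) ∧
          ∀ᶠ g in nhdsWithin gh (Set.Ioi gh),
            (positiveEigenvalues P (L g) (u g)).encard = N)) := by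
  have hstep := hbranch.isStepCoeff hgh (hbif gh hgh)
  have hstable : ∀ g, IsStable P α (L g) (u g) ↔
      (positiveEigenvalues P (L g) (u g)).encard = 0 := fun g => isStable_iff_encard hα
  have hcount : deriv L gh = 0 → (∃ n : ℕ, Odd n ∧ VanishesToOrder (deriv L) gh n) →
      ∃ N : ℕ, frontAngle P (L gh) (u gh) = (N + 1 : ℕ) * Real.pi ∧
        (((∀ᶠ g in 𝓝[<] gh, (positiveEigenvalues P (L g) (u g)).encard = N) ∧
          ∀ᶠ g in 𝓝[>] gh, (positiveEigenvalues P (L g) (u g)).encard = N + 1) ∨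
        ((∀ᶠ g in 𝓝[<] gh, (positiveEigenvalues P (L g) (u g)).encard = N + 1) ∧
          ∀ᶠ g in 𝓝[>] gh, (positiveEigenvalues P (L g) (u g)).encard = N)) := by
    rintro hL ⟨n, hn, hv⟩
    obtain ⟨j, hj, s, hs, hev⟩ := hbranch.exists_eventually_encard_eq_of_sign hbif hgh hL
    refine ⟨j, hj, ?_⟩
    have hl := hev.filter_mono (nhdsWithin_le_nhds (s := Set.Iio gh))
    have hr := hev.filter_mono (nhdsWithin_le_nhds (s := Set.Ioi gh))
    rcases hv.sign_of_odd hn hs with ⟨h1, h2⟩ | ⟨h1, h2⟩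
    · exact Or.inl ⟨(hl.and h1).mono fun g hg => hg.1.1 hg.2,
        (hr.and h2).mono fun g hg => hg.1.2 hg.2⟩
    · exact Or.inr ⟨(hl.and h1).mono fun g hg => hg.1.2 hg.2,
        (hr.and h2).mono fun g hg => hg.1.1 hg.2⟩
  refine ⟨fun hL => ?_, ⟨fun hch => ?_, ?_⟩, fun hL hodd => ?_⟩
  · obtain ⟨j, hj, -⟩ := hbranch.exists_eventually_encard_eq_of_sign hbif hgh hL
    obtain ⟨Ψ, h1, h2, -⟩ := exists_eigenfunction_zero hstep (by omega) hj
    exact ⟨Ψ, h1, h2⟩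
  · have hL : deriv L gh = 0 := by
      by_contra hL
      obtain ⟨N, hN⟩ := hbranch.exists_eventually_encard_eq hbif hgh hL
      refine not_changesAt (c := N = 0) ?_ hch
      filter_upwards [hN.filter_mono nhdsWithin_le_nhds] with g hg
      rw [hstable, hg]
      simp
    obtain ⟨j, hj, s, hs, hev⟩ := hbranch.exists_eventually_encard_eq_of_sign hbif hgh hL
    have hev' := hev.filter_mono (nhdsWithin_le_nhds (s := {gh}ᶜ))
    obtain ⟨n, hn⟩ := hord
    -- If the order is even, L' has the same sign on both sides, so the count is the same on both
    -- sides.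
    have hodd : Odd n := by
      by_contra hne
      rcases hn.sign_of_even (Nat.not_odd_iff_even.1 hne) hs with h | h
      · refine not_changesAt (c := False) ?_ hch
        filter_upwards [hev', h] with g hg hg'
        rw [hstable, hg.2 hg']
        simp
      · refine not_changesAt (c := j = 0) ?_ hch
        filter_upwards [hev', h] with g hg hg'
        rw [hstable, hg.1 hg']
        simp
    refine ⟨hL, ⟨n, hodd, hn⟩, ?_⟩
    obtain ⟨N, hN, hN'⟩ := hcount hL ⟨n, hodd, hn⟩
    obtain ⟨Ψ, h1, -, h3⟩ := exists_eigenfunction_zero hstep (by omega) hN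
    refine ⟨Ψ, h1, h3.2 ?_⟩
    -- If N ≥ 1, the fronts are unstable on both sides.
    by_contra hN0
    have hN0 : N ≠ 0 := by omega
    rcases hN' with ⟨hl, hr⟩ | ⟨hl, hr⟩
    · rcases hch with ⟨h4, -⟩ | ⟨-, h4⟩
      · obtain ⟨g, hg, hg'⟩ := (hl.and h4).exists
        rw [hstable, hg] at hg'
        simp [hN0] at hg'
      · obtain ⟨g, hg, hg'⟩ := (hr.and h4).exists
        rw [hstable, hg] at hg'
        simp at hg'
    · rcases hch with ⟨h4, -⟩ | ⟨-, h4⟩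
      · obtain ⟨g, hg, hg'⟩ := (hl.and h4).exists
        rw [hstable, hg] at hg'
        simp at hg'
      · obtain ⟨g, hg, hg'⟩ := (hr.and h4).exists
        rw [hstable, hg] at hg'
        simp [hN0] at hg'
  · rintro ⟨hL, hodd, Φ, hΦ, hΦ0⟩
    obtain ⟨N, hN, hN'⟩ := hcount hL hodd
    obtain ⟨Ψ, h1, h2, h3⟩ := exists_eigenfunction_zero hstep (by omega) hN
    obtain ⟨c, rfl⟩ := h2 Φ hΦ
    -- By simplicity the given eigenfunction without zeros is a multiple of Ψ, so Ψ has no zeros and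
    -- N + 1 = 1.
    have hN0 : N = 0 := by
      have := h3.1 fun x hx => hΦ0 x (by simp [hx])
      omega
    subst hN0
    rcases hN' with ⟨hl, hr⟩ | ⟨hl, hr⟩
    · refine Or.inl ⟨hl.mono fun g hg => ?_, hr.mono fun g hg => ?_⟩ <;> simp [hstable, hg]
    · refine Or.inr ⟨hl.mono fun g hg => ?_, hr.mono fun g hg => ?_⟩ <;> simp [hstable, hg]
  · obtain ⟨N, -, hN⟩ := hcount hL hodd
    exact ⟨N, hN⟩
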